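/- **Definitions.** A *semimultiplicative set* is a set $T$ with a partially defined multiplication such that $(st)u$ is defined if and only if $s(tu)$ is, and then both agree. For an index set $k$, a *$k$-semigraph* is a semimultiplicative set $T$ with a map $d:T\to\mathbb N_0^k$ such that $d(xy)=d(x)+d(y)$ whenever $xy$ is defined, and such that whenever $d(x)=n_1+n_2$ there are unique $x_1,x_2\in T$ with $x=x_1x_2$, $d(x_1)=n_1$, $d(x_2)=n_2$. Put $T^{(\min)}(x,y)=\{(\alpha,\beta)\in T\times T : x\alpha=y\beta \text{ are defined},\ d(x\alpha)=d(x)\vee d(y)\}$; $T$ is *finitely aligned* if these sets are finite. Write $s\le t$ if $\alpha s=t$ for some $\alpha\in T$. In a $*$-algebra put $P_a=aa^*$, $Q_a=a^*a$; projections are ordered by $p\le q\Leftrightarrow pq=p$, and $p<q$ means $p\le q$, $p\ne q$. Algebras need not have a unit; a unit $1$ is adjoined where needed. A *$k$-semigraph algebra* is a $*$-algebra $X$ generated by disjoint subsets $\mathcal P,\mathcal T$ with a degree map $d$ on $\mathcal T$ such that: (i) $\mathcal P$ consists of commuting projections and is closed under products; (ii) $\mathcal T$ consists of nonzero partial isometries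 and is closed under nonzero products; (iii) $\mathcal T_1=\mathcal T\sqcup\{1\}$, with $d(1)=0$ and the nonzero products of $X$ as the defined products within $\mathcal T$, is a finitely aligned $k$-semigraph; (iv) for $x\in\mathcal T$, $p\in\mathcal P$ there is $q\in\mathcal P$ with $px=xq$; (v) for $x,y\in\mathcal T$ there are $q_{\alpha,\beta}\in\mathcal P$ with $x^*y=\sum_{(\alpha,\beta)\in\mathcal T_1^{(\min)}(x,y)}\alpha q_{\alpha,\beta}\beta^*$; (vi) the kernel of the canonical map onto $X$ from the free $*$-algebra on $\mathcal P\cup\mathcal T$ is generated, as a self-adjoint two-sided ideal, by a set of elements each of which is a linear combination of words of one and the same degree. Here a word is a product of letters $a,a^*$ with $a\in\mathcal P\cup\mathcal T$, and its degree in $\mathbb Z^k$ is the sum of the degrees of its letters, with $d(p)=0$ for $p\in\mathcal P$ and $d(a^*)=-d(a)$. *Half-standard words* are the elements $sp$, *standard words* the elements $spt^*$ (of degree $d(s)-d(t)$), with $s,t\in\mathcal T_1$, $p\in\mathcal P$. *Standard projections* are the elements $P_x(1-P_{y_1})\cdots(1-P_{y_m})$ with $m\ge0$ and half-standard words $x,y_i$.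 The *core* is the linear span of all words of degree $0$. $X$ is * *free* if (a) $P_a\notin\mathcal P$ for every half-standard word $a\notin\mathcal P$, and (b) whenever $n\ge1$, $p\in\mathcal P$ and $a_1,\dots,a_n$ are half-standard words with $P_{a_i}<p$ for all $i$, then $\bigvee_i P_{a_i}<p$; * *weakly free* if for all $i\in k$, all nonzero standard projections $p$ formed from $\mathcal P$ and $\{t\in\mathcal T: d(t)_i=0\}$, and all finite sets $\mathcal B$ of elements of $\mathcal T$ of degree $e_i$ (the $i$-th unit vector), the inequality $p\le\sum_{b\in\mathcal B}P_b$ fails; * *cancelling* if for every standard word $w=spt^*$ with $d(s)\ne d(t)$ and every nonzero standard projection $e$ there is a nonzero standard projection $f\le e$ with $fwf=0$. Let $T$ be a finitely aligned $k$-semigraph in which every element $e$ of degree $0$ is idempotent ($ee$ is defined and equals $e$). The *freely generated semigraph algebra* $X$ of $T$ is the universal complex $*$-algebra generated by $T$ subject to: each $t\in T$ is a partial isometry; each $t$ with $d(t)=0$ is a projection; $xy=z$ in $X$ if $xy=z$ in $T$; $xy=0$ if $xy$ is undefined in $T$; $Q_xQ_y=Q_yQ_x$; and $x^*y=\sum_{(e,f)\in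 T^{(\min)}(x,y)}eQ_{yf}f^*$ for all $x,y\in T$. Let $\mathcal Q(T)=C^*(X)$ be the universal $C^*$-algebra of $X$, with universal representation $\pi:X\to\mathcal Q(T)$. Let $\Delta_\mu$ be the set of formal symbols $y\mu_{\alpha_1,\dots,\alpha_n}$ with $n\ge1$, $y,\alpha_i\in T$ and $y\le\alpha_i$ for some $i$, and let $\Delta=T\sqcup\Delta_\mu$. It is a semimultiplicative set with left cancellation under the product of $T$ together with $x(y\mu_\alpha)=(xy)\mu_\alpha$ whenever $x\in T$, $xy$ is defined and $(xy)\mu_\alpha\in\Delta_\mu$ (no other products being defined). For $s\in\Delta$ let $\lambda_s\in B(\ell^2(\Delta))$ be given by $\lambda_s\delta_t=\delta_{st}$ if $st$ is defined and $\lambda_s\delta_t=0$ otherwise; $C^*_r(\Delta)$ is the $C^*$-subalgebra of $B(\ell^2(\Delta))$ generated by $\{\lambda_s : s\in\Delta\}$. **Theorem.** With $T$ and $X$ as above: 1. The canonical map $T\to X$ is injective, and $X$ is a $k$-semigraph algebra with $\mathcal P=\{Q_{t_1}\cdots Q_{t_n}: n\ge1,\ t_i\in T\}\cup\{0\}$ and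 $\mathcal T=\{t\in T: d(t)\ne0\}$. It is free, weakly free and cancelling. 2. $X$ satisfies the Cuntz–Krieger uniqueness theorem: $\pi$ is injective on the core and non-vanishing on nonzero standard projections, and for every representation $\psi:X\to A$ in a $C^*$-algebra with dense image which is non-vanishing on nonzero standard projections there is a $*$-isomorphism $\Phi:\mathcal Q(T)\to A$ with $\Phi\circ\pi=\psi$. 3. There is a representation $\varphi:X\to C^*_r(\Delta)$ with $\varphi(t)=\lambda_t$ for all $t\in T$. It has dense image, is non-vanishing on nonzero standard projections and injective on the core, and is a universal $C^*$-representation of $X$ (every representation of $X$ in a $C^*$-algebra factors uniquely through $\varphi$, as it does through $\pi$). There is a $*$-isomorphism $\Phi:\mathcal Q(T)\to C^*_r(\Delta)$ with $\Phi\circ\pi=\varphi$. -/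

import Mathlib

universe u v w

noncomputable section

namespace SemigraphCStar

open scoped Classical ENNReal

/-! ### Universal (non-unital) complex star-algebras given by generators and relations -/

/-- Formal star-polynomial expressions without constant term in a set `G` of generators. -/
inductive StarTerm (G : Type u) : Type u
  | gen : G → StarTerm G
  | zero : StarTerm G
  | add : StarTerm G → StarTerm G → StarTerm G
  | neg : StarTerm G → StarTerm G
  | smul : ℂ → StarTerm G → StarTerm G
  | mul : StarTerm G → StarTerm G → StarTerm G
  | adj : StarTerm G → StarTerm G

/-- Finite sums of expressions. -/
def StarTerm.sum {G : Type u} : List (StarTerm G) → StarTerm G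
  | [] => .zero
  | a :: l => .add a (StarTerm.sum l)

/-- The smallest congruence which contains the relations `r` and all identities that hold in every
(associative, not necessarily unital) star-algebra over `ℂ`. -/
inductive StarRel {G : Type u} (r : StarTerm G → StarTerm G → Prop) :
    StarTerm G → StarTerm G → Prop
  | of {a b} : r a b → StarRel r a b
  | refl (a) : StarRel r a a
  | symm {a b} : StarRel r a b → StarRel r b a
  | trans {a b c} : StarRel r a b → StarRel r b c → StarRel r a c
  | add_congr {a a' b b'} : StarRel r a a' → StarRel r b b' → StarRel r (.add a b) (.add a' b')
  | neg_congr {a a'} : StarRel r a a' → StarRel r (.neg a) (.neg a')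
  | smul_congr (z : ℂ) {a a'} : StarRel r a a' → StarRel r (.smul z a) (.smul z a')
  | mul_congr {a a' b b'} : StarRel r a a' → StarRel r b b' → StarRel r (.mul a b) (.mul a' b')
  | adj_congr {a a'} : StarRel r a a' → StarRel r (.adj a) (.adj a')
  | add_assoc (a b c) : StarRel r (.add (.add a b) c) (.add a (.add b c))
  | add_comm (a b) : StarRel r (.add a b) (.add b a)
  | zero_add (a) : StarRel r (.add .zero a) a
  | neg_add (a) : StarRel r (.add (.neg a) a) .zero
  | mul_assoc (a b c) : StarRel r (.mul (.mul a b) c) (.mul a (.mul b c))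
  | left_distrib (a b c) : StarRel r (.mul a (.add b c)) (.add (.mul a b) (.mul a c))
  | right_distrib (a b c) : StarRel r (.mul (.add a b) c) (.add (.mul a c) (.mul b c))
  | zero_mul (a) : StarRel r (.mul .zero a) .zero
  | mul_zero (a) : StarRel r (.mul a .zero) .zero
  | one_smul (a) : StarRel r (.smul 1 a) a
  | mul_smul (z z' : ℂ) (a) : StarRel r (.smul (z * z') a) (.smul z (.smul z' a))
  | smul_add (z : ℂ) (a b) : StarRel r (.smul z (.add a b)) (.add (.smul z a) (.smul z b))
  | add_smul (z z' : ℂ) (a) : StarRel r (.smul (z + z') a) (.add (.smul z a) (.smul z' a))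
  | zero_smul (a) : StarRel r (.smul 0 a) .zero
  | smul_zero (z : ℂ) : StarRel r (.smul z .zero) .zero
  | smul_mul (z : ℂ) (a b) : StarRel r (.mul (.smul z a) b) (.smul z (.mul a b))
  | mul_smul_comm (z : ℂ) (a b) : StarRel r (.mul a (.smul z b)) (.smul z (.mul a b))
  | adj_adj (a) : StarRel r (.adj (.adj a)) a
  | adj_add (a b) : StarRel r (.adj (.add a b)) (.add (.adj a) (.adj b))
  | adj_mul (a b) : StarRel r (.adj (.mul a b)) (.mul (.adj b) (.adj a))
  | adj_smul (z : ℂ) (a) : StarRel r (.adj (.smul z a)) (.smul (star z) (.adj a))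

/-- The setoid of `StarRel r`. -/
def starSetoid {G : Type u} (r : StarTerm G → StarTerm G → Prop) : Setoid (StarTerm G) where
  r := StarRel r
  iseqv := ⟨.refl, .symm, .trans⟩

/-- The universal star-algebra over `ℂ` generated by the set `G` subject to the relations `r`. -/
def PresentedStarAlgebra {G : Type u} (r : StarTerm G → StarTerm G → Prop) : Type u :=
  Quotient (starSetoid r)

namespace PresentedStarAlgebra

variable {G : Type u} (r : StarTerm G → StarTerm G → Prop)

/-- The class of an expression. -/
def mk (a : StarTerm G) : PresentedStarAlgebra r := Quotient.mk (starSetoid r) a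

/-- The image of a generator. -/
def of (g : G) : PresentedStarAlgebra r := mk r (.gen g)

variable {r}

theorem mk_eq {a b : StarTerm G} (h : StarRel r a b) : mk r a = mk r b := Quotient.sound h

theorem ind {p : PresentedStarAlgebra r → Prop} (h : ∀ a, p (mk r a)) (x) : p x :=
  Quotient.ind h x

instance : Zero (PresentedStarAlgebra r) := ⟨mk r .zero⟩
instance : Add (PresentedStarAlgebra r) :=
  ⟨Quotient.map₂ .add fun _ _ h _ _ h' => StarRel.add_congr h h'⟩
instance : Neg (PresentedStarAlgebra r) := ⟨Quotient.map .neg fun _ _ h => StarRel.neg_congr h⟩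
instance : Mul (PresentedStarAlgebra r) :=
  ⟨Quotient.map₂ .mul fun _ _ h _ _ h' => StarRel.mul_congr h h'⟩
instance : SMul ℂ (PresentedStarAlgebra r) :=
  ⟨fun z => Quotient.map (.smul z) fun _ _ h => StarRel.smul_congr z h⟩
instance : Star (PresentedStarAlgebra r) := ⟨Quotient.map .adj fun _ _ h => StarRel.adj_congr h⟩

theorem mk_zero : mk r .zero = 0 := rfl
theorem mk_add (a b : StarTerm G) : mk r (.add a b) = mk r a + mk r b := rfl
theorem mk_neg (a : StarTerm G) : mk r (.neg a) = -mk r a := rfl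
theorem mk_mul (a b : StarTerm G) : mk r (.mul a b) = mk r a * mk r b := rfl
theorem mk_smul (z : ℂ) (a : StarTerm G) : mk r (.smul z a) = z • mk r a := rfl
theorem mk_adj (a : StarTerm G) : mk r (.adj a) = star (mk r a) := rfl

theorem add_comm' (x y : PresentedStarAlgebra r) : x + y = y + x := by
  induction x using ind with | _ a
  induction y using ind with | _ b
  exact mk_eq (.add_comm a b)

theorem zero_add' (x : PresentedStarAlgebra r) : 0 + x = x := by
  induction x using ind with | _ a
  exact mk_eq (.zero_add a)

instance : NonUnitalRing (PresentedStarAlgebra r) where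
  add_assoc x y z := by
    induction x using ind with | _ a
    induction y using ind with | _ b
    induction z using ind with | _ c
    exact mk_eq (.add_assoc a b c)
  zero_add := zero_add'
  add_zero x := by rw [add_comm', zero_add']
  add_comm := add_comm'
  neg_add_cancel x := by
    induction x using ind with | _ a
    exact mk_eq (.neg_add a)
  mul_assoc x y z := by
    induction x using ind with | _ a
    induction y using ind with | _ b
    induction z using ind with | _ c
    exact mk_eq (.mul_assoc a b c)
  left_distrib x y z := by
    induction x using ind with | _ a
    induction y using ind with | _ b
    induction z using ind with | _ c
    exact mk_eq (.left_distrib a b c)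
  right_distrib x y z := by
    induction x using ind with | _ a
    induction y using ind with | _ b
    induction z using ind with | _ c
    exact mk_eq (.right_distrib a b c)
  zero_mul x := by
    induction x using ind with | _ a
    exact mk_eq (.zero_mul a)
  mul_zero x := by
    induction x using ind with | _ a
    exact mk_eq (.mul_zero a)
  nsmul := nsmulRec
  zsmul := zsmulRec

instance : Module ℂ (PresentedStarAlgebra r) where
  one_smul x := by
    induction x using ind with | _ a
    exact mk_eq (.one_smul a)
  mul_smul z z' x := by
    induction x using ind with | _ a
    exact mk_eq (.mul_smul z z' a)
  smul_add z x y := by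
    induction x using ind with | _ a
    induction y using ind with | _ b
    exact mk_eq (.smul_add z a b)
  add_smul z z' x := by
    induction x using ind with | _ a
    exact mk_eq (.add_smul z z' a)
  zero_smul x := by
    induction x using ind with | _ a
    exact mk_eq (.zero_smul a)
  smul_zero z := mk_eq (.smul_zero z)

instance : IsScalarTower ℂ (PresentedStarAlgebra r) (PresentedStarAlgebra r) where
  smul_assoc z x y := by
    induction x using ind with | _ a
    induction y using ind with | _ b
    exact mk_eq (.smul_mul z a b)

instance : SMulCommClass ℂ (PresentedStarAlgebra r) (PresentedStarAlgebra r) where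
  smul_comm z x y := by
    induction x using ind with | _ a
    induction y using ind with | _ b
    exact (mk_eq (.mul_smul_comm z a b)).symm

instance : StarRing (PresentedStarAlgebra r) where
  star_involutive x := by
    induction x using ind with | _ a
    exact mk_eq (.adj_adj a)
  star_mul x y := by
    induction x using ind with | _ a
    induction y using ind with | _ b
    exact mk_eq (.adj_mul a b)
  star_add x y := by
    induction x using ind with | _ a
    induction y using ind with | _ b
    exact mk_eq (.adj_add a b)

instance : StarModule ℂ (PresentedStarAlgebra r) where
  star_smul z x := by
    induction x using ind with | _ a
    exact mk_eq (.adj_smul z a)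

end PresentedStarAlgebra

section Eval

variable {G : Type u} {A : Type v} [NonUnitalRing A] [StarRing A] [Module ℂ A]

/-- The value of an expression in a star-algebra. -/
def StarTerm.eval (f : G → A) : StarTerm G → A
  | .gen g => f g
  | .zero => 0
  | .add a b => a.eval f + b.eval f
  | .neg a => -a.eval f
  | .smul z a => z • a.eval f
  | .mul a b => a.eval f * b.eval f
  | .adj a => star (a.eval f)

variable [IsScalarTower ℂ A A] [SMulCommClass ℂ A A] [StarModule ℂ A]

theorem StarRel.eval_eq {r : StarTerm G → StarTerm G → Prop} (f : G → A)
    (hf : ∀ a b, r a b → a.eval f = b.eval f) {a b : StarTerm G} (h : StarRel r a b) :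
    a.eval f = b.eval f := by
  induction h with
  | of h => exact hf _ _ h
  | refl => rfl
  | symm _ ih => exact ih.symm
  | trans _ _ ih ih' => exact ih.trans ih'
  | add_congr _ _ ih ih' => simp [StarTerm.eval, ih, ih']
  | neg_congr _ ih => simp [StarTerm.eval, ih]
  | smul_congr _ _ ih => simp [StarTerm.eval, ih]
  | mul_congr _ _ ih ih' => simp [StarTerm.eval, ih, ih']
  | adj_congr _ ih => simp [StarTerm.eval, ih]
  | add_comm => simp [StarTerm.eval, _root_.add_comm]
  | add_assoc => simp [StarTerm.eval, _root_.add_assoc]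
  | mul_assoc => simp [StarTerm.eval, _root_.mul_assoc]
  | left_distrib => simp [StarTerm.eval, mul_add]
  | right_distrib => simp [StarTerm.eval, add_mul]
  | mul_smul => simp [StarTerm.eval, SemigroupAction.mul_smul]
  | add_smul => simp [StarTerm.eval, _root_.add_smul]
  | smul_mul => simp [StarTerm.eval, smul_mul_assoc]
  | mul_smul_comm => simp [StarTerm.eval, _root_.mul_smul_comm]
  | _ => simp [StarTerm.eval]

/-- The homomorphism given by the universal property. -/
def PresentedStarAlgebra.lift {r : StarTerm G → StarTerm G → Prop} (f : G → A)
    (hf : ∀ a b, r a b → a.eval f = b.eval f) : PresentedStarAlgebra r →⋆ₙₐ[ℂ] A where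
  toFun := Quotient.lift (StarTerm.eval f) fun _ _ h => StarRel.eval_eq f hf h
  map_smul' z x := by
    induction x using PresentedStarAlgebra.ind with | _ a
    rfl
  map_zero' := rfl
  map_add' x y := by
    induction x using PresentedStarAlgebra.ind with | _ a
    induction y using PresentedStarAlgebra.ind with | _ b
    rfl
  map_mul' x y := by
    induction x using PresentedStarAlgebra.ind with | _ a
    induction y using PresentedStarAlgebra.ind with | _ b
    rfl
  map_star' x := by
    induction x using PresentedStarAlgebra.ind with | _ a
    rfl

end Eval

/-- The free (non-unital) star-algebra over `ℂ` generated by `G`. -/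
abbrev FreeStarAlgebra (G : Type u) : Type u :=
  PresentedStarAlgebra (fun _ _ : StarTerm G => False)

/-- The canonical homomorphism from the free star-algebra. -/
def FreeStarAlgebra.lift {G : Type u} {A : Type v} [NonUnitalRing A] [StarRing A] [Module ℂ A]
    [IsScalarTower ℂ A A] [SMulCommClass ℂ A A] [StarModule ℂ A] (f : G → A) :
    FreeStarAlgebra G →⋆ₙₐ[ℂ] A :=
  PresentedStarAlgebra.lift f fun _ _ h => h.elim

/-! ### Semimultiplicative sets and higher rank semigraphs -/

/-- A set with a partially defined associative multiplication; `mul s t = none` means that the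
product of `s` and `t` is undefined. -/
structure SemimultiplicativeSet (T : Type u) where
  mul : T → T → Option T
  assoc : ∀ s t u, (mul s t).bind (fun a => mul a u) = (mul t u).bind (fun b => mul s b)

/-- A `k`-semigraph, for an arbitrary index set `k`. -/
structure Semigraph (k : Type v) (T : Type u) extends SemimultiplicativeSet T where
  d : T → k → ℕ
  d_mul : ∀ x y z, mul x y = some z → d z = d x + d y
  factor : ∀ (x : T) (n₁ n₂ : k → ℕ), d x = n₁ + n₂ →
    ∃! p : T × T, mul p.1 p.2 = some x ∧ d p.1 = n₁ ∧ d p.2 = n₂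

/-- The minimal common extensions of `x` and `y`. -/
def minCommonExt {k : Type v} {T : Type u} (mul : T → T → Option T) (d : T → k → ℕ) (x y : T) :
    Set (T × T) :=
  {p | ∃ z, mul x p.1 = some z ∧ mul y p.2 = some z ∧ d z = d x ⊔ d y}

/-- `s ≤ t` if `α s = t` for some `α`. -/
def SemimultiplicativeSet.le {T : Type u} (S : SemimultiplicativeSet T) (s t : T) : Prop :=
  ∃ α, S.mul α s = some t

/-- Left cancellation. -/
def SemimultiplicativeSet.LeftCancellative {T : Type u} (S : SemimultiplicativeSet T) : Prop :=
  ∀ s t₁ t₂ z, S.mul s t₁ = some z → S.mul s t₂ = some z → t₁ = t₂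

/-- Finite alignment: all sets of minimal common extensions are finite. -/
def Semigraph.FinitelyAligned {k : Type v} {T : Type u} (S : Semigraph k T) : Prop :=
  ∀ x y, (minCommonExt S.mul S.d x y).Finite

/-! ### Semigraph algebras -/

section StarAlgebra

variable {X : Type u} [NonUnitalRing X] [StarRing X]

/-- The range projection `P_a`. -/
def rangeProj (a : X) : X := a * star a

/-- The source projection `Q_a`. -/
def sourceProj (a : X) : X := star a * a

/-- The order `p ≤ q` on projections. -/
def ProjLE (p q : X) : Prop := p * q = p

/-- The strict order `p < q` on projections. -/
def ProjLT (p q : X) : Prop := ProjLE p q ∧ p ≠ q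

/-- The supremum of finitely many commuting projections. -/
def projSup : List X → X
  | [] => 0
  | p :: l => p + projSup l - p * projSup l

/-- `IsWord g δ n a`: the element `a` is a word of degree `n` in the letters `g i` and `(g i)*`,
where the letter `g i` has degree `δ i` and the letter `(g i)*` has degree `-δ i`. -/
inductive IsWord {k : Type v} {I : Type w} (g : I → X) (δ : I → k → ℤ) : (k → ℤ) → X → Prop
  | letter (i : I) : IsWord g δ (δ i) (g i)
  | letter_star (i : I) : IsWord g δ (-δ i) (star (g i))
  | mul {m n a b} : IsWord g δ m a → IsWord g δ n b → IsWord g δ (m + n) (a * b)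

variable [Module ℂ X]

/-- The two-sided self-adjoint ideal generated by a set. -/
def starIdeal (R : Set X) : Set X :=
  {a | ∀ I : Submodule ℂ X, R ⊆ I → (∀ x, ∀ y ∈ I, x * y ∈ I ∧ y * x ∈ I ∧ star y ∈ I) → a ∈ I}

end StarAlgebra

/-- Two subsets `P` and `T` of a star-algebra, with a degree map on `T`. -/
structure GeneratingPair (k : Type v) (X : Type u) where
  P : Set X
  T : Set X
  d : T → k → ℕ

namespace GeneratingPair

variable {k : Type v} {X : Type u} [NonUnitalRing X] [StarRing X] [Module ℂ X]

/-- The multiplication on `T₁ = T ⊔ {1}`. Here and below the elements of `T₁` are those of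
`Option D.T`, and `none` is the adjoined unit `1`. Two elements of `T` can be composed if their
product in `X` is in `T`. -/
def mul₁ (D : GeneratingPair k X) : Option D.T → Option D.T → Option (Option D.T)
  | none, y => some y
  | some x, none => some (some x)
  | some x, some y => if h : (x : X) * y ∈ D.T then some (some ⟨_, h⟩) else none

/-- The degree map on `T₁`. -/
def d₁ (D : GeneratingPair k X) : Option D.T → k → ℕ
  | none => 0
  | some t => D.d t

/-- The elements of `T₁` as multipliers of `X`, that is, in `X` with a unit adjoined. -/
def val₁ (D : GeneratingPair k X) : Option D.T → Unitization ℂ X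
  | none => 1
  | some t => ((t : X) : Unitization ℂ X)

/-- The letters: the elements of `P` and of `T`. -/
def letter (D : GeneratingPair k X) : D.P ⊕ D.T → X := Sum.elim (fun p => p) (fun t => t)

/-- The degrees of the letters. -/
def letterDeg (D : GeneratingPair k X) : D.P ⊕ D.T → k → ℤ :=
  Sum.elim (fun _ => 0) (fun t i => (D.d t i : ℤ))

/-- The fiber space of the free star-algebra on `P ∪ T`. -/
def fiberSpace (D : GeneratingPair k X) : Set (FreeStarAlgebra (D.P ⊕ D.T)) :=
  {a | ∃ n : k → ℤ,
    a ∈ Submodule.span ℂ {w | IsWord (PresentedStarAlgebra.of _) D.letterDeg n w}}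

/-- The core: the linear span of all words of degree zero. -/
def core (D : GeneratingPair k X) : Submodule ℂ X :=
  Submodule.span ℂ {w | IsWord D.letter D.letterDeg 0 w}

variable [IsScalarTower ℂ X X] [SMulCommClass ℂ X X]

/-- Half-standard words `s p`, with `s ∈ T₁` and `p ∈ P`. -/
def halfStandard (D : GeneratingPair k X) : Set X :=
  {a | ∃ s : Option D.T, ∃ p ∈ D.P, (a : Unitization ℂ X) = D.val₁ s * (p : Unitization ℂ X)}

/-- Standard projections `P_x (1 - P_{y₁}) ⋯ (1 - P_{yₘ})`, with half-standard words `x`, `yᵢ`. -/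
def standardProj (D : GeneratingPair k X) : Set X :=
  {p | ∃ x ∈ D.halfStandard, ∃ l : List X, (∀ y ∈ l, y ∈ D.halfStandard) ∧
    (p : Unitization ℂ X) = (rangeProj x : X) *
      (l.map fun y => 1 - ((rangeProj y : X) : Unitization ℂ X)).prod}

/-- `X`, with the sets `P` and `T` and the degree map on `T`, is a `k`-semigraph algebra. -/
structure IsSemigraphAlgebra [StarModule ℂ X] (D : GeneratingPair k X) : Prop where
  disjoint : Disjoint D.P D.T
  generates : NonUnitalStarAlgebra.adjoin ℂ (D.P ∪ D.T) = ⊤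
  proj : ∀ p ∈ D.P, IsStarProjection p
  proj_comm : ∀ p ∈ D.P, ∀ q ∈ D.P, p * q = q * p
  proj_mul : ∀ p ∈ D.P, ∀ q ∈ D.P, p * q ∈ D.P
  ne_zero : ∀ t ∈ D.T, t ≠ 0
  partialIsometry : ∀ t ∈ D.T, t * star t * t = t
  mul_mem : ∀ s ∈ D.T, ∀ t ∈ D.T, s * t ≠ 0 → s * t ∈ D.T
  semigraph : ∃ S : Semigraph k (Option D.T),
    S.mul = D.mul₁ ∧ S.d = D.d₁ ∧ S.FinitelyAligned
  exchange : ∀ x ∈ D.T, ∀ p ∈ D.P, ∃ q ∈ D.P, p * x = x * q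
  expansion : ∀ x y : D.T, ∃ q : Option D.T × Option D.T → X,
    (∀ c ∈ minCommonExt D.mul₁ D.d₁ (some x) (some y), q c ∈ D.P) ∧
    ((star (x : X) * y : X) : Unitization ℂ X) =
      ∑ᶠ c ∈ minCommonExt D.mul₁ D.d₁ (some x) (some y),
        D.val₁ c.1 * (q c : Unitization ℂ X) * star (D.val₁ c.2)
  fiber : ∃ R ⊆ D.fiberSpace, ∀ a, FreeStarAlgebra.lift D.letter a = 0 ↔ a ∈ starIdeal R

/-- Freeness. -/
def IsFree (D : GeneratingPair k X) : Prop :=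
  (∀ a ∈ D.halfStandard, a ∉ D.P → rangeProj a ∉ D.P) ∧
  ∀ p ∈ D.P, ∀ l : List X, l ≠ [] →
    (∀ a ∈ l, a ∈ D.halfStandard ∧ ProjLT (rangeProj a) p) → ProjLT (projSup (l.map rangeProj)) p

/-- The sets `P` and `{t ∈ T | d(t)ᵢ = 0}`, which generate the subalgebra attached to the
coordinate `i`. -/
def remove (D : GeneratingPair k X) (i : k) : GeneratingPair k X where
  P := D.P
  T := {t | ∃ h : t ∈ D.T, D.d ⟨t, h⟩ i = 0}
  d t := D.d ⟨t, t.2.choose⟩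

/-- Weak freeness. -/
def IsWeaklyFree (D : GeneratingPair k X) : Prop :=
  ∀ i : k, ∀ p ∈ (D.remove i).standardProj, p ≠ 0 →
    ∀ B : Finset X, (∀ b ∈ B, ∃ h : b ∈ D.T, D.d ⟨b, h⟩ = Pi.single i 1) →
      ¬ ProjLE p (∑ b ∈ B, rangeProj b)

/-- The cancelling condition. -/
def IsCancelling (D : GeneratingPair k X) : Prop :=
  ∀ (s t : Option D.T), D.d₁ s ≠ D.d₁ t → ∀ p ∈ D.P, ∀ w : X,
    (w : Unitization ℂ X) = D.val₁ s * (p : Unitization ℂ X) * star (D.val₁ t) →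
      ∀ e ∈ D.standardProj, e ≠ 0 →
        ∃ f ∈ D.standardProj, f ≠ 0 ∧ ProjLE f e ∧ f * w * f = 0

end GeneratingPair

/-! ### Representations in C⋆-algebras -/

section Representations

variable {X : Type u} [NonUnitalRing X] [StarRing X] [Module ℂ X]

/-- A representation of `X` in a C⋆-algebra. -/
structure CStarRep (X : Type u) [NonUnitalRing X] [StarRing X] [Module ℂ X] : Type (u + 1) where
  alg : Type u
  [inst : NonUnitalCStarAlgebra alg]
  hom : X →⋆ₙₐ[ℂ] alg

instance (ρ : CStarRep X) : NonUnitalCStarAlgebra ρ.alg := ρ.inst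

/-- The norms of each element of `X` in all representations are bounded. -/
def CStarBounded (X : Type u) [NonUnitalRing X] [StarRing X] [Module ℂ X] : Prop :=
  ∀ x : X, ∃ C : ℝ, ∀ ρ : CStarRep X, ‖ρ.hom x‖ ≤ C

/-- The direct product of all representations of `X`. -/
def productRep (hX : CStarBounded X) :
    X →⋆ₙₐ[ℂ] lp (fun ρ : CStarRep X => ρ.alg) ∞ where
  toFun x := ⟨fun ρ => ρ.hom x, memℓp_infty (by
    obtain ⟨C, hC⟩ := hX x
    exact ⟨C, by rintro _ ⟨ρ, rfl⟩; exact hC ρ⟩)⟩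
  map_smul' z x := by ext ρ; exact map_smul ρ.hom z x
  map_zero' := by ext ρ; exact map_zero ρ.hom
  map_add' x y := by ext ρ; exact map_add ρ.hom x y
  map_mul' x y := by ext ρ; exact map_mul ρ.hom x y
  map_star' x := by ext ρ; exact map_star ρ.hom x

/-- The closed star-subalgebra generated by a set, in a C⋆-algebra. -/
def cstarClosure {A : Type u} [NonUnitalCStarAlgebra A] (s : Set A) :
    NonUnitalStarSubalgebra ℂ A :=
  (NonUnitalStarAlgebra.adjoin ℂ s).topologicalClosure

instance {A : Type u} [NonUnitalCStarAlgebra A] (s : Set A) :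
    IsClosed (cstarClosure s : Set A) :=
  NonUnitalStarSubalgebra.isClosed_topologicalClosure _

theorem subset_cstarClosure {A : Type u} [NonUnitalCStarAlgebra A] (s : Set A) :
    s ⊆ cstarClosure s := fun _ h =>
  NonUnitalStarSubalgebra.le_topologicalClosure _ (NonUnitalStarAlgebra.subset_adjoin ℂ s h)

/-- The universal (enveloping) C⋆-algebra `C*(X)`: the closure of the image of `X` in the product
of all representations of `X` in C⋆-algebras. -/
def UniversalCStar (hX : CStarBounded X) : Type (u + 1) :=
  cstarClosure (Set.range (productRep hX))

instance (hX : CStarBounded X) : NonUnitalCStarAlgebra (UniversalCStar hX) :=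
  inferInstanceAs (NonUnitalCStarAlgebra (cstarClosure (Set.range (productRep hX))))

/-- The universal representation of `X` in `C*(X)`. -/
def universalRep (hX : CStarBounded X) : X →⋆ₙₐ[ℂ] UniversalCStar hX :=
  NonUnitalStarAlgHom.codRestrict (productRep hX) (cstarClosure (Set.range (productRep hX)))
    fun x => subset_cstarClosure _ ⟨x, rfl⟩

/-- `π` is a universal representation of `X`: every representation of `X` in a C⋆-algebra factors
uniquely through `π`. -/
def IsUniversalRep {C : Type v} [NonUnitalCStarAlgebra C] (π : X →⋆ₙₐ[ℂ] C) : Prop :=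
  ∀ (A : Type w) [NonUnitalCStarAlgebra A] (ψ : X →⋆ₙₐ[ℂ] A),
    ∃! Φ : C →⋆ₙₐ[ℂ] A, ∀ x, Φ (π x) = ψ x

end Representations

section CuntzKrieger

variable {k : Type w} {X : Type u} [NonUnitalRing X] [StarRing X] [Module ℂ X]

/-- Injectivity on the core. -/
def InjectiveOnCore (D : GeneratingPair k X) {A : Type v} [NonUnitalCStarAlgebra A]
    (ψ : X →⋆ₙₐ[ℂ] A) : Prop :=
  Set.InjOn ψ D.core

variable [IsScalarTower ℂ X X] [SMulCommClass ℂ X X]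

/-- `ψ` does not vanish on nonzero standard projections. -/
def NonVanishing (D : GeneratingPair k X) {A : Type v} [NonUnitalCStarAlgebra A]
    (ψ : X →⋆ₙₐ[ℂ] A) : Prop :=
  ∀ p ∈ D.standardProj, p ≠ 0 → ψ p ≠ 0

/-- The Cuntz–Krieger uniqueness property: the universal representation is injective on the core,
hence non-vanishing on nonzero standard projections, and every representation of `X` in a
C⋆-algebra which is non-vanishing on nonzero standard projections and has dense image is isomorphic
to it. -/
def CuntzKriegerUniqueness (D : GeneratingPair k X) (hX : CStarBounded X) : Prop :=
  InjectiveOnCore D (universalRep hX) ∧ NonVanishing D (universalRep hX) ∧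
  ∀ (A : Type v) [NonUnitalCStarAlgebra A] (ψ : X →⋆ₙₐ[ℂ] A), NonVanishing D ψ → DenseRange ψ →
    ∃ Φ : UniversalCStar hX ≃⋆ₐ[ℂ] A, ∀ x, Φ (universalRep hX x) = ψ x

end CuntzKrieger

/-! ### The left reduced C⋆-algebra of a semimultiplicative set -/

section LeftRegular

variable {Γ : Type u}

/-- The coefficient at `u` of `λ_s f`: it is `f t` if `u = s t`, and `0` if there is no such `t`. -/
def leftShift (S : SemimultiplicativeSet Γ) (s : Γ) (f : Γ → ℂ) (u : Γ) : ℂ :=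
  if h : ∃ t, S.mul s t = some u then f h.choose else 0

theorem leftShift_sum_le (S : SemimultiplicativeSet Γ) (s : Γ) (f : lp (fun _ : Γ => ℂ) 2)
    (F : Finset Γ) :
    ∑ u ∈ F, ‖leftShift S s f u‖ ^ (2 : ℝ≥0∞).toReal ≤ ‖f‖ ^ (2 : ℝ≥0∞).toReal := by
  have h2 : 0 < (2 : ℝ≥0∞).toReal := by norm_num
  let t : Γ → Γ := fun u => if h : ∃ t, S.mul s t = some u then h.choose else u
  let E := F.filter fun u => ∃ t, S.mul s t = some u
  have hE : ∀ u ∈ E, S.mul s (t u) = some u := fun u hu => by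
    have h := (Finset.mem_filter.1 hu).2
    simp only [t, dif_pos h]
    exact h.choose_spec
  have hinj : Set.InjOn t E := fun u hu v hv huv => by
    have h1 := hE u hu
    rw [huv, hE v hv] at h1
    exact (Option.some.inj h1).symm
  calc ∑ u ∈ F, ‖leftShift S s f u‖ ^ (2 : ℝ≥0∞).toReal
      = ∑ u ∈ E, ‖f (t u)‖ ^ (2 : ℝ≥0∞).toReal := by
        rw [Finset.sum_filter]
        refine Finset.sum_congr rfl fun u _ => ?_
        by_cases h : ∃ t, S.mul s t = some u
        · simp [leftShift, t, h]
        · simp [leftShift, h]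
    _ = ∑ v ∈ E.image t, ‖f v‖ ^ (2 : ℝ≥0∞).toReal := 
        (Finset.sum_image (f := fun v => ‖f v‖ ^ (2 : ℝ≥0∞).toReal) hinj).symm
    _ ≤ ‖f‖ ^ (2 : ℝ≥0∞).toReal := lp.sum_rpow_le_norm_rpow h2 f _

/-- The operator `λ_s` on `ℓ²`, for a semimultiplicative set with left cancellation: it maps `δ_t`
to `δ_{st}` if `s t` is defined, and to `0` otherwise. -/
def leftRegular (S : SemimultiplicativeSet Γ) (s : Γ) :
    lp (fun _ : Γ => ℂ) 2 →L[ℂ] lp (fun _ : Γ => ℂ) 2 :=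
  LinearMap.mkContinuous
    { toFun := fun f => ⟨leftShift S s f, memℓp_gen' (leftShift_sum_le S s f)⟩
      map_add' := fun f g => by
        ext u
        change leftShift S s (f + g : lp (fun _ : Γ => ℂ) 2) u =
          leftShift S s f u + leftShift S s g u
        by_cases h : ∃ t, S.mul s t = some u <;> simp [leftShift, h]
      map_smul' := fun z f => by
        ext u
        change leftShift S s (z • f : lp (fun _ : Γ => ℂ) 2) u = z * leftShift S s f u
        by_cases h : ∃ t, S.mul s t = some u <;> simp [leftShift, h] } 1
    (fun f => by
      rw [one_mul]
      exact lp.norm_le_of_forall_sum_le (by norm_num) (norm_nonneg f) (leftShift_sum_le S s f))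

theorem leftRegular_single (S : SemimultiplicativeSet Γ) (hS : S.LeftCancellative) (s t : Γ) :
    leftRegular S s (lp.single 2 t 1) = (S.mul s t).elim 0 fun u => lp.single 2 u 1 := by
  ext u
  change leftShift S s (lp.single 2 t (1 : ℂ) : lp (fun _ : Γ => ℂ) 2) u = _
  by_cases h : ∃ t, S.mul s t = some u
  · simp only [leftShift, dif_pos h]
    have h1 := h.choose_spec
    by_cases h2 : h.choose = t
    · rw [h2] at h1 ⊢
      simp [h1]
    · rcases h3 : S.mul s t with _ | v
      · simp [h2]
      · have : u ≠ v := fun huv => h2 (hS s _ _ u h1 (huv ▸ h3))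
        simp [h2, this]
  · simp only [leftShift, dif_neg h]
    rcases h3 : S.mul s t with _ | v
    · simp
    · have : u ≠ v := fun huv => h ⟨t, huv ▸ h3⟩
      simp [this]

/-- The left reduced C⋆-algebra of a semimultiplicative set with left cancellation: the
C⋆-subalgebra of the bounded operators on `ℓ²` generated by the operators `λ_s`. -/
abbrev leftReducedCStar (S : SemimultiplicativeSet Γ) :
    NonUnitalStarSubalgebra ℂ (lp (fun _ : Γ => ℂ) 2 →L[ℂ] lp (fun _ : Γ => ℂ) 2) :=
  cstarClosure (Set.range (leftRegular S))

end LeftRegular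

/-! ### Freely generated semigraph algebras -/

namespace Semigraph

variable {k : Type v} {T : Type u} (S : Semigraph k T)

/-- The defining relations of the freely generated semigraph algebra. -/
inductive FreeRel : StarTerm T → StarTerm T → Prop
  | partialIsometry (t : T) :
      FreeRel (.mul (.mul (.gen t) (.adj (.gen t))) (.gen t)) (.gen t)
  | idempotent (e : T) : S.d e = 0 → FreeRel (.mul (.gen e) (.gen e)) (.gen e)
  | selfAdjoint (e : T) : S.d e = 0 → FreeRel (.adj (.gen e)) (.gen e)
  | mul_defined (x y z : T) : S.mul x y = some z → FreeRel (.mul (.gen x) (.gen y)) (.gen z)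
  | mul_undefined (x y : T) : S.mul x y = none → FreeRel (.mul (.gen x) (.gen y)) .zero
  | source_comm (x y : T) :
      FreeRel
        (.mul (.mul (.adj (.gen x)) (.gen x)) (.mul (.adj (.gen y)) (.gen y)))
        (.mul (.mul (.adj (.gen y)) (.gen y)) (.mul (.adj (.gen x)) (.gen x)))
  /-- `x* y = ∑ e Q_{yf} f*`, where `l` lists the minimal common extensions `(e, f)` of `x`, `y`
  and `Q_{yf} = f* y* y f`. -/
  | expansion (x y : T) (l : List (T × T)) : l.Nodup →
      (∀ c, c ∈ l ↔ c ∈ minCommonExt S.mul S.d x y) →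
      FreeRel (.mul (.adj (.gen x)) (.gen y))
        (StarTerm.sum (l.map fun c =>
          .mul
            (.mul (.gen c.1)
              (.mul (.adj (.mul (.gen y) (.gen c.2))) (.mul (.gen y) (.gen c.2))))
            (.adj (.gen c.2))))

/-- The freely generated semigraph algebra of `S`. -/
abbrev FreeAlg : Type u := PresentedStarAlgebra S.FreeRel

/-- The canonical map from the semigraph to its freely generated semigraph algebra. -/
def ι (t : T) : S.FreeAlg := PresentedStarAlgebra.of _ t

/-- The generators of the freely generated semigraph algebra as a semigraph algebra: `P` consists of
`0` and all products `Q_{t₁} ⋯ Q_{tₙ}` with `n ≥ 1`, and `T` consists of the elements of the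
semigraph with nonzero degree. -/
def freePair : GeneratingPair k S.FreeAlg where
  P := {p | ∃ (t : T) (l : List T),
    p = (l.map fun s => sourceProj (S.ι s)).foldl (· * ·) (sourceProj (S.ι t))} ∪ {0}
  T := {x | ∃ t, S.d t ≠ 0 ∧ S.ι t = x}
  d x := S.d x.2.choose

theorem freeAlg_cstarBounded : CStarBounded S.FreeAlg := by
  intro x
  induction x using PresentedStarAlgebra.ind with | _ a
  induction a with
  | gen t =>
    refine ⟨1, fun ρ => ?_⟩
    have h : ρ.hom (S.ι t) * star (ρ.hom (S.ι t)) * ρ.hom (S.ι t) = ρ.hom (S.ι t) := by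
      rw [← map_star, ← map_mul, ← map_mul]
      exact congrArg _ (PresentedStarAlgebra.mk_eq (.of (.partialIsometry t)))
    change ‖ρ.hom (S.ι t)‖ ≤ 1
    generalize ρ.hom (S.ι t) = y at h
    have h1 : star (star y * y) * (star y * y) = star y * y := by
      rw [star_mul, star_star, mul_assoc, ← mul_assoc y, h]
    have h2 : ‖star y * y‖ * ‖star y * y‖ = ‖star y * y‖ := by
      rw [← CStarRing.norm_star_mul_self, h1]
    rw [CStarRing.norm_star_mul_self] at h2
    nlinarith [norm_nonneg y, sq_nonneg (‖y‖ - 1), sq_nonneg (‖y‖ * ‖y‖ - 1), sq_nonneg (‖y‖)]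
  | zero => exact ⟨0, fun ρ => by rw [PresentedStarAlgebra.mk_zero, map_zero, norm_zero]⟩
  | add a b iha ihb =>
    obtain ⟨C, hC⟩ := iha
    obtain ⟨C', hC'⟩ := ihb
    refine ⟨C + C', fun ρ => ?_⟩
    rw [PresentedStarAlgebra.mk_add, map_add]
    exact (norm_add_le _ _).trans (add_le_add (hC ρ) (hC' ρ))
  | neg a ih =>
    obtain ⟨C, hC⟩ := ih
    refine ⟨C, fun ρ => ?_⟩
    rw [PresentedStarAlgebra.mk_neg, map_neg, norm_neg]
    exact hC ρ
  | smul z a ih =>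
    obtain ⟨C, hC⟩ := ih
    refine ⟨‖z‖ * C, fun ρ => ?_⟩
    rw [PresentedStarAlgebra.mk_smul, map_smul, norm_smul]
    exact mul_le_mul_of_nonneg_left (hC ρ) (norm_nonneg z)
  | mul a b iha ihb =>
    obtain ⟨C, hC⟩ := iha
    obtain ⟨C', hC'⟩ := ihb
    refine ⟨C * C', fun ρ => ?_⟩
    rw [PresentedStarAlgebra.mk_mul, map_mul]
    exact (norm_mul_le _ _).trans
      (mul_le_mul (hC ρ) (hC' ρ) (norm_nonneg _) ((norm_nonneg _).trans (hC ρ)))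
  | adj a ih =>
    obtain ⟨C, hC⟩ := ih
    refine ⟨C, fun ρ => ?_⟩
    rw [PresentedStarAlgebra.mk_adj, map_star, norm_star]
    exact hC ρ

/-- The freely generated semigraph C⋆-algebra `Q(T)`. -/
abbrev Q : Type (u + 1) := UniversalCStar S.freeAlg_cstarBounded

/-- The universal representation of the freely generated semigraph algebra in `Q(T)`. -/
abbrev toQ : S.FreeAlg →⋆ₙₐ[ℂ] S.Q := universalRep S.freeAlg_cstarBounded

/-- The set `Δ = T ⊔ Δ_μ`. The element `y μ_{α₁, …, αₙ}` of `Δ_μ` is the pair `(y, [α₁, …, αₙ])`,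
where `y ≤ αᵢ` for at least one `i` (in particular `n ≥ 1`). -/
abbrev DeltaType : Type u := T ⊕ {q : T × List T // ∃ a ∈ q.2, S.le q.1 a}

/-- The multiplication of `Δ`. -/
def deltaMul : S.DeltaType → S.DeltaType → Option S.DeltaType
  | .inl x, .inl y => (S.mul x y).map .inl
  | .inl x, .inr q => (S.mul x q.1.1).bind fun z =>
      if h : ∃ a ∈ q.1.2, S.le z a then some (.inr ⟨(z, q.1.2), h⟩) else none
  | .inr _, _ => none

/-- The semimultiplicative set `Δ`. -/
def Delta : SemimultiplicativeSet S.DeltaType where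
  mul := S.deltaMul
  assoc a b c := by
    rcases a with a | a
    · rcases b with b | b
      · rcases c with c | ⟨⟨y, α⟩, hy⟩
        · have := S.assoc a b c
          simp only [deltaMul]
          rcases h1 : S.mul a b with _ | ab <;> rcases h2 : S.mul b c with _ | bc <;>
            simp only [h1, h2, Option.bind_none, Option.bind_some, Option.map_none,
              Option.map_some] at this ⊢
          · simp [← this]
          · simp [this]
          · simp [this]
        · have := S.assoc a b y
          simp only [deltaMul]
          rcases h1 : S.mul a b with _ | ab <;> rcases h2 : S.mul b y with _ | by' <;>
            simp only [h1, h2, Option.bind_none, Option.bind_some, Option.map_none,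
              Option.map_some, deltaMul] at this ⊢
          · split_ifs
            · simp [deltaMul, ← this]
            · rfl
          · simp [this]
          · rw [this]
            by_cases h3 : ∃ x ∈ α, S.le by' x
            · simp [h3, deltaMul]
            · rw [dif_neg h3]
              rcases h4 : S.mul a by' with _ | z
              · simp
              · have : ¬ ∃ x ∈ α, S.le z x := by
                  rintro ⟨x, hx, β, hβ⟩
                  refine h3 ⟨x, hx, ?_⟩
                  have h5 := S.assoc β a by'
                  rw [h4] at h5
                  simp only [Option.bind_some, hβ] at h5
                  rcases h6 : S.mul β a with _ | c
                  · simp [h6] at h5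
                  · exact ⟨c, by simpa [h6] using h5⟩
                simp [this]
      · rcases h : (S.deltaMul (.inl a) (.inr b)) with _ | z
        · simp [deltaMul]
        · simp only [deltaMul, Option.bind_eq_some_iff] at h
          obtain ⟨w, _, h⟩ := h
          split_ifs at h
          cases h
          simp [deltaMul]
    · rcases h : S.deltaMul b c with _ | z <;> simp [deltaMul]

theorem mul_left_cancel {s t₁ t₂ z : T} (h₁ : S.mul s t₁ = some z) (h₂ : S.mul s t₂ = some z) :
    t₁ = t₂ := by
  have hd := (S.d_mul _ _ _ h₁).symm.trans (S.d_mul _ _ _ h₂)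
  have hd' : S.d t₁ = S.d t₂ := add_left_cancel hd
  obtain ⟨p, _, hp⟩ := S.factor z (S.d s) (S.d t₁) (S.d_mul _ _ _ h₁)
  exact congrArg Prod.snd ((hp (s, t₁) ⟨h₁, rfl, rfl⟩).trans (hp (s, t₂) ⟨h₂, rfl, hd'.symm⟩).symm)

theorem Delta_leftCancellative : S.Delta.LeftCancellative := by
  rintro (s | s) (t₁ | ⟨⟨t₁, α₁⟩, _⟩) (t₂ | ⟨⟨t₂, α₂⟩, _⟩) z h₁ h₂ <;>
    simp only [Delta, deltaMul, Option.map_eq_some_iff, Option.bind_eq_some_iff,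
      reduceCtorEq] at h₁ h₂
  · obtain ⟨a, h₁, rfl⟩ := h₁
    obtain ⟨b, h₂, h⟩ := h₂
    cases h
    rw [S.mul_left_cancel h₁ h₂]
  · obtain ⟨a, h₁, rfl⟩ := h₁
    obtain ⟨b, h₂, h⟩ := h₂
    split_ifs at h
    cases h
  · obtain ⟨a, h₁, h⟩ := h₁
    obtain ⟨b, h₂, rfl⟩ := h₂
    split_ifs at h
    cases h
  · obtain ⟨a, h₁, h⟩ := h₁
    obtain ⟨b, h₂, h'⟩ := h₂
    split_ifs at h h'
    cases h
    cases h'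
    have := S.mul_left_cancel h₁ h₂
    subst this
    rfl

end Semigraph

end SemigraphCStar

end

noncomputable section

namespace SemigraphCStar

open scoped Classical ENNReal

/-! ### Sources, ranges and factorizations in a semigraph -/

namespace Semigraph

variable {k : Type v} {T : Type u} (S : Semigraph k T)

/-! Everything is read off from one faithful representation Λ, the map `(tailAction hid).rep`. A
tail set R consists of elements with a common source and is closed under right factors. The
semigraph acts on the points (R, y) with y ∈ R by y ↦ xy, as long as xy stays in R. Unique
factorization makes this a system of partial injections in which every coincidence xu = yv passes
through one minimal common extension. Hence the operators on ℓ² satisfy the defining relations of X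
(`PartialAction.rep`). The second coordinate records degrees. The first records source projections:
at the base point (R, root), Q_r takes the value 1 exactly when r ∈ R.

The words s Q_{r₁} ⋯ Q_{rₙ} t* span X (`wordSpan_eq_top`). Such a word, if nonzero, is determined by
s, t and the tail set R generated by s, t and the rᵢ, and it carries (R, t) to (R, s). Ordering
words by d(t) and then by R makes these matrix coefficients triangular (`exists_coeff_ne_zero`), so
Λ is faithful. Relations in X can thus be checked on sets of points. Moreover, a nonzero standard
projection contains the minimal point of its leading half-standard word (`exists_point_of_ne_zero`).
Freeness and weak freeness follow by inspecting that point.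

The analytic part compares an arbitrary representation with Λ.

Lower bound (`norm_rep_le_of_nonVanishing`): around each base point, every y ∈ X can be compressed
by a nonzero standard projection e so that e y e is the diagonal coefficient of Λ(y) times e
(`exists_near`). A representation that does not vanish on e therefore sees the vector state. As each
base point is cyclic for its block, such a representation has norm at least that of Λ. The same
compression gives the cancelling condition.

Upper bound (`norm_le_norm_rep`): every representation is dominated by Λ. Words with d(s) = d(t) = n
over finitely many letters span a finite-dimensional *-algebra on which Λ is injective. This gives
an estimate up to a constant, and iterated squaring removes the constant. Finitely many components
of the core are separated by bounded maps, since the norm of a component of degree n is attained on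
points of degree n. Homogeneous elements reduce to the core through x*x. For general x, the number
of degrees occurring in (x*x)^(2^j) is bounded by a polynomial in 2^j, and iterated squaring absorbs
this factor as well.

Consequently all representations that do not vanish on standard projections induce the same norm on
X, namely the universal one. The representation on ℓ²(Δ) is of this kind, because the symbol y μ_α
behaves like a point of the tail set generated by α. -/

theorem assoc_left {x y z a b : T} (h₁ : S.mul x y = some a) (h₂ : S.mul a z = some b) :
    ∃ c, S.mul y z = some c ∧ S.mul x c = some b := by
  have h := S.assoc x y z
  rw [h₁, Option.bind_some, h₂] at h
  exact Option.bind_eq_some_iff.1 h.symm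

theorem assoc_right {x y z b c : T} (h₁ : S.mul y z = some c) (h₂ : S.mul x c = some b) :
    ∃ a, S.mul x y = some a ∧ S.mul a z = some b := by
  have h := S.assoc x y z
  rw [h₁, Option.bind_some, h₂] at h
  exact Option.bind_eq_some_iff.1 h

theorem factor_unique {x y x' y' z : T} (h : S.mul x y = some z) (h' : S.mul x' y' = some z)
    (hd : S.d x = S.d x') : x = x' ∧ y = y' := by
  have e := (S.d_mul _ _ _ h).symm.trans (S.d_mul _ _ _ h')
  rw [hd] at e
  obtain ⟨p, _, hp⟩ := S.factor z (S.d x) (S.d y) (S.d_mul _ _ _ h)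
  exact Prod.ext_iff.1 ((hp (x, y) ⟨h, rfl, rfl⟩).trans
    (hp (x', y') ⟨h', hd.symm, (add_left_cancel e).symm⟩).symm)

theorem mul_right_cancel {x y x' z : T} (h : S.mul x y = some z) (h' : S.mul x' y = some z) :
    x = x' := by
  have e := (S.d_mul _ _ _ h).symm.trans (S.d_mul _ _ _ h')
  exact (S.factor_unique h h' (add_right_cancel e)).1

theorem exists_factor {c : T} {n : k → ℕ} (h : n ≤ S.d c) :
    ∃ a b, S.mul a b = some c ∧ S.d a = n := by
  obtain ⟨p, hp, _⟩ := S.factor c n (S.d c - n) (add_tsub_cancel_of_le h).symm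
  exact ⟨p.1, p.2, hp.1, hp.2.1⟩

/-- If `a b = c e` and `d a ≤ d c` then `c = a f` and `b = f e`. -/
theorem factor_through {a b c e z : T} (h : S.mul a b = some z) (h' : S.mul c e = some z)
    (hd : S.d a ≤ S.d c) : ∃ f, S.mul a f = some c ∧ S.mul f e = some b := by
  obtain ⟨a', f, hf, ha'⟩ := S.exists_factor hd
  obtain ⟨b', hb', hz⟩ := S.assoc_left hf h'
  obtain ⟨rfl, rfl⟩ := S.factor_unique h hz ha'.symm
  exact ⟨f, hf, hb'⟩

/-- The common value w = xu = yv has degree at least d(x) ∨ d(y). Its left factor g of exactly that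
degree is a common extension of x and y, and what is left over is the common right factor c of u and
v. -/
theorem exists_minCommonExt {x y u v w : T} (h : S.mul x u = some w) (h' : S.mul y v = some w) :
    ∃ e f g c, S.mul x e = some g ∧ S.mul y f = some g ∧ S.d g = S.d x ⊔ S.d y ∧
      S.mul e c = some u ∧ S.mul f c = some v := by
  have hle : S.d x ⊔ S.d y ≤ S.d w := by
    rw [sup_le_iff]
    constructor
    · rw [S.d_mul _ _ _ h]; exact le_self_add
    · rw [S.d_mul _ _ _ h']; exact le_self_add
  obtain ⟨g, c, hg, hd⟩ := S.exists_factor hle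
  obtain ⟨e, he, he'⟩ := S.factor_through h hg (hd ▸ le_sup_left)
  obtain ⟨f, hf, hf'⟩ := S.factor_through h' hg (hd ▸ le_sup_right)
  exact ⟨e, f, g, c, he, hf, hd, he', hf'⟩

/-- Every element of degree zero is idempotent. -/
def IdemZero : Prop := ∀ e, S.d e = 0 → S.mul e e = some e

variable {S} (hid : S.IdemZero)
include hid

/-- Factor x = ye with d(e) = 0. Idempotence gives xe = (ye)e = y(ee) = ye = x, so e is a local unit
of x. -/
theorem IdemZero.exists_src (x : T) : ∃ e, S.d e = 0 ∧ S.mul x e = some x := by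
  obtain ⟨⟨y, e⟩, ⟨h, _, he⟩, _⟩ := S.factor x (S.d x) 0 (add_zero _).symm
  obtain ⟨c, hc, hc'⟩ := S.assoc_right (hid e he) h
  rw [h] at hc
  cases hc
  exact ⟨e, he, hc'⟩

theorem IdemZero.exists_rng (x : T) : ∃ e, S.d e = 0 ∧ S.mul e x = some x := by
  obtain ⟨⟨e, y⟩, ⟨h, he, _⟩, _⟩ := S.factor x 0 (S.d x) (zero_add _).symm
  obtain ⟨c, hc, hc'⟩ := S.assoc_left (hid e he) h
  rw [h] at hc
  cases hc
  exact ⟨e, he, hc'⟩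

omit hid

variable (S) in
/-- The source of `x`: the element `e` of degree zero with `x e = x`. -/
def src (x : T) : T := if h : ∃ e, S.d e = 0 ∧ S.mul x e = some x then h.choose else x

variable (S) in
/-- The range of `x`: the element `e` of degree zero with `e x = x`. -/
def rng (x : T) : T := if h : ∃ e, S.d e = 0 ∧ S.mul e x = some x then h.choose else x

include hid

theorem IdemZero.d_src (x : T) : S.d (S.src x) = 0 := by
  rw [src, dif_pos (hid.exists_src x)]
  exact (hid.exists_src x).choose_spec.1

theorem IdemZero.mul_src (x : T) : S.mul x (S.src x) = some x := by
  rw [src, dif_pos (hid.exists_src x)]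
  exact (hid.exists_src x).choose_spec.2

theorem IdemZero.d_rng (x : T) : S.d (S.rng x) = 0 := by
  rw [rng, dif_pos (hid.exists_rng x)]
  exact (hid.exists_rng x).choose_spec.1

theorem IdemZero.rng_mul (x : T) : S.mul (S.rng x) x = some x := by
  rw [rng, dif_pos (hid.exists_rng x)]
  exact (hid.exists_rng x).choose_spec.2

theorem IdemZero.src_eq {x e : T} (h : S.mul x e = some x) : S.src x = e :=
  S.mul_left_cancel (hid.mul_src x) h

theorem IdemZero.rng_eq {x e : T} (h : S.mul e x = some x) : S.rng x = e :=
  S.mul_right_cancel (hid.rng_mul x) h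

omit hid in
theorem d_eq_zero_of_mul_right {x e z : T} (h : S.mul x e = some z) (hd : S.d z = S.d x) :
    S.d e = 0 := by
  have := S.d_mul _ _ _ h
  rw [hd] at this
  simpa using this

/-- If z = xe then ze = x(ee) = xe = z, and right cancellation gives z = x. Elements of degree zero
thus act only as local units. -/
theorem IdemZero.eq_of_mul_zero {x e z : T} (h : S.mul x e = some z) (he : S.d e = 0) :
    z = x ∧ S.src x = e := by
  obtain ⟨c, hc, hc'⟩ := S.assoc_right (hid e he) h
  rw [h] at hc
  cases hc
  have := S.mul_right_cancel h hc'
  subst this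
  exact ⟨rfl, hid.src_eq h⟩

theorem IdemZero.eq_of_zero_mul {x e z : T} (h : S.mul e x = some z) (he : S.d e = 0) :
    z = x ∧ S.rng x = e := by
  obtain ⟨c, hc, hc'⟩ := S.assoc_left (hid e he) h
  rw [h] at hc
  cases hc
  have := S.mul_left_cancel h hc'
  subst this
  exact ⟨rfl, hid.rng_eq h⟩

theorem IdemZero.src_of_zero {e : T} (he : S.d e = 0) : S.src e = e := hid.src_eq (hid e he)

theorem IdemZero.src_eq_rng {x y z : T} (h : S.mul x y = some z) : S.src x = S.rng y := by
  obtain ⟨c, hc, hc'⟩ := S.assoc_left (hid.mul_src x) h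
  exact (hid.eq_of_zero_mul hc (hid.d_src x)).2.symm

theorem IdemZero.src_of_mul {x y z : T} (h : S.mul x y = some z) : S.src z = S.src y := by
  obtain ⟨a, ha, ha'⟩ := S.assoc_right (hid.mul_src y) h
  rw [h] at ha
  cases ha
  exact hid.src_eq ha'

omit hid
variable (S)

/-- A nonempty set of elements with the same source, closed under passage to right factors. -/
@[ext]
structure TailSet where
  carrier : Set T
  root : T
  d_root : S.d root = 0
  root_mem : root ∈ carrier
  mul_root : ∀ y ∈ carrier, S.mul y root = some y
  tail : ∀ x y z, S.mul x y = some z → z ∈ carrier → y ∈ carrier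

variable {S}

/-- The root is no extra datum: two roots r, r' of one carrier satisfy rr' = r = rr, so they agree
by left cancellation. -/
theorem TailSet.ext_carrier {R R' : S.TailSet} (h : R.carrier = R'.carrier) : R = R' := by
  have h₁ := R'.mul_root _ (h ▸ R.root_mem)
  have h₂ := R.mul_root _ R.root_mem
  exact TailSet.ext h (S.mul_left_cancel h₂ h₁)

/-- The tail set of all `y` such that `y h ∈ R`. -/
def TailSet.comap (hid : S.IdemZero) (R : S.TailSet) {h : T} (hh : h ∈ R.carrier) : S.TailSet where
  carrier := {y | ∃ z ∈ R.carrier, S.mul y h = some z}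
  root := S.rng h
  d_root := hid.d_rng h
  root_mem := ⟨h, hh, hid.rng_mul h⟩
  mul_root := by
    rintro y ⟨z, hz, hy⟩
    rw [← hid.src_eq_rng hy]
    exact hid.mul_src y
  tail := by
    rintro x y z hxy ⟨w, hw, hz⟩
    obtain ⟨c, hc, hc'⟩ := S.assoc_left hxy hz
    exact ⟨c, R.tail _ _ _ hc' hw, hc⟩

theorem le_refl' (hid : S.IdemZero) (x : T) : S.le x x := ⟨_, hid.rng_mul x⟩

theorem le_trans' {x y z : T} (h : S.le x y) (h' : S.le y z) : S.le x z := by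
  obtain ⟨a, ha⟩ := h
  obtain ⟨b, hb⟩ := h'
  obtain ⟨c, hc, hc'⟩ := S.assoc_right ha hb
  exact ⟨c, hc'⟩

theorem IdemZero.src_of_le (hid : S.IdemZero) {x y : T} (h : S.le x y) : S.src x = S.src y := by
  obtain ⟨a, ha⟩ := h
  exact (hid.src_of_mul ha).symm

/-- The tail set generated by a list of elements with common source `e`. -/
def TailSet.gen (hid : S.IdemZero) (e : T) (l : List T) (he : S.d e = 0)
    (hl : ∀ y ∈ l, S.src y = e) : S.TailSet where
  carrier := {y | ∃ a ∈ e :: l, S.le y a}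
  root := e
  d_root := he
  root_mem := ⟨e, by simp, le_refl' hid e⟩
  mul_root := by
    rintro y ⟨a, ha, hy⟩
    have : S.src y = e := by
      rw [hid.src_of_le hy]
      rcases List.mem_cons.1 ha with rfl | ha
      · exact hid.src_of_zero he
      · exact hl a ha
    rw [← this]
    exact hid.mul_src y
  tail := by
    rintro x y z h ⟨a, ha, hz⟩
    exact ⟨a, ha, le_trans' ⟨x, h⟩ hz⟩

theorem TailSet.gen_subset (hid : S.IdemZero) {e : T} {l : List T} {he : S.d e = 0}
    {hl : ∀ y ∈ l, S.src y = e} {R : S.TailSet} (h : e ∈ R.carrier)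
    (h' : ∀ y ∈ l, y ∈ R.carrier) : (TailSet.gen hid e l he hl).carrier ⊆ R.carrier := by
  rintro y ⟨a, ha, b, hb⟩
  refine R.tail _ _ _ hb ?_
  rcases List.mem_cons.1 ha with rfl | ha
  · exact h
  · exact h' a ha

theorem TailSet.mem_gen (hid : S.IdemZero) {e : T} {l : List T} {he : S.d e = 0}
    {hl : ∀ y ∈ l, S.src y = e} {y : T} (hy : y ∈ l) :
    y ∈ (TailSet.gen hid e l he hl).carrier :=
  ⟨y, List.mem_cons_of_mem _ hy, le_refl' hid y⟩

end Semigraph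

/-! ### Operators on `ℓ²` given by partial injections -/

section PartialInjections

variable {Ω : Type u}

/-- The Hilbert space `ℓ²(Ω)`. -/
abbrev Ell2 (Ω : Type u) : Type u := lp (fun _ : Ω => ℂ) 2

/-- The basis vectors of `ℓ²(Ω)`. -/
def delta (u : Ω) : Ell2 Ω := lp.single 2 u (1 : ℂ)

theorem delta_apply (u v : Ω) : (delta u : Ell2 Ω) v = if v = u then 1 else 0 := by
  simp [delta, Pi.single_apply]

theorem delta_apply_self (u : Ω) : (delta u : Ell2 Ω) u = 1 := by simp [delta_apply]

theorem delta_ne_zero (u : Ω) : (delta u : Ell2 Ω) ≠ 0 := fun h => by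
  have := delta_apply_self u
  rw [h] at this
  simp at this

theorem inner_delta_left (u : Ω) (ξ : Ell2 Ω) : inner ℂ (delta u) ξ = ξ u := by
  simp [delta, lp.inner_single_left]

theorem dense_span_delta : Dense (Submodule.span ℂ (Set.range (delta (Ω := Ω))) : Set (Ell2 Ω)) := by
  intro ξ
  have h := lp.hasSum_single (E := fun _ : Ω => ℂ) (p := 2) (by norm_num) ξ
  refine mem_closure_of_tendsto h (Filter.Eventually.of_forall fun s => ?_)
  refine Submodule.sum_mem _ fun u _ => ?_
  have : lp.single 2 u (ξ u) = ξ u • delta u := by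
    rw [delta, ← lp.single_smul]
    simp
  rw [this]
  exact Submodule.smul_mem _ _ (Submodule.subset_span ⟨u, rfl⟩)

theorem ext_delta {H : Type*} [NormedAddCommGroup H] [NormedSpace ℂ H] {A B : Ell2 Ω →L[ℂ] H}
    (h : ∀ u, A (delta u) = B (delta u)) : A = B := by
  refine ContinuousLinearMap.ext_on dense_span_delta ?_
  rintro _ ⟨u, rfl⟩
  exact h u

/-- The coefficient at `u` of the image of `f` under the operator given by `g`. -/
def pushFun (g : Ω ≃. Ω) (f : Ω → ℂ) (u : Ω) : ℂ := (g.symm u).elim 0 f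

theorem pushFun_sum_le (g : Ω ≃. Ω) (f : Ell2 Ω) (F : Finset Ω) :
    ∑ u ∈ F, ‖pushFun g f u‖ ^ (2 : ℝ≥0∞).toReal ≤ ‖f‖ ^ (2 : ℝ≥0∞).toReal := by
  have h2 : 0 < (2 : ℝ≥0∞).toReal := by norm_num
  let E := F.filter fun u => (g.symm u).isSome
  let t : Ω → Ω := fun u => (g.symm u).getD u
  have hE : ∀ u ∈ E, g.symm u = some (t u) := fun u hu => by
    obtain ⟨v, hv⟩ := Option.isSome_iff_exists.1 (Finset.mem_filter.1 hu).2
    simp [t, hv]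
  have hinj : Set.InjOn t E := fun u hu v hv huv => by
    have h1 := hE u hu
    rw [huv] at h1
    exact g.symm.inj h1 (hE v hv)
  calc ∑ u ∈ F, ‖pushFun g f u‖ ^ (2 : ℝ≥0∞).toReal
      = ∑ u ∈ E, ‖f (t u)‖ ^ (2 : ℝ≥0∞).toReal := by
        rw [Finset.sum_filter]
        refine Finset.sum_congr rfl fun u _ => ?_
        rcases h : g.symm u with _ | v
        · simp [pushFun, h]
        · simp [pushFun, h, t]
    _ = ∑ v ∈ E.image t, ‖f v‖ ^ (2 : ℝ≥0∞).toReal :=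
        (Finset.sum_image (f := fun v => ‖f v‖ ^ (2 : ℝ≥0∞).toReal) hinj).symm
    _ ≤ ‖f‖ ^ (2 : ℝ≥0∞).toReal := lp.sum_rpow_le_norm_rpow h2 f _

/-- The partial isometry of `ℓ²(Ω)` given by a partial injection of `Ω`. -/
def shiftOp (g : Ω ≃. Ω) : Ell2 Ω →L[ℂ] Ell2 Ω :=
  LinearMap.mkContinuous
    { toFun := fun f => ⟨pushFun g f, memℓp_gen' (pushFun_sum_le g f)⟩
      map_add' := fun f h => by
        ext u
        change pushFun g (f + h : Ell2 Ω) u = pushFun g f u + pushFun g h u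
        unfold pushFun
        rcases g.symm u with _ | v
        · exact (add_zero 0).symm
        · rfl
      map_smul' := fun z f => by
        ext u
        change pushFun g (z • f : Ell2 Ω) u = z * pushFun g f u
        rcases h' : g.symm u with _ | v <;> simp [pushFun, h'] } 1
    (fun f => by
      rw [one_mul]
      exact lp.norm_le_of_forall_sum_le (by norm_num) (norm_nonneg f) (pushFun_sum_le g f))

theorem shiftOp_apply (g : Ω ≃. Ω) (f : Ell2 Ω) (u : Ω) :
    shiftOp g f u = (g.symm u).elim 0 f := rfl

theorem norm_shiftOp_le (g : Ω ≃. Ω) : ‖shiftOp g‖ ≤ 1 :=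
  LinearMap.mkContinuous_norm_le _ zero_le_one _

theorem norm_shiftOp_apply_le (g : Ω ≃. Ω) (f : Ell2 Ω) : ‖shiftOp g f‖ ≤ ‖f‖ := by
  simpa using (shiftOp g).le_of_opNorm_le (norm_shiftOp_le g) f

theorem shiftOp_delta (g : Ω ≃. Ω) (u : Ω) : shiftOp g (delta u) = (g u).elim 0 delta := by
  ext v
  rw [shiftOp_apply]
  rcases h : g.symm v with _ | w
  · rcases h' : g u with _ | v'
    · rfl
    · have : v ≠ v' := by
        rintro rfl
        rw [g.eq_some_iff.2 h'] at h
        cases h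
      simp [delta_apply, this]
  · have hw := g.eq_some_iff.1 h
    rcases h' : g u with _ | v'
    · have : w ≠ u := by
        rintro rfl
        rw [h'] at hw
        cases hw
      simp [delta_apply, this]
    · by_cases hwu : w = u
      · subst hwu
        rw [hw] at h'
        cases h'
        simp [delta_apply]
      · have : v ≠ v' := by
          rintro rfl
          exact hwu (g.inj hw h')
        simp [delta_apply, this, hwu]

theorem shiftOp_delta_some {g : Ω ≃. Ω} {u v : Ω} (h : g u = some v) :
    shiftOp g (delta u) = delta v := by rw [shiftOp_delta, h]; rfl

theorem shiftOp_delta_none {g : Ω ≃. Ω} {u : Ω} (h : g u = none) :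
    shiftOp g (delta u) = 0 := by rw [shiftOp_delta, h]; rfl

theorem shiftOp_trans (f g : Ω ≃. Ω) : shiftOp (f.trans g) = shiftOp g * shiftOp f := by
  refine ext_delta fun u => ?_
  change _ = shiftOp g (shiftOp f (delta u))
  rw [shiftOp_delta, shiftOp_delta f]
  change ((f u).bind g).elim 0 delta = _
  rcases f u with _ | v
  · simp
  · simp [shiftOp_delta]

theorem shiftOp_bot : shiftOp (⊥ : Ω ≃. Ω) = 0 :=
  ext_delta fun u => by rw [shiftOp_delta]; rfl

theorem star_shiftOp (g : Ω ≃. Ω) : star (shiftOp g) = shiftOp g.symm := by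
  refine ext_delta fun u => ?_
  ext v
  rw [← inner_delta_left v, ContinuousLinearMap.star_eq_adjoint,
    ContinuousLinearMap.adjoint_inner_right, shiftOp_apply, PEquiv.symm_symm, shiftOp_delta]
  rcases g v with _ | w
  · simp
  · simp [inner_delta_left]

theorem shiftOp_injective : Function.Injective (shiftOp (Ω := Ω)) := by
  intro f g h
  ext u v
  have h1 := DFunLike.congr_fun h (delta u)
  rw [shiftOp_delta, shiftOp_delta] at h1
  rcases hf : f u with _ | a <;> rcases hg : g u with _ | b <;> simp only [hf, hg] at h1
  · rfl
  · exact absurd h1.symm (delta_ne_zero _)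
  · exact absurd h1 (delta_ne_zero _)
  · have h2 := congrArg (fun ξ : Ell2 Ω => ξ a) h1
    simp only [Option.elim_some, delta_apply] at h2
    by_cases hab : a = b
    · rw [hab]
    · simp [hab] at h2

/-- The operator of a finite disjoint union of partial injections. -/
theorem shiftOp_eq_sum {ι : Type*} (C : Finset ι) (g : Ω ≃. Ω) (f : ι → Ω ≃. Ω)
    (h : ∀ u v, g u = some v ↔ ∃ c ∈ C, f c u = some v)
    (huniq : ∀ u v v', ∀ c ∈ C, ∀ c' ∈ C, f c u = some v → f c' u = some v' → c = c') :
    shiftOp g = ∑ c ∈ C, shiftOp (f c) := by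
  refine ext_delta fun u => ?_
  rw [sum_apply]
  rcases hg : g u with _ | v
  · rw [shiftOp_delta_none hg, Finset.sum_eq_zero]
    intro c hc
    refine shiftOp_delta_none ?_
    rcases hf : f c u with _ | w
    · rfl
    · rw [(h u w).2 ⟨c, hc, hf⟩] at hg
      cases hg
  · obtain ⟨c, hc, hf⟩ := (h u v).1 hg
    rw [shiftOp_delta_some hg, Finset.sum_eq_single_of_mem c hc, shiftOp_delta_some hf]
    intro c' hc' hne
    refine shiftOp_delta_none ?_
    rcases hf' : f c' u with _ | w
    · rfl
    · exact absurd (huniq _ _ _ _ hc' _ hc hf' hf) hne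

/-- The projection onto `ℓ²(U)`. -/
def indicatorOp (U : Set Ω) : Ell2 Ω →L[ℂ] Ell2 Ω := shiftOp (PEquiv.ofSet U)

theorem ofSet_apply (U : Set Ω) (u : Ω) : PEquiv.ofSet U u = if u ∈ U then some u else none := rfl

theorem indicatorOp_apply (U : Set Ω) (ξ : Ell2 Ω) (u : Ω) :
    indicatorOp U ξ u = if u ∈ U then ξ u else 0 := by
  rw [indicatorOp, shiftOp_apply, PEquiv.ofSet_symm, ofSet_apply]
  split_ifs <;> rfl

theorem indicatorOp_delta (U : Set Ω) (u : Ω) :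
    indicatorOp U (delta u) = if u ∈ U then delta u else 0 := by
  rw [indicatorOp, shiftOp_delta, ofSet_apply]
  split_ifs <;> rfl

theorem indicatorOp_mul (U W : Set Ω) : indicatorOp U * indicatorOp W = indicatorOp (U ∩ W) := by
  refine ext_delta fun u => ?_
  change indicatorOp U (indicatorOp W (delta u)) = _
  rw [indicatorOp_delta, indicatorOp_delta]
  by_cases h : u ∈ W <;> by_cases h' : u ∈ U <;> simp [h, h', indicatorOp_delta]

theorem indicatorOp_sub_mul (U W : Set Ω) :
    indicatorOp U - indicatorOp U * indicatorOp W = indicatorOp (U \ W) := by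
  rw [indicatorOp_mul]
  refine ext_delta fun u => ?_
  rw [sub_apply, indicatorOp_delta, indicatorOp_delta, indicatorOp_delta]
  by_cases h : u ∈ W <;> by_cases h' : u ∈ U <;> simp [h, h']

theorem star_indicatorOp (U : Set Ω) : star (indicatorOp U) = indicatorOp U := by
  rw [indicatorOp, star_shiftOp, PEquiv.ofSet_symm]

theorem indicatorOp_injective : Function.Injective (indicatorOp (Ω := Ω)) := by
  intro U W h
  ext u
  have h1 := congrArg (fun A : Ell2 Ω →L[ℂ] Ell2 Ω => A (delta u)) h
  simp only [indicatorOp_delta] at h1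
  by_cases hU : u ∈ U <;> by_cases hW : u ∈ W <;> simp [hU, hW, delta_ne_zero, (delta_ne_zero u).symm] at h1 ⊢

theorem indicatorOp_empty : indicatorOp (∅ : Set Ω) = 0 :=
  ext_delta fun u => by simp [indicatorOp_delta]

theorem shiftOp_mul_star (g : Ω ≃. Ω) :
    shiftOp g * star (shiftOp g) = indicatorOp {v | ∃ u, g u = some v} := by
  rw [star_shiftOp, ← shiftOp_trans, PEquiv.symm_trans_self, indicatorOp]
  congr 1
  ext u v
  simp [Option.isSome_iff_exists, PEquiv.eq_some_iff]

theorem star_mul_shiftOp (g : Ω ≃. Ω) :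
    star (shiftOp g) * shiftOp g = indicatorOp {u | ∃ v, g u = some v} := by
  rw [star_shiftOp, ← shiftOp_trans, PEquiv.self_trans_symm, indicatorOp]
  congr 1
  ext u v
  simp [Option.isSome_iff_exists]

/-! ### Block decompositions -/

theorem inner_eq_zero_of_disjoint {ξ η : Ell2 Ω} (h : ∀ u, ξ u = 0 ∨ η u = 0) :
    inner ℂ ξ η = 0 := by
  rw [lp.inner_eq_tsum]
  have : (fun i => inner ℂ (ξ i) (η i)) = fun _ : Ω => (0 : ℂ) := by
    ext i
    rcases h i with h | h <;> simp [h]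
  rw [this, tsum_zero]

theorem norm_sum_sq_of_disjoint {I : Type*} (F : Finset I) (ξ : I → Ell2 Ω)
    (h : ∀ i j, i ≠ j → ∀ u, ξ i u = 0 ∨ ξ j u = 0) :
    ‖∑ i ∈ F, ξ i‖ ^ 2 = ∑ i ∈ F, ‖ξ i‖ ^ 2 := by
  induction F using Finset.induction_on with
  | empty => simp
  | insert a F ha ih =>
    rw [Finset.sum_insert ha, Finset.sum_insert ha, ← ih, sq, sq, sq]
    refine norm_add_sq_eq_norm_sq_add_norm_sq_of_inner_eq_zero (𝕜 := ℂ) _ _ ?_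
    rw [inner_sum]
    refine Finset.sum_eq_zero fun i hi => inner_eq_zero_of_disjoint (h a i ?_)
    rintro rfl
    exact ha hi

/-- The norm of a block operator is bounded if its blocks are uniformly bounded. -/
theorem norm_le_of_blocks {I : Type*} (A : Ell2 Ω →L[ℂ] Ell2 Ω) (κ κ' : Ω → I) {C : ℝ}
    (hC : 0 ≤ C) (hA : ∀ u v, A (delta v) u ≠ 0 → κ' u = κ v)
    (hb : ∀ i, ∀ ξ ∈ Submodule.span ℂ (delta '' {v | κ v = i}), ‖A ξ‖ ≤ C * ‖ξ‖) :
    ‖A‖ ≤ C := by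
  refine A.opNorm_le_bound hC fun ξ => ?_
  refine dense_span_delta.induction (P := fun ξ => ‖A ξ‖ ≤ C * ‖ξ‖) ?_
    (isClosed_le (by fun_prop) (by fun_prop)) ξ
  intro ξ hξ
  obtain ⟨c, rfl⟩ := (Finsupp.mem_span_range_iff_exists_finsupp (R := ℂ)).1 hξ
  set F := c.support.image κ
  let η : I → Ell2 Ω := fun i => ∑ v ∈ c.support with κ v = i, c v • delta v
  have hsum : c.sum (fun i a => a • delta i) = ∑ i ∈ F, η i := by
    -- A finite combination of basis vectors splits along the fibers of κ; by `hA`, the images of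
    -- the pieces are supported on distinct fibers of κ'.
    exact (Finset.sum_fiberwise_of_maps_to (fun x hx => Finset.mem_image_of_mem _ hx) _).symm
  have hη : ∀ i, η i ∈ Submodule.span ℂ (delta '' {v | κ v = i}) := fun i =>
    Submodule.sum_mem _ fun v hv => Submodule.smul_mem _ _
      (Submodule.subset_span ⟨v, (Finset.mem_filter.1 hv).2, rfl⟩)
  have h1 : ∀ i u, η i u ≠ 0 → κ u = i := by
    intro i u
    refine Submodule.span_induction (p := fun ξ _ => ξ u ≠ 0 → κ u = i) ?_ ?_ ?_ ?_ (hη i)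
    · rintro _ ⟨v, hv, rfl⟩ h
      rw [delta_apply] at h
      split_ifs at h with huv
      · rw [huv]; exact hv
      · exact absurd rfl h
    · intro h; exact absurd rfl h
    · intro x y _ _ hx hy h
      by_contra hne
      refine h ?_
      change x u + y u = 0
      rw [not_not.1 (mt hx hne), not_not.1 (mt hy hne), add_zero]
    · intro a x _ hx h
      refine hx fun h0 => h ?_
      change a * x u = 0
      rw [h0, mul_zero]
  have h2 : ∀ i u, A (η i) u ≠ 0 → κ' u = i := by
    intro i u
    refine Submodule.span_induction (p := fun ξ _ => A ξ u ≠ 0 → κ' u = i) ?_ ?_ ?_ ?_ (hη i)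
    · rintro _ ⟨v, hv, rfl⟩ h
      rw [hA u v h]; exact hv
    · intro h; rw [map_zero] at h; exact absurd rfl h
    · intro x y _ _ hx hy h
      by_contra hne
      refine h ?_
      rw [map_add]
      change A x u + A y u = 0
      rw [not_not.1 (mt hx hne), not_not.1 (mt hy hne), add_zero]
    · intro a x _ hx h
      refine hx fun h0 => h ?_
      rw [map_smul]
      change a * A x u = 0
      rw [h0, mul_zero]
  have hdisj : ∀ (ζ : I → Ell2 Ω) (τ : Ω → I), (∀ i u, ζ i u ≠ 0 → τ u = i) →
      ∀ i j, i ≠ j → ∀ u, ζ i u = 0 ∨ ζ j u = 0 := by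
    intro ζ τ hζ i j hij u
    by_contra! h
    exact hij ((hζ i u h.1).symm.trans (hζ j u h.2))
  -- Pythagoras on both sides: the pieces are orthogonal before and after applying A.
  have hsq : ‖A (∑ i ∈ F, η i)‖ ^ 2 ≤ (C * ‖∑ i ∈ F, η i‖) ^ 2 := by
    rw [map_sum, norm_sum_sq_of_disjoint F _ (hdisj _ κ' h2), mul_pow,
      norm_sum_sq_of_disjoint F _ (hdisj _ κ h1), Finset.mul_sum]
    refine Finset.sum_le_sum fun i _ => ?_
    rw [← mul_pow]
    exact pow_le_pow_left₀ (norm_nonneg _) (hb i _ (hη i)) 2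
  rw [hsum]
  exact le_of_sq_le_sq hsq (by positivity)

end PartialInjections

namespace Semigraph

variable {k : Type v} {T : Type u} (S : Semigraph k T)

/-! ### Actions by partial injections and their representations -/

/-- An action of a semigraph by partial injections which is compatible with factorizations. -/
structure PartialAction (Ω : Type u) where
  act : T → Ω → Option Ω
  assoc : ∀ x y u, (S.mul x y).bind (fun z => act z u) = (act y u).bind (act x)
  inj : ∀ x u u' w, act x u = some w → act x u' = some w → u = u'
  one : ∀ e u w, S.d e = 0 → act e u = some w → w = u
  lcm : ∀ x y u v w, act x u = some w → act y v = some w →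
    ∃ e f g c, S.mul x e = some g ∧ S.mul y f = some g ∧ S.d g = S.d x ⊔ S.d y ∧
      act e c = some u ∧ act f c = some v
  unique : ∀ x x' u u' w, act x u = some w → act x' u' = some w → S.d x = S.d x' → x = x'

namespace PartialAction

variable {S} {Ω : Type u} (α : S.PartialAction Ω)

theorem act_mul {x y z : T} {u v w : Ω} (h : S.mul x y = some z) (hy : α.act y u = some v)
    (hx : α.act x v = some w) : α.act z u = some w := by
  have := α.assoc x y u
  rw [h, hy, Option.bind_some, Option.bind_some, hx] at this
  exact this

theorem act_of_mul {x y z : T} {u w : Ω} (h : S.mul x y = some z) (hz : α.act z u = some w) :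
    ∃ v, α.act y u = some v ∧ α.act x v = some w := by
  have := α.assoc x y u
  rw [h, Option.bind_some, hz] at this
  exact Option.bind_eq_some_iff.1 this.symm

theorem mul_of_act {x y : T} {u v w : Ω} (hy : α.act y u = some v) (hx : α.act x v = some w) :
    ∃ z, S.mul x y = some z ∧ α.act z u = some w := by
  have := α.assoc x y u
  rw [hy, Option.bind_some, hx] at this
  exact Option.bind_eq_some_iff.1 this

/-- The partial injection given by an element of the semigraph. -/
def pequiv (x : T) : Ω ≃. Ω where
  toFun := α.act x
  invFun w := if h : ∃ u, α.act x u = some w then some h.choose else none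
  inv u w := by
    by_cases h : ∃ u, α.act x u = some w
    · rw [dif_pos h]
      constructor
      · intro hu
        cases hu
        exact h.choose_spec
      · intro hw
        exact congrArg some (α.inj _ _ _ _ h.choose_spec hw)
    · rw [dif_neg h]
      constructor
      · intro hu
        cases hu
      · intro hw
        exact absurd ⟨u, hw⟩ h

theorem pequiv_apply (x : T) (u : Ω) : α.pequiv x u = α.act x u := rfl

theorem pequiv_symm_eq_some {x : T} {u w : Ω} :
    (α.pequiv x).symm w = some u ↔ α.act x u = some w := (α.pequiv x).eq_some_iff

theorem shiftOp_mul {x y z : T} (h : S.mul x y = some z) :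
    shiftOp (α.pequiv x) * shiftOp (α.pequiv y) = shiftOp (α.pequiv z) := by
  rw [← shiftOp_trans]
  congr 1
  ext u v
  have := α.assoc x y u
  rw [h, Option.bind_some] at this
  change v ∈ (α.act y u).bind (α.act x) ↔ v ∈ α.act z u
  rw [this]

theorem shiftOp_mul_none {x y : T} (h : S.mul x y = none) :
    shiftOp (α.pequiv x) * shiftOp (α.pequiv y) = 0 := by
  rw [← shiftOp_trans, ← shiftOp_bot]
  congr 1
  ext u v
  have := α.assoc x y u
  rw [h, Option.bind_none] at this
  change v ∈ (α.act y u).bind (α.act x) ↔ v ∈ none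
  rw [this]

theorem shiftOp_zero {e : T} (he : S.d e = 0) :
    shiftOp (α.pequiv e) = indicatorOp {u | ∃ v, α.act e u = some v} := by
  refine ext_delta fun u => ?_
  rw [shiftOp_delta, pequiv_apply, indicatorOp_delta]
  rcases h : α.act e u with _ | v
  · simp [h]
  · rw [if_pos ⟨v, h⟩, α.one _ _ _ he h]
    rfl

/-- The partial injection of the word `e Q_{yf} f*`. -/
def extPEquiv (y e f : T) : Ω ≃. Ω :=
  ((α.pequiv f).symm.trans
    (((α.pequiv f).trans (α.pequiv y)).trans ((α.pequiv f).trans (α.pequiv y)).symm)).trans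
      (α.pequiv e)

theorem extPEquiv_eq_some {y e f : T} {u v : Ω} : α.extPEquiv y e f u = some v ↔
    ∃ c w, α.act f c = some u ∧ α.act e c = some v ∧ α.act y u = some w := by
  simp only [extPEquiv, PEquiv.trans_eq_some, PEquiv.eq_some_iff, pequiv_apply]
  constructor
  · rintro ⟨c, ⟨c', h1, w, ⟨u', h3, h4⟩, u'', h5, h6⟩, h2⟩
    rw [h1] at h3
    cases h3
    have := α.inj _ _ _ _ h4 h6
    subst this
    have := α.inj _ _ _ _ h5 h1
    subst this
    exact ⟨c, w, h1, h2, h4⟩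
  · rintro ⟨c, w, h1, h2, h3⟩
    exact ⟨c, ⟨c, h1, w, ⟨u, h1, h3⟩, u, h1, h3⟩, h2⟩

/-- Axiom `lcm` of a partial action says that the partial injection of x*y is the union of those of
the words e Q_{yf} f* over the minimal common extensions. Axiom `unique` says that a point lies in
the domain of at most one of them, since xe = yf has the fixed degree d(x) ∨ d(y). So the union
becomes a sum of operators. -/
theorem extension_sum (x y : T) (l : List (T × T)) (hl : l.Nodup)
    (hmem : ∀ c, c ∈ l ↔ c ∈ minCommonExt S.mul S.d x y) :
    star (shiftOp (α.pequiv x)) * shiftOp (α.pequiv y) =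
      (l.map fun c => shiftOp (α.extPEquiv y c.1 c.2)).sum := by
  rw [← List.sum_toFinset _ hl, star_shiftOp, ← shiftOp_trans]
  refine shiftOp_eq_sum _ _ _ ?_ ?_
  · intro u v
    simp only [PEquiv.trans_eq_some, pequiv_symm_eq_some, pequiv_apply, extPEquiv_eq_some,
      List.mem_toFinset]
    constructor
    · rintro ⟨w, h1, h2⟩
      obtain ⟨e, f, g, c, he, hf, hd, hc, hc'⟩ := α.lcm _ _ _ _ _ h2 h1
      exact ⟨(e, f), (hmem _).2 ⟨g, he, hf, hd⟩, c, w, hc', hc, h1⟩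
    · rintro ⟨⟨e, f⟩, hc, c, w, h1, h2, h3⟩
      obtain ⟨g, hg, hg', hd⟩ := (hmem _).1 hc
      obtain ⟨v', hv', h4⟩ := α.act_of_mul hg (α.act_mul hg' h1 h3)
      rw [h2] at hv'
      cases hv'
      exact ⟨w, h3, h4⟩
  · rintro u v v' ⟨e, f⟩ hc ⟨e', f'⟩ hc' h h'
    rw [extPEquiv_eq_some] at h h'
    obtain ⟨c, w, h1, h2, h3⟩ := h
    obtain ⟨c', w', h1', h2', h3'⟩ := h'
    obtain ⟨g, hg1, hg2, hgd⟩ := (hmem _).1 (List.mem_toFinset.1 hc)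
    obtain ⟨g', hg1', hg2', hgd'⟩ := (hmem _).1 (List.mem_toFinset.1 hc')
    simp only at h1 h2 h1' h2' hg1 hg2 hg1' hg2'
    have hgg := α.unique _ _ _ _ _ (α.act_mul hg2 h1 h3)
      ((α.act_mul hg2' h1' (h3'.trans (h3'.symm.trans h3)))) (hgd.trans hgd'.symm)
    subst hgg
    rw [S.mul_left_cancel hg1 hg1', S.mul_left_cancel hg2 hg2']

theorem eval_sum {G A : Type*} [NonUnitalRing A] [StarRing A] [Module ℂ A] (f : G → A)
    (l : List (StarTerm G)) : (StarTerm.sum l).eval f = (l.map (StarTerm.eval f)).sum := by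
  induction l with
  | nil => rfl
  | cons a l ih => simp [StarTerm.sum, StarTerm.eval, ih]

/-- The representation of the freely generated semigraph algebra given by a partial action. -/
def rep : S.FreeAlg →⋆ₙₐ[ℂ] (Ell2 Ω →L[ℂ] Ell2 Ω) :=
  PresentedStarAlgebra.lift (fun t => shiftOp (α.pequiv t)) (by
    intro a b h
    induction h with
    | partialIsometry t =>
      simp only [StarTerm.eval]
      rw [shiftOp_mul_star]
      refine ext_delta fun u => ?_
      change indicatorOp _ (shiftOp _ (delta u)) = _
      rcases h : α.pequiv t u with _ | w
      · rw [shiftOp_delta_none h, map_zero]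
      · rw [shiftOp_delta_some h, indicatorOp_delta, if_pos ⟨u, h⟩]
    | idempotent e he =>
      simp only [StarTerm.eval]
      rw [α.shiftOp_zero he, indicatorOp_mul, Set.inter_self]
    | selfAdjoint e he =>
      simp only [StarTerm.eval]
      rw [α.shiftOp_zero he, star_indicatorOp]
    | mul_defined x y z h => exact α.shiftOp_mul h
    | mul_undefined x y h => exact α.shiftOp_mul_none h
    | source_comm x y =>
      simp only [StarTerm.eval]
      rw [star_mul_shiftOp, star_mul_shiftOp, indicatorOp_mul, indicatorOp_mul, Set.inter_comm]
    | expansion x y l hl hmem =>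
      simp only [StarTerm.eval]
      rw [eval_sum, α.extension_sum x y l hl hmem, List.map_map]
      congr 1
      refine List.map_congr_left fun c _ => ?_
      simp only [Function.comp_apply, StarTerm.eval, extPEquiv, ← shiftOp_trans, star_shiftOp,
        PEquiv.trans_assoc])

theorem rep_ι (t : T) : α.rep (S.ι t) = shiftOp (α.pequiv t) := rfl

end PartialAction

variable {S}

/-! ### The action on the points of tail sets -/

variable (S) in
/-- The pairs `(R, y)` where `R` is a tail set and `y ∈ R`. -/
abbrev TailPts : Type u := {p : S.TailSet × T // p.2 ∈ p.1.carrier}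

variable (S) in
/-- The partial map `(R, y) ↦ (R, x y)`. -/
def tailAct (x : T) (p : S.TailPts) : Option S.TailPts :=
  (S.mul x p.1.2).bind fun z =>
    if h : z ∈ p.1.1.carrier then some ⟨(p.1.1, z), h⟩ else none

theorem tailAct_eq_some {x : T} {p q : S.TailPts} :
    S.tailAct x p = some q ↔ S.mul x p.1.2 = some q.1.2 ∧ q.1.1 = p.1.1 := by
  obtain ⟨⟨R, y⟩, hy⟩ := p
  obtain ⟨⟨R', y'⟩, hy'⟩ := q
  simp only [tailAct, Option.bind_eq_some_iff]
  constructor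
  · rintro ⟨z, hz, h⟩
    split_ifs at h with h'
    cases h
    exact ⟨hz, rfl⟩
  · rintro ⟨h, rfl⟩
    exact ⟨y', h, by rw [dif_pos hy']⟩

/-- The action on the points of tail sets. -/
def tailAction (hid : S.IdemZero) : S.PartialAction S.TailPts where
  act := S.tailAct
  assoc x y p := by
    ext q
    simp only [Option.bind_eq_some_iff, tailAct_eq_some]
    constructor
    · rintro ⟨z, hz, hq, hR⟩
      obtain ⟨c, hc, hc'⟩ := S.assoc_left hz hq
      exact ⟨⟨(p.1.1, c), p.1.1.tail _ _ _ hc' (hR ▸ q.2)⟩, ⟨hc, rfl⟩, hc', hR⟩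
    · rintro ⟨r, ⟨h1, h2⟩, h3, h4⟩
      obtain ⟨a, ha, ha'⟩ := S.assoc_right h1 h3
      exact ⟨a, ha, ha', h4.trans h2⟩
  inj x u u' w h h' := by
    rw [tailAct_eq_some] at h h'
    refine Subtype.ext (Prod.ext (h.2.symm.trans h'.2) (S.mul_left_cancel h.1 h'.1))
  one e u w he h := by
    rw [tailAct_eq_some] at h
    exact Subtype.ext (Prod.ext h.2 (hid.eq_of_zero_mul h.1 he).1)
  lcm x y u v w h h' := by
    rw [tailAct_eq_some] at h h'
    obtain ⟨e, f, g, c, he, hf, hd, hc, hc'⟩ := S.exists_minCommonExt h.1 h'.1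
    -- Closure under right factors keeps the common factor c inside the tail set.
    have hcR : c ∈ w.1.1.carrier := w.1.1.tail _ _ _ hc (h.2 ▸ u.2)
    refine ⟨e, f, g, ⟨(w.1.1, c), hcR⟩, he, hf, hd, ?_, ?_⟩
    · exact tailAct_eq_some.2 ⟨hc, h.2.symm⟩
    · exact tailAct_eq_some.2 ⟨hc', h'.2.symm⟩
  unique x x' u u' w h h' hd := by
    rw [tailAct_eq_some] at h h'
    exact (S.factor_unique h.1 h'.1 hd).1

/-! ### The action on `Δ` -/

theorem deltaMul_inl_eq_some {x : T} {p q : S.DeltaType} :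
    S.deltaMul (.inl x) p = some q ↔
      (∃ y z, p = .inl y ∧ q = .inl z ∧ S.mul x y = some z) ∨
      (∃ y z, p = .inr y ∧ q = .inr z ∧ S.mul x y.1.1 = some z.1.1 ∧ z.1.2 = y.1.2) := by
  rcases p with y | ⟨⟨y, l⟩, hy⟩
  · simp only [deltaMul, Option.map_eq_some_iff]
    constructor
    · rintro ⟨z, hz, rfl⟩
      exact .inl ⟨y, z, rfl, rfl, hz⟩
    · rintro (⟨y', z, h, rfl, hz⟩ | ⟨y', z, h, _⟩)
      · cases h
        exact ⟨z, hz, rfl⟩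
      · cases h
  · simp only [deltaMul, Option.bind_eq_some_iff]
    constructor
    · rintro ⟨z, hz, h⟩
      split_ifs at h with h'
      cases h
      exact .inr ⟨_, _, rfl, rfl, hz, rfl⟩
    · rintro (⟨y', z, h, _⟩ | ⟨y', ⟨⟨z, l'⟩, hz⟩, h, rfl, h1, h2⟩)
      · cases h
      · cases h
        simp only at h1 h2
        subst h2
        exact ⟨z, h1, by rw [dif_pos hz]⟩

/-- The action on `Δ`. -/
def deltaAction (hid : S.IdemZero) : S.PartialAction S.DeltaType where
  act x p := S.deltaMul (.inl x) p
  assoc x y p := by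
    have := S.Delta.assoc (.inl x) (.inl y) p
    simpa [Delta, deltaMul, Option.bind_map, Function.comp_def] using this
  inj x _ _ w h h' := S.Delta_leftCancellative _ _ _ _ h h'
  one e u w he h := by
    rw [deltaMul_inl_eq_some] at h
    rcases h with ⟨y, z, rfl, rfl, h⟩ | ⟨⟨⟨y, l⟩, hy⟩, ⟨⟨z, l'⟩, hz⟩, rfl, rfl, h, h'⟩
    · rw [(hid.eq_of_zero_mul h he).1]
    · simp only at h h'
      subst h'
      have := (hid.eq_of_zero_mul h he).1
      subst this
      rfl
  lcm x y u v w h h' := by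
    simp only [deltaMul_inl_eq_some] at h h' ⊢
    rcases h with ⟨y1, z, rfl, rfl, h⟩ | ⟨⟨⟨y1, l⟩, hy⟩, ⟨⟨z, l'⟩, hz⟩, rfl, rfl, h, hl⟩
    · obtain ⟨y2, z', rfl, h1, h'⟩ | ⟨_, _, _, h1, _⟩ := h'
      · cases h1
        obtain ⟨e, f, g, c, he, hf, hd, hc, hc'⟩ := S.exists_minCommonExt h h'
        exact ⟨e, f, g, .inl c, he, hf, hd, .inl ⟨_, _, rfl, rfl, hc⟩, .inl ⟨_, _, rfl, rfl, hc'⟩⟩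
      · cases h1
    · obtain ⟨_, _, _, h1, _⟩ | ⟨⟨⟨y2, l2⟩, hy2⟩, z', rfl, h1, h', hl'⟩ := h'
      · cases h1
      · cases h1
        simp only at h h' hl hl'
        subst hl hl'
        obtain ⟨e, f, g, c, he, hf, hd, hc, hc'⟩ := S.exists_minCommonExt h h'
        obtain ⟨a, ha, hya⟩ := hy
        -- The symbol at c is still in Δ because c is a right factor of y₁, which lies below a.
        exact ⟨e, f, g, .inr ⟨(c, l'), a, ha, le_trans' ⟨e, hc⟩ hya⟩, he, hf, hd,
          .inr ⟨_, _, rfl, rfl, hc, rfl⟩, .inr ⟨_, _, rfl, rfl, hc', rfl⟩⟩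
  unique x x' u u' w h h' hd := by
    rw [deltaMul_inl_eq_some] at h h'
    rcases h with ⟨y1, z, rfl, rfl, h⟩ | ⟨y1, z, rfl, rfl, h, hl⟩
    · obtain ⟨y2, z', rfl, h1, h'⟩ | ⟨_, _, _, h1, _⟩ := h'
      · cases h1
        exact (S.factor_unique h h' hd).1
      · cases h1
    · obtain ⟨_, _, _, h1, _⟩ | ⟨y2, z', rfl, h1, h', hl'⟩ := h'
      · cases h1
      · cases h1
        exact (S.factor_unique h h' hd).1

theorem leftRegular_eq_shiftOp (hid : S.IdemZero) (x : T) :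
    leftRegular S.Delta (.inl x) = shiftOp ((deltaAction hid).pequiv x) := by
  refine ext_delta fun u => ?_
  rw [shiftOp_delta]
  exact leftRegular_single _ S.Delta_leftCancellative _ _

/-- No product in Δ has its left factor in Δ_μ. These elements enlarge the Hilbert space but
contribute no new operators. -/
theorem leftRegular_inr (q : {q : T × List T // ∃ a ∈ q.2, S.le q.1 a}) :
    leftRegular S.Delta (.inr q) = 0 :=
  ext_delta fun _ => leftRegular_single _ S.Delta_leftCancellative _ _

end Semigraph

theorem PresentedStarAlgebra.mk_sum {G : Type u} (r : StarTerm G → StarTerm G → Prop)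
    (l : List (StarTerm G)) : mk r (StarTerm.sum l) = (l.map (mk r)).sum := by
  induction l with
  | nil => rfl
  | cons a l ih => rw [StarTerm.sum, mk_add, ih, List.map_cons, List.sum_cons]

namespace Semigraph

variable {k : Type v} {T : Type u} (S : Semigraph k T)

/-! ### Relations in the freely generated semigraph algebra -/

theorem ι_mul {x y z : T} (h : S.mul x y = some z) : S.ι x * S.ι y = S.ι z :=
  PresentedStarAlgebra.mk_eq (.of (.mul_defined x y z h))

theorem ι_mul_none {x y : T} (h : S.mul x y = none) : S.ι x * S.ι y = 0 :=
  PresentedStarAlgebra.mk_eq (.of (.mul_undefined x y h))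

theorem ι_mul_star_mul (x : T) : S.ι x * star (S.ι x) * S.ι x = S.ι x :=
  PresentedStarAlgebra.mk_eq (.of (.partialIsometry x))

theorem star_ι_zero {e : T} (he : S.d e = 0) : star (S.ι e) = S.ι e :=
  PresentedStarAlgebra.mk_eq (.of (.selfAdjoint e he))

theorem ι_zero_mul_self {e : T} (he : S.d e = 0) : S.ι e * S.ι e = S.ι e :=
  PresentedStarAlgebra.mk_eq (.of (.idempotent e he))

/-- The source projection of a generator. -/
def Q' (x : T) : S.FreeAlg := sourceProj (S.ι x)

theorem Q'_def (x : T) : S.Q' x = star (S.ι x) * S.ι x := rfl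

theorem Q'_comm (x y : T) : S.Q' x * S.Q' y = S.Q' y * S.Q' x :=
  PresentedStarAlgebra.mk_eq (.of (.source_comm x y))

theorem star_ι_mul_ι_list (x y : T) (l : List (T × T)) (hl : l.Nodup)
    (hmem : ∀ c, c ∈ l ↔ c ∈ minCommonExt S.mul S.d x y) :
    star (S.ι x) * S.ι y = (l.map fun c => S.ι c.1 *
      (star (S.ι y * S.ι c.2) * (S.ι y * S.ι c.2)) * star (S.ι c.2)).sum := by
  refine (PresentedStarAlgebra.mk_eq (.of (.expansion x y l hl hmem))).trans ?_
  rw [PresentedStarAlgebra.mk_sum, List.map_map]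
  rfl

theorem star_Q' (x : T) : star (S.Q' x) = S.Q' x := by
  rw [Q'_def, star_mul, star_star]

theorem ι_mul_Q' (x : T) : S.ι x * S.Q' x = S.ι x := by
  rw [Q'_def, ← mul_assoc, ι_mul_star_mul]

theorem Q'_mul_star_ι (x : T) : S.Q' x * star (S.ι x) = star (S.ι x) := by
  have := congrArg star (S.ι_mul_Q' x)
  rwa [star_mul, star_Q'] at this

theorem Q'_mul_self (x : T) : S.Q' x * S.Q' x = S.Q' x := by
  rw [Q'_def, mul_assoc, ← mul_assoc (S.ι x), ι_mul_star_mul]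

theorem Q'_zero {e : T} (he : S.d e = 0) : S.Q' e = S.ι e := by
  rw [Q'_def, star_ι_zero S he, ι_zero_mul_self S he]

/-- If y = ax then Q_y = x*a*y begins with x*, which absorbs Q_x. Hence source projections decrease
along right factors. -/
theorem Q'_mul_of_le {x y : T} (h : S.le x y) : S.Q' x * S.Q' y = S.Q' y := by
  obtain ⟨a, ha⟩ := h
  rw [Q'_def S y, ← S.ι_mul ha, star_mul, ← mul_assoc, ← mul_assoc (S.Q' x), Q'_mul_star_ι]

theorem star_ι_mul {x y z : T} (h : S.mul x y = some z) :
    star (S.ι y) * star (S.ι x) = star (S.ι z) := by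
  rw [← S.ι_mul h, star_mul]

variable {S}

/-- Since y = rx already extends r, the only common extension of r and y of degree d(r) ∨ d(y) =
d(y) is y itself. -/
theorem minCommonExt_mul (hid : S.IdemZero) {r x y : T} (h : S.mul r x = some y) (c : T × T) :
    c ∈ [(x, S.src y)] ↔ c ∈ minCommonExt S.mul S.d r y := by
  obtain ⟨e, f⟩ := c
  have hd : S.d r ≤ S.d y := by rw [S.d_mul _ _ _ h]; exact le_self_add
  simp only [List.mem_singleton, Prod.mk.injEq]
  constructor
  · rintro ⟨rfl, rfl⟩
    exact ⟨y, h, hid.mul_src y, (sup_eq_right.2 hd).symm⟩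
  · rintro ⟨z, h1, h2, h3⟩
    rw [sup_eq_right.2 hd] at h3
    obtain ⟨h4, h5⟩ := hid.eq_of_mul_zero h2 (S.d_eq_zero_of_mul_right h2 h3)
    simp only at h1 h4 h5
    rw [h4] at h1
    exact ⟨S.mul_left_cancel h1 h, h5.symm⟩

theorem Q'_mul_src (hid : S.IdemZero) (x : T) : S.Q' x * S.ι (S.src x) = S.Q' x := by
  rw [Q'_def, mul_assoc, S.ι_mul (hid.mul_src x)]

/-- The exchange relation Q_r x = x Q_{rx}: expand r*(rx) over the single minimal common extension
of r and rx. It lets source projections be moved past generators. -/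
theorem Q'_mul_ι (hid : S.IdemZero) {r x y : T} (h : S.mul r x = some y) :
    S.Q' r * S.ι x = S.ι x * S.Q' y := by
  rw [Q'_def, mul_assoc, S.ι_mul h,
    S.star_ι_mul_ι_list r y [(x, S.src y)] (List.nodup_singleton _) (minCommonExt_mul hid h)]
  simp only [List.map_cons, List.map_nil, List.sum_cons, List.sum_nil, add_zero]
  rw [S.ι_mul (hid.mul_src y), S.star_ι_zero (hid.d_src y), mul_assoc, ← Q'_def, Q'_mul_src hid]

theorem Q'_mul_ι_none {r x : T} (h : S.mul r x = none) : S.Q' r * S.ι x = 0 := by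
  rw [Q'_def, mul_assoc, S.ι_mul_none h, mul_zero]

theorem star_ι_mul_Q' (hid : S.IdemZero) {r x y : T} (h : S.mul r x = some y) :
    star (S.ι x) * S.Q' r = S.Q' y * star (S.ι x) := by
  have := congrArg star (Q'_mul_ι hid h)
  rwa [star_mul, star_mul, star_Q', star_Q'] at this

theorem star_ι_mul_Q'_none {r x : T} (h : S.mul r x = none) : star (S.ι x) * S.Q' r = 0 := by
  have := congrArg star (Q'_mul_ι_none h)
  rwa [star_mul, star_Q', star_zero] at this

/-- A degree-zero element other than the source of x cannot be multiplied to x from the right, so e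
= e* kills Q_x. -/
theorem ι_zero_mul_Q' (hid : S.IdemZero) {e x : T} (he : S.d e = 0) (h : S.src x ≠ e) :
    S.ι e * S.Q' x = 0 := by
  have h1 : S.mul x e = none := by
    rcases h2 : S.mul x e with _ | z
    · rfl
    · exact absurd (hid.eq_of_mul_zero h2 he).2 h
  have := star_ι_mul_Q'_none h1
  rwa [S.star_ι_zero he] at this

theorem src_mul_Q' (hid : S.IdemZero) (x : T) : S.ι (S.src x) * S.Q' x = S.Q' x := by
  have := congrArg star (Q'_mul_src hid x)
  rwa [star_mul, star_Q', S.star_ι_zero (hid.d_src x)] at this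

/-! ### Standard words -/

variable (S) in
/-- Multiplication by the product of the source projections of a list of elements. -/
def qm : List T → S.FreeAlg →ₗ[ℂ] S.FreeAlg
  | [] => LinearMap.id
  | r :: l => LinearMap.mulLeft ℂ (S.Q' r) ∘ₗ qm l

theorem qm_nil (y : S.FreeAlg) : S.qm [] y = y := rfl

theorem qm_cons (r : T) (l : List T) (y : S.FreeAlg) : S.qm (r :: l) y = S.Q' r * S.qm l y := rfl

theorem qm_mul (l : List T) (y z : S.FreeAlg) : S.qm l y * z = S.qm l (y * z) := by
  induction l with
  | nil => rfl
  | cons r l ih => rw [qm_cons, qm_cons, mul_assoc, ih]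

theorem qm_append (l l' : List T) (y : S.FreeAlg) : S.qm (l ++ l') y = S.qm l (S.qm l' y) := by
  induction l with
  | nil => rfl
  | cons r l ih => rw [List.cons_append, qm_cons, qm_cons, ih]

theorem Q'_mul_qm (r : T) (l : List T) (y : S.FreeAlg) :
    S.Q' r * S.qm l y = S.qm l (S.Q' r * y) := by
  induction l with
  | nil => rfl
  | cons a l ih => rw [qm_cons, qm_cons, ← ih, ← mul_assoc, Q'_comm, mul_assoc]

theorem qm_comm (l l' : List T) (y : S.FreeAlg) : S.qm l (S.qm l' y) = S.qm l' (S.qm l y) := by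
  induction l with
  | nil => rfl
  | cons a l ih => rw [qm_cons, qm_cons, ih, Q'_mul_qm]

theorem qm_eq_self {l : List T} {y : S.FreeAlg} (h : ∀ r ∈ l, S.Q' r * y = y) : S.qm l y = y := by
  induction l with
  | nil => rfl
  | cons a l ih =>
    rw [qm_cons, ih fun r hr => h r (List.mem_cons_of_mem _ hr), h a List.mem_cons_self]

theorem Q'_mul_qm_of_mem {r : T} {l : List T} (h : r ∈ l) (y : S.FreeAlg) :
    S.Q' r * S.qm l y = S.qm l y := by
  induction l with
  | nil => cases h
  | cons a l ih =>
    rcases List.mem_cons.1 h with rfl | h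
    · rw [qm_cons, ← mul_assoc, Q'_mul_self]
    · rw [qm_cons, ← mul_assoc, Q'_comm, mul_assoc, ih h]

theorem Q'_mul_qm_of_le {r r' : T} {l : List T} (hr : r ∈ l) (h : S.le r' r) (y : S.FreeAlg) :
    S.Q' r' * S.qm l y = S.qm l y := by
  rw [← Q'_mul_qm_of_mem hr, ← mul_assoc, Q'_mul_of_le S h]

variable (S) in
/-- The word `s Q_{r₁} ⋯ Q_{rₙ} t*`. -/
def word (s : T) (l : List T) (t : T) : S.FreeAlg := S.ι s * S.qm l (star (S.ι t))

/-- The letters s and t may be added to the list for free, since s = s Q_s and t* = Q_t t*. In this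
form the word depends on s, t and the tails of the whole list only. -/
theorem word_eq (s : T) (l : List T) (t : T) :
    S.word s l t = S.ι s * S.qm (s :: t :: l) (star (S.ι t)) := by
  rw [word, qm_cons, ← mul_assoc, ι_mul_Q', qm_cons, Q'_mul_qm, Q'_mul_star_ι]

/-- Moves source projections to the right past a generator by the exchange relation; one undefined
product re makes everything vanish. -/
theorem qm_mul_ι (hid : S.IdemZero) (l : List T) (e : T) :
    (∀ y, S.qm l (S.ι e * y) = 0) ∨ ∃ l', ∀ y, S.qm l (S.ι e * y) = S.ι e * S.qm l' y := by
  induction l with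
  | nil => exact .inr ⟨[], fun y => rfl⟩
  | cons r l ih =>
    rcases ih with h | ⟨l', h⟩
    · exact .inl fun y => by rw [qm_cons, h, mul_zero]
    · rcases hr : S.mul r e with _ | z
      · exact .inl fun y => by rw [qm_cons, h, ← mul_assoc, Q'_mul_ι_none hr, zero_mul]
      · refine .inr ⟨z :: l', fun y => ?_⟩
        rw [qm_cons, h, ← mul_assoc, Q'_mul_ι hid hr, mul_assoc, qm_cons]

theorem star_ι_mul_qm (hid : S.IdemZero) (l : List T) (f : T) :
    (∀ y, star (S.ι f) * S.qm l y = 0) ∨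
      ∃ l', ∀ y, star (S.ι f) * S.qm l y = S.qm l' (star (S.ι f) * y) := by
  induction l with
  | nil => exact .inr ⟨[], fun y => rfl⟩
  | cons r l ih =>
    rcases hr : S.mul r f with _ | z
    · exact .inl fun y => by rw [qm_cons, ← mul_assoc, star_ι_mul_Q'_none hr, zero_mul]
    · rcases ih with h | ⟨l', h⟩
      · exact .inl fun y => by rw [qm_cons, ← mul_assoc, star_ι_mul_Q' hid hr, mul_assoc, h, mul_zero]
      · refine .inr ⟨z :: l', fun y => ?_⟩
        rw [qm_cons, ← mul_assoc, star_ι_mul_Q' hid hr, mul_assoc, h, qm_cons]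

variable (S) in
/-- The span of the words `s p t*` with a given relation between `s` and `t`. -/
def wordSpan (p : T → T → Prop) : Submodule ℂ S.FreeAlg :=
  Submodule.span ℂ {w | ∃ s l t, p s t ∧ S.word s l t = w}

theorem word_mem_wordSpan {p : T → T → Prop} {s t : T} (l : List T) (h : p s t) :
    S.word s l t ∈ S.wordSpan p := Submodule.subset_span ⟨s, l, t, h, rfl⟩

theorem wordSpan_mono {p q : T → T → Prop} (h : ∀ s t, p s t → q s t) :
    S.wordSpan p ≤ S.wordSpan q := by
  refine Submodule.span_mono ?_
  rintro _ ⟨s, l, t, hp, rfl⟩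
  exact ⟨s, l, t, h s t hp, rfl⟩

theorem wordSpan_map_le {p : T → T → Prop} {M : Submodule ℂ S.FreeAlg}
    (f : S.FreeAlg →ₗ[ℂ] S.FreeAlg) (h : ∀ s l t, p s t → f (S.word s l t) ∈ M)
    {x : S.FreeAlg} (hx : x ∈ S.wordSpan p) : f x ∈ M := by
  have : S.wordSpan p ≤ M.comap f := by
    refine Submodule.span_le.2 ?_
    rintro _ ⟨s, l, t, hp, rfl⟩
    exact h s l t hp
  exact this hx

/-- The relation satisfied by `(a, b)` if the word `a p b*` occurs in the expansion of the product
of words `s p t*` and `s' p t'*`. -/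
def ProdRel (S : Semigraph k T) (s t s' t' a b : T) : Prop :=
  ∃ e f g, S.mul t e = some g ∧ S.mul s' f = some g ∧ S.d g = S.d t ⊔ S.d s' ∧
    S.mul s e = some a ∧ S.mul t' f = some b

variable (hid : S.IdemZero) (hS : S.FinitelyAligned)

include hid hS

/-- Expand x*s by the defining relation, then push the source projections so that each summand is
again a word or zero. The recorded relation between the outer letters carries all later degree
bookkeeping. -/
theorem star_ι_mul_word (x s : T) (l : List T) (t : T) :
    star (S.ι x) * S.word s l t ∈ S.wordSpan fun e b => ∃ f g, S.mul x e = some g ∧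
      S.mul s f = some g ∧ S.d g = S.d x ⊔ S.d s ∧ S.mul t f = some b := by
  rw [word, ← mul_assoc, S.star_ι_mul_ι_list x s (hS x s).toFinset.toList
    (Finset.nodup_toList _) (by simp), ← List.sum_toFinset _ (Finset.nodup_toList _),
    Finset.sum_mul]
  refine Submodule.sum_mem _ ?_
  rintro ⟨e, f⟩ hc
  simp only [Finset.toList_toFinset, Set.Finite.mem_toFinset] at hc
  obtain ⟨g, h1, h2, h3⟩ := hc
  simp only at h1 h2 ⊢
  rw [S.ι_mul h2, mul_assoc, mul_assoc]
  rcases star_ι_mul_qm hid l f with h | ⟨l', h⟩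
  · rw [h, mul_zero, mul_zero]
    exact Submodule.zero_mem _
  · rw [h]
    rcases h4 : S.mul t f with _ | b
    · have : star (S.ι f) * star (S.ι t) = 0 := by
        rw [← star_mul, S.ι_mul_none h4, star_zero]
      rw [this, map_zero, mul_zero, mul_zero]
      exact Submodule.zero_mem _
    · rw [S.star_ι_mul h4]
      exact word_mem_wordSpan (s := e) (t := b) (g :: l') ⟨f, g, h1, h2, h3, h4⟩

theorem word_mul_word (s t s' t' : T) (l l' : List T) :
    S.word s l t * S.word s' l' t' ∈ S.wordSpan (S.ProdRel s t s' t') := by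
  rw [word, mul_assoc, qm_mul]
  refine wordSpan_map_le (LinearMap.mulLeft ℂ (S.ι s) ∘ₗ S.qm l) ?_
    (star_ι_mul_word hid hS t s' l' t')
  rintro e m b ⟨f, g, h1, h2, h3, h4⟩
  simp only [LinearMap.comp_apply, LinearMap.mulLeft_apply, word]
  rcases qm_mul_ι hid l e with h | ⟨m', h⟩
  · rw [h, mul_zero]
    exact Submodule.zero_mem _
  · rw [h, ← mul_assoc]
    rcases h5 : S.mul s e with _ | a
    · rw [S.ι_mul_none h5, zero_mul]
      exact Submodule.zero_mem _
    · rw [S.ι_mul h5]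
      rw [← qm_append]
      exact word_mem_wordSpan (s := a) (t := b) _ ⟨e, f, g, h1, h2, h3, h5, h4⟩

/-- Words span the algebra. -/
theorem wordSpan_eq_top : S.wordSpan (fun _ _ => True) = ⊤ := by
  set M := S.wordSpan (fun _ _ => True)
  have hmul : ∀ x, ∀ y ∈ M, S.ι x * y ∈ M := by
    intro x y hy
    refine wordSpan_map_le (LinearMap.mulLeft ℂ (S.ι x)) ?_ hy
    intro s l t _
    rw [LinearMap.mulLeft_apply, word, ← mul_assoc]
    rcases h : S.mul x s with _ | z
    · rw [S.ι_mul_none h, zero_mul]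
      exact Submodule.zero_mem _
    · rw [S.ι_mul h]
      exact word_mem_wordSpan l trivial
  have hstar : ∀ x, ∀ y ∈ M, star (S.ι x) * y ∈ M := by
    intro x y hy
    refine wordSpan_map_le (LinearMap.mulLeft ℂ (star (S.ι x))) ?_ hy
    intro s l t _
    exact wordSpan_mono (fun _ _ _ => trivial) (star_ι_mul_word hid hS x s l t)
  -- The induction carries a together with its adjoint, and left multiplication by both, because
  -- products and adjoints of expressions call for all four statements.
  have key : ∀ a : S.FreeAlg, a ∈ M ∧ star a ∈ M ∧ ∀ y ∈ M, a * y ∈ M ∧ star a * y ∈ M := by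
    intro a
    induction a using PresentedStarAlgebra.ind with | _ a
    induction a with
    | gen t =>
      refine ⟨?_, ?_, fun y hy => ⟨hmul t y hy, hstar t y hy⟩⟩
      · have : S.word t [] (S.src t) = S.ι t := by
          rw [word, qm_nil, S.star_ι_zero (hid.d_src t), S.ι_mul (hid.mul_src t)]
        change S.ι t ∈ M
        exact this ▸ word_mem_wordSpan (p := fun _ _ => True) [] trivial
      · have : S.word (S.src t) [] t = star (S.ι t) := by
          rw [word, qm_nil, ← S.star_ι_zero (hid.d_src t), S.star_ι_mul (hid.mul_src t)]
        change star (S.ι t) ∈ M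
        exact this ▸ word_mem_wordSpan (p := fun _ _ => True) [] trivial
    | zero =>
      rw [PresentedStarAlgebra.mk_zero, star_zero]
      exact ⟨M.zero_mem, M.zero_mem, fun y _ => by simp⟩
    | add a b ha hb =>
      rw [PresentedStarAlgebra.mk_add, star_add]
      refine ⟨M.add_mem ha.1 hb.1, M.add_mem ha.2.1 hb.2.1, fun y hy => ?_⟩
      rw [add_mul, add_mul]
      exact ⟨M.add_mem (ha.2.2 y hy).1 (hb.2.2 y hy).1, M.add_mem (ha.2.2 y hy).2 (hb.2.2 y hy).2⟩
    | neg a ha =>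
      rw [PresentedStarAlgebra.mk_neg, star_neg]
      refine ⟨M.neg_mem ha.1, M.neg_mem ha.2.1, fun y hy => ?_⟩
      rw [neg_mul, neg_mul]
      exact ⟨M.neg_mem (ha.2.2 y hy).1, M.neg_mem (ha.2.2 y hy).2⟩
    | smul z a ha =>
      rw [PresentedStarAlgebra.mk_smul, star_smul]
      refine ⟨M.smul_mem _ ha.1, M.smul_mem _ ha.2.1, fun y hy => ?_⟩
      rw [smul_mul_assoc, smul_mul_assoc]
      exact ⟨M.smul_mem _ (ha.2.2 y hy).1, M.smul_mem _ (ha.2.2 y hy).2⟩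
    | mul a b ha hb =>
      rw [PresentedStarAlgebra.mk_mul, star_mul]
      refine ⟨(ha.2.2 _ hb.1).1, (hb.2.2 _ ha.2.1).2, fun y hy => ?_⟩
      rw [mul_assoc, mul_assoc]
      exact ⟨(ha.2.2 _ (hb.2.2 y hy).1).1, (hb.2.2 _ (ha.2.2 y hy).2).2⟩
    | adj a ha =>
      rw [PresentedStarAlgebra.mk_adj, star_star]
      exact ⟨ha.2.1, ha.1, fun y hy => (ha.2.2 y hy).symm⟩
  exact eq_top_iff.2 fun a _ => (key a).1

omit hid hS

/-! ### Values of words in representations -/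

namespace PartialAction

variable {Ω : Type u} (α : S.PartialAction Ω)

/-- The points at which all elements of a list can be applied. -/
def dom (l : List T) : Set Ω := {u | ∀ r ∈ l, ∃ v, α.act r u = some v}

theorem rep_Q' (r : T) : α.rep (S.Q' r) = indicatorOp {u | ∃ v, α.act r u = some v} := by
  rw [Q'_def, map_mul, map_star, rep_ι, star_mul_shiftOp]
  rfl

theorem rep_qm (l : List T) (y : S.FreeAlg) :
    α.rep (S.qm l y) = indicatorOp (α.dom l) * α.rep y := by
  induction l with
  | nil =>
    have : α.dom [] = Set.univ := by ext; simp [dom]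
    rw [this, qm_nil]
    refine ext_delta fun u => ?_
    change _ = indicatorOp _ (α.rep y (delta u))
    ext v
    rw [indicatorOp_apply, if_pos (Set.mem_univ v)]
  | cons r l ih =>
    rw [qm_cons, map_mul, ih, rep_Q', ← mul_assoc, indicatorOp_mul]
    congr 2
    ext u
    simp [dom]

/-- The partial injection given by a word. -/
def wordPEquiv (s : T) (l : List T) (t : T) : Ω ≃. Ω :=
  ((α.pequiv t).symm.trans (PEquiv.ofSet (α.dom l))).trans (α.pequiv s)

theorem rep_word (s : T) (l : List T) (t : T) :
    α.rep (S.word s l t) = shiftOp (α.wordPEquiv s l t) := by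
  rw [word, map_mul, rep_qm, map_star, rep_ι, rep_ι, star_shiftOp, wordPEquiv, shiftOp_trans,
    shiftOp_trans]
  rfl

theorem wordPEquiv_eq_some {s : T} {l : List T} {t : T} {u v : Ω} :
    α.wordPEquiv s l t u = some v ↔
      ∃ c ∈ α.dom l, α.act t c = some u ∧ α.act s c = some v := by
  simp only [wordPEquiv, PEquiv.trans_eq_some, PEquiv.eq_some_iff, pequiv_apply,
    PEquiv.ofSet_eq_some_iff]
  constructor
  · rintro ⟨c, ⟨_, h1, rfl, h2⟩, h3⟩
    exact ⟨c, h2, h1, h3⟩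
  · rintro ⟨c, h1, h2, h3⟩
    exact ⟨c, ⟨c, h2, rfl, h1⟩, h3⟩

end PartialAction

/-! ### Linear independence of words -/

variable (S) in
/-- Standard words up to equality: triples `(s, R, t)` where the tail set `R` is finitely generated
and contains `s` and `t`. -/
structure WordKey where
  s : T
  t : T
  l : List T
  tails : S.TailSet
  s_mem : s ∈ tails.carrier
  t_mem : t ∈ tails.carrier
  l_mem : ∀ r ∈ l, r ∈ tails.carrier
  gen : ∀ R : S.TailSet, s ∈ R.carrier → t ∈ R.carrier → (∀ r ∈ l, r ∈ R.carrier) →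
    tails.carrier ⊆ R.carrier
  le : ∀ r ∈ tails.carrier, ∃ r' ∈ s :: t :: l, S.le r r'

/-- The word of a key. -/
def WordKey.word (κ : S.WordKey) : S.FreeAlg := S.word κ.s κ.l κ.t

/-- Every letter must end at the source of s: otherwise s = s·src(s) brings a local unit next to a
source projection that it annihilates. -/
theorem word_eq_zero (hid : S.IdemZero) {s t : T} {l : List T} {r : T} (hr : r ∈ t :: l)
    (h : S.src r ≠ S.src s) : S.word s l t = 0 := by
  have h0 : ∃ y, S.qm (t :: l) (star (S.ι t)) = S.Q' r * y :=
    ⟨_, (Q'_mul_qm_of_mem hr _).symm⟩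
  obtain ⟨y, hy⟩ := h0
  have h1 : S.ι (S.src s) * S.Q' r = 0 := ι_zero_mul_Q' hid (hid.d_src s) h
  rw [word_eq, qm_cons, hy, ← S.ι_mul (hid.mul_src s), mul_assoc, ← mul_assoc (S.Q' s), Q'_comm,
    mul_assoc, ← mul_assoc (S.ι (S.src s)), h1, zero_mul, mul_zero]

theorem exists_wordKey (hid : S.IdemZero) (s t : T) (l : List T) :
    S.word s l t = 0 ∨ ∃ κ : S.WordKey, κ.s = s ∧ κ.t = t ∧ κ.l = l := by
  by_cases h : ∀ r ∈ t :: l, S.src r = S.src s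
  · have h' : ∀ r ∈ s :: t :: l, S.src r = S.src s := by
      intro r hr
      rcases List.mem_cons.1 hr with rfl | hr
      · rfl
      · exact h r hr
    let R := TailSet.gen hid (S.src s) (s :: t :: l) (hid.d_src s) h'
    have hroot : ∀ R' : S.TailSet, s ∈ R'.carrier → S.src s ∈ R'.carrier :=
      fun R' hs => R'.tail _ _ _ (hid.mul_src s) hs
    refine .inr ⟨⟨s, t, l, R, TailSet.mem_gen hid (by simp), TailSet.mem_gen hid (by simp),
      fun r hr => TailSet.mem_gen hid (by simp [hr]), fun R' hs ht hl => ?_, ?_⟩, rfl, rfl, rfl⟩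
    · refine TailSet.gen_subset hid (hroot R' hs) ?_
      intro y hy
      rcases List.mem_cons.1 hy with rfl | hy
      · exact hs
      · rcases List.mem_cons.1 hy with rfl | hy
        · exact ht
        · exact hl _ hy
    · rintro r ⟨a, ha, hr⟩
      rcases List.mem_cons.1 ha with rfl | ha
      · exact ⟨s, by simp, le_trans' hr ⟨s, hid.mul_src s⟩⟩
      · exact ⟨a, ha, hr⟩
  · push Not at h
    obtain ⟨r, hr, h⟩ := h
    exact .inl (word_eq_zero hid hr h)

/-- Each element of the generated tail set is a right factor of one of the generators, so its source
projection is already contained in the product. -/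
theorem WordKey.qm_absorb (κ : S.WordKey) {l : List T} (h : ∀ r ∈ l, r ∈ κ.tails.carrier)
    (y : S.FreeAlg) : S.qm l (S.qm (κ.s :: κ.t :: κ.l) y) = S.qm (κ.s :: κ.t :: κ.l) y := by
  refine qm_eq_self fun r hr => ?_
  obtain ⟨r', hr', hle⟩ := κ.le r (h r hr)
  exact Q'_mul_qm_of_le hr' hle y

/-- Two lists generating the same tail set absorb each other's source projections, so both words
equal the word over the concatenated list. -/
theorem WordKey.word_eq_word {κ κ' : S.WordKey} (hs : κ.s = κ'.s) (ht : κ.t = κ'.t)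
    (hR : κ.tails.carrier = κ'.tails.carrier) : κ.word = κ'.word := by
  rw [WordKey.word, WordKey.word, word_eq, word_eq]
  have hmem : ∀ κ : S.WordKey, ∀ r ∈ κ.s :: κ.t :: κ.l, r ∈ κ.tails.carrier := by
    intro κ r hr
    rcases List.mem_cons.1 hr with rfl | hr
    · exact κ.s_mem
    · rcases List.mem_cons.1 hr with rfl | hr
      · exact κ.t_mem
      · exact κ.l_mem _ hr
  rw [← κ.qm_absorb (hR ▸ hmem κ'), qm_comm, κ'.qm_absorb (hR ▸ hmem κ), hs, ht]

/-- The coefficient of a word at the point of its own key. -/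
theorem WordKey.wordPEquiv_self (hid : S.IdemZero) (κ : S.WordKey) :
    (tailAction hid).wordPEquiv κ.s κ.l κ.t ⟨(κ.tails, κ.t), κ.t_mem⟩ =
      some ⟨(κ.tails, κ.s), κ.s_mem⟩ := by
  rw [PartialAction.wordPEquiv_eq_some]
  refine ⟨⟨(κ.tails, κ.tails.root), κ.tails.root_mem⟩, fun r hr =>
    ⟨⟨(κ.tails, r), κ.l_mem r hr⟩, tailAct_eq_some.2 ⟨κ.tails.mul_root _ (κ.l_mem r hr), rfl⟩⟩, ?_, ?_⟩
  · exact tailAct_eq_some.2 ⟨κ.tails.mul_root _ κ.t_mem, rfl⟩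
  · exact tailAct_eq_some.2 ⟨κ.tails.mul_root _ κ.s_mem, rfl⟩

/-- If the word of κ' maps (R, t) to (R, s), then t = t'c and s = s'c for some c. As d(t') is not
strictly smaller than d(t), c has degree zero. Hence the outer letters agree and the list of κ' lies
in R. -/
theorem WordKey.of_wordPEquiv (hid : S.IdemZero) {κ κ' : S.WordKey}
    (h : (tailAction hid).wordPEquiv κ'.s κ'.l κ'.t ⟨(κ.tails, κ.t), κ.t_mem⟩ =
      some ⟨(κ.tails, κ.s), κ.s_mem⟩) (hd : ¬ S.d κ'.t < S.d κ.t) :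
    κ'.s = κ.s ∧ κ'.t = κ.t ∧ κ'.tails.carrier ⊆ κ.tails.carrier := by
  rw [PartialAction.wordPEquiv_eq_some] at h
  obtain ⟨⟨⟨R, c⟩, hc⟩, hdom, h3, h4⟩ := h
  obtain ⟨h1, hR⟩ := tailAct_eq_some.1 h3
  obtain ⟨h2, _⟩ := tailAct_eq_some.1 h4
  clear h3 h4
  simp only at h1 h2 hR
  subst hR
  have hdt := S.d_mul _ _ _ h1
  have hc0 : S.d c = 0 := by
    by_contra hne
    refine hd (hdt ▸ lt_of_le_of_ne le_self_add fun heq => hne ?_)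
    simpa using heq.symm
  have hs := (hid.eq_of_mul_zero h2 hc0).1
  have ht := (hid.eq_of_mul_zero h1 hc0).1
  refine ⟨hs.symm, ht.symm, κ'.gen _ (hs ▸ κ.s_mem) (ht ▸ κ.t_mem) fun r hr => ?_⟩
  obtain ⟨v, hv⟩ := hdom r hr
  obtain ⟨hv, hvR⟩ := tailAct_eq_some.1 hv
  simp only at hv hvR
  rw [(hid.eq_of_mul_zero hv hc0).1.symm, ← hvR]
  exact v.2

/-- A representative of the keys with the same word. -/
def WordKey.canon (κ : S.WordKey) : S.WordKey :=
  haveI : Nonempty S.WordKey := ⟨κ⟩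
  Function.invFun (fun κ : S.WordKey => (κ.s, κ.t, κ.tails)) (κ.s, κ.t, κ.tails)

theorem WordKey.canon_spec (κ : S.WordKey) :
    κ.canon.s = κ.s ∧ κ.canon.t = κ.t ∧ κ.canon.tails = κ.tails := by
  have : Nonempty S.WordKey := ⟨κ⟩
  have h := Function.invFun_eq (f := fun κ : S.WordKey => (κ.s, κ.t, κ.tails)) ⟨κ, rfl⟩
  exact ⟨congrArg (fun p => p.1) h, congrArg (fun p => p.2.1) h, congrArg (fun p => p.2.2) h⟩

theorem WordKey.canon_eq {κ κ' : S.WordKey} (hs : κ.s = κ'.s) (ht : κ.t = κ'.t)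
    (hR : κ.tails = κ'.tails) : κ.canon = κ'.canon := by
  rw [canon, canon]
  simp only [hs, ht, hR]

/-- One representative per triple (s, t, R) suffices, so distinct words in the spanning set have
distinct triples and can be told apart by matrix coefficients. -/
theorem wordSpan_le_span_canon (hid : S.IdemZero) (p : T → T → Prop) :
    S.wordSpan p ≤
      Submodule.span ℂ (WordKey.word '' {κ : S.WordKey | κ.canon = κ ∧ p κ.s κ.t}) := by
  refine Submodule.span_le.2 ?_
  rintro _ ⟨s, l, t, hp, rfl⟩
  rcases exists_wordKey hid s t l with h | ⟨κ, rfl, rfl, rfl⟩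
  · rw [h]
    exact Submodule.zero_mem _
  · obtain ⟨h1, h2, h3⟩ := κ.canon_spec
    refine Submodule.subset_span ⟨κ.canon, ⟨WordKey.canon_eq h1 h2 h3, by rwa [h1, h2]⟩, ?_⟩
    exact WordKey.word_eq_word h1 h2 (by rw [h3])

/-- A nonzero combination of words has a nonzero matrix coefficient at the point of one of its
keys. -/
theorem exists_coeff_ne_zero (hid : S.IdemZero) {p : T → T → Prop} {x : S.FreeAlg}
    (hx : x ∈ S.wordSpan p) (hne : x ≠ 0) :
    ∃ κ : S.WordKey, p κ.s κ.t ∧ (tailAction hid).rep x (delta ⟨(κ.tails, κ.t), κ.t_mem⟩)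
      ⟨(κ.tails, κ.s), κ.s_mem⟩ ≠ 0 := by
  obtain ⟨c, hc, rfl⟩ := (Finsupp.mem_span_image_iff_linearCombination ℂ).1
    (wordSpan_le_span_canon hid p hx)
  rw [Finsupp.mem_supported] at hc
  have hsupp : c.support.Nonempty := by
    rw [Finsupp.support_nonempty_iff]
    rintro rfl
    exact hne (map_zero _)
  -- The coefficient is read at a key that first minimizes d(t) over the support and then, among
  -- keys with that degree, minimizes the tail set.
  obtain ⟨κ₁, hκ₁, hmin₁⟩ := c.support.exists_minimalFor (fun κ => S.d κ.t) hsupp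
  obtain ⟨κ, hκ, hmin⟩ := (c.support.filter fun κ => S.d κ.t = S.d κ₁.t).exists_minimalFor
    (fun κ => κ.tails.carrier) ⟨κ₁, Finset.mem_filter.2 ⟨hκ₁, rfl⟩⟩
  obtain ⟨hκc, hκd⟩ := Finset.mem_filter.1 hκ
  refine ⟨κ, (hc hκc).2, ?_⟩
  rw [Finsupp.linearCombination_apply, Finsupp.sum, map_sum, sum_apply, lp.coeFn_sum,
    Finset.sum_apply, Finset.sum_eq_single_of_mem κ hκc]
  · rw [map_smul, WordKey.word, PartialAction.rep_word]
    change c κ * shiftOp _ (delta _) _ ≠ 0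
    rw [shiftOp_delta_some (κ.wordPEquiv_self hid), delta_apply_self, mul_one]
    exact Finsupp.mem_support_iff.1 hκc
  · intro κ' hκ' hne'
    rw [map_smul, WordKey.word, PartialAction.rep_word]
    change c κ' * shiftOp _ (delta _) _ = 0
    rw [shiftOp_delta]
    rcases h : (tailAction hid).wordPEquiv κ'.s κ'.l κ'.t ⟨(κ.tails, κ.t), κ.t_mem⟩ with _ | q
    · exact mul_zero _
    · by_cases hq : q = ⟨(κ.tails, κ.s), κ.s_mem⟩
      · exfalso
        subst hq
        -- A contributing key κ' has d(t') ≤ d(t), and strict inequality is excluded by minimality.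
        -- Its tail set is contained in that of κ, hence equal to it by the second minimality, so κ'
        -- = κ.
        obtain ⟨h1, h2, h3⟩ := WordKey.of_wordPEquiv hid h fun hlt =>
          (lt_irrefl _ (hlt.trans_le ((hκd.le.trans (hmin₁ hκ' (hlt.le.trans hκd.le))))))
        have h4 : κ'.tails = κ.tails := TailSet.ext_carrier <| h3.antisymm <|
          hmin (Finset.mem_filter.2 ⟨hκ', by rw [h2, hκd]⟩) h3
        have h5 := WordKey.canon_eq h1 h2 h4
        rw [(hc hκ').1, (hc hκc).1] at h5
        exact hne' h5
      · rw [Option.elim_some, delta_apply, if_neg (Ne.symm hq), mul_zero]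

/-- The representation on the points of tail sets is faithful. -/
theorem rep_tailAction_injective (hid : S.IdemZero) (hS : S.FinitelyAligned) :
    Function.Injective (tailAction hid).rep := by
  refine (injective_iff_map_eq_zero _).2 fun x hx => ?_
  by_contra hne
  have hmem : x ∈ S.wordSpan (fun _ _ => True) := by
    rw [wordSpan_eq_top hid hS]
    trivial
  obtain ⟨κ, _, h⟩ := exists_coeff_ne_zero hid hmem hne
  rw [hx] at h
  exact h rfl

end Semigraph

/-! ### Standard projections -/

/-- The factors 1 - P_y live in the unitization. Multiplying by them one after another is the
operation f ↦ f - f P_y, which stays in X. -/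
theorem inr_foldl_sub {X : Type u} [NonUnitalRing X] [StarRing X] [Module ℂ X]
    [IsScalarTower ℂ X X] [SMulCommClass ℂ X X] (a : X) (l : List X) :
    ((l.foldl (fun f y => f - f * rangeProj y) a : X) : Unitization ℂ X) =
      a * (l.map fun y => 1 - ((rangeProj y : X) : Unitization ℂ X)).prod := by
  induction l generalizing a with
  | nil => simp
  | cons y l ih =>
    rw [List.foldl_cons, ih, List.map_cons, List.prod_cons, ← mul_assoc, mul_sub, mul_one,
      Unitization.inr_sub, Unitization.inr_mul]

theorem GeneratingPair.mem_standardProj_iff {k : Type v} {X : Type u} [NonUnitalRing X]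
    [StarRing X] [Module ℂ X] [IsScalarTower ℂ X X] [SMulCommClass ℂ X X]
    (D : GeneratingPair k X) (p : X) : p ∈ D.standardProj ↔
      ∃ x ∈ D.halfStandard, ∃ l : List X, (∀ y ∈ l, y ∈ D.halfStandard) ∧
        p = l.foldl (fun f y => f - f * rangeProj y) (rangeProj x) := by
  simp only [standardProj, Set.mem_ofPred_eq]
  refine exists_congr fun x => and_congr_right fun _ => exists_congr fun l =>
    and_congr_right fun _ => ?_
  rw [← inr_foldl_sub, Unitization.inr_injective.eq_iff]

namespace Semigraph

variable {k : Type v} {T : Type u} {S : Semigraph k T}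

theorem eq_of_rep_eq (hid : S.IdemZero) (hS : S.FinitelyAligned) {x y : S.FreeAlg}
    (h : (tailAction hid).rep x = (tailAction hid).rep y) : x = y :=
  rep_tailAction_injective hid hS h

/-- At the point (R, src x), with R generated by x, the action of x produces (R, x). An element
acting in the same way must equal x. -/
theorem ι_injective (hid : S.IdemZero) : Function.Injective S.ι := by
  intro x y h
  have h1 := congrArg (tailAction hid).rep h
  rw [PartialAction.rep_ι, PartialAction.rep_ι] at h1
  have h2 := shiftOp_injective h1
  let R := TailSet.gen hid (S.src x) [x] (hid.d_src x) (by simp)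
  have hx : x ∈ R.carrier := TailSet.mem_gen hid (by simp)
  have h3 := DFunLike.congr_fun h2 (⟨(R, S.src x), R.root_mem⟩ : S.TailPts)
  have h4 : (tailAction hid).act x ⟨(R, S.src x), R.root_mem⟩ = some ⟨(R, x), hx⟩ :=
    tailAct_eq_some.2 ⟨hid.mul_src x, rfl⟩
  rw [PartialAction.pequiv_apply, PartialAction.pequiv_apply, h4] at h3
  exact (hid.eq_of_mul_zero (tailAct_eq_some.1 h3.symm).1 (hid.d_src x)).1

theorem ι_ne_zero (hid : S.IdemZero) (x : T) : S.ι x ≠ 0 := by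
  intro h
  have h1 := congrArg (tailAction hid).rep h
  rw [PartialAction.rep_ι, map_zero, ← shiftOp_bot] at h1
  have h2 := shiftOp_injective h1
  let R := TailSet.gen hid (S.src x) [x] (hid.d_src x) (by simp)
  have hx : x ∈ R.carrier := TailSet.mem_gen hid (by simp)
  have h3 := DFunLike.congr_fun h2 (⟨(R, S.src x), R.root_mem⟩ : S.TailPts)
  have h4 : (tailAction hid).act x ⟨(R, S.src x), R.root_mem⟩ = some ⟨(R, x), hx⟩ :=
    tailAct_eq_some.2 ⟨hid.mul_src x, rfl⟩
  rw [PartialAction.pequiv_apply, h4] at h3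
  cases h3

variable (S) in
/-- The product `Q_t Q_{s₁} ⋯ Q_{sₙ}`. -/
def prodQ (t : T) (l : List T) : S.FreeAlg :=
  (l.map fun s => sourceProj (S.ι s)).foldl (· * ·) (sourceProj (S.ι t))

theorem prodQ_mem (t : T) (l : List T) : S.prodQ t l ∈ S.freePair.P := .inl ⟨t, l, rfl⟩

theorem zero_mem_P : (0 : S.FreeAlg) ∈ S.freePair.P := .inr rfl

theorem mem_P_iff {p : S.FreeAlg} : p ∈ S.freePair.P ↔ p = 0 ∨ ∃ t l, p = S.prodQ t l :=
  or_comm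

variable (S) in
/-- The half-standard word `s Q_{r₁} ⋯ Q_{rₙ}`. -/
def half (s : T) (l : List T) : S.FreeAlg := S.ι s * S.qm l (S.Q' s)

variable (S) in
/-- The range projection of a half-standard word. -/
def halfProj (s : T) (l : List T) : S.FreeAlg := rangeProj (S.half s l)

variable (S) in
/-- The standard projection `P_x (1 - P_{y₁}) ⋯ (1 - P_{yₙ})`. -/
def stdProj (s : T) (l : List T) (Y : List (T × List T)) : S.FreeAlg :=
  Y.foldl (fun f y => f - f * S.halfProj y.1 y.2) (S.halfProj s l)

namespace PartialAction

variable {Ω : Type u} (α : S.PartialAction Ω)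

theorem dom_append (l l' : List T) : α.dom (l ++ l') = α.dom l ∩ α.dom l' := by
  ext u
  simp only [dom, List.mem_append, Set.mem_inter_iff]
  exact ⟨fun h => ⟨fun r hr => h r (.inl hr), fun r hr => h r (.inr hr)⟩,
    fun h r hr => hr.elim (h.1 r) (h.2 r)⟩

theorem dom_cons (t : T) (l : List T) : α.dom (t :: l) = {u | ∃ v, α.act t u = some v} ∩ α.dom l := by
  ext u
  simp [dom]

theorem dom_singleton (t : T) : α.dom [t] = {u | ∃ v, α.act t u = some v} := by
  ext u
  simp [dom]

theorem rep_prodQ (t : T) (l : List T) : α.rep (S.prodQ t l) = indicatorOp (α.dom (t :: l)) := by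
  have key : ∀ (l : List T) (a : S.FreeAlg), α.rep ((l.map fun s => sourceProj (S.ι s)).foldl
      (· * ·) a) = α.rep a * indicatorOp (α.dom l) := by
    intro l
    induction l with
    | nil =>
      intro a
      have : α.dom [] = Set.univ := by ext; simp [dom]
      rw [this]
      refine ext_delta fun u => ?_
      change _ = α.rep a (indicatorOp _ (delta u))
      rw [indicatorOp_delta, if_pos (Set.mem_univ u)]
      rfl
    | cons r l ih =>
      intro a
      rw [List.map_cons, List.foldl_cons, ih, map_mul, mul_assoc]
      have := α.rep_Q' r
      rw [Q'] at this
      rw [this, indicatorOp_mul, dom_cons]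
  rw [prodQ, key, dom_cons, ← indicatorOp_mul, ← rep_Q']
  rfl

/-- The partial injection of a half-standard word. -/
def halfPEquiv (s : T) (l : List T) : Ω ≃. Ω := (PEquiv.ofSet (α.dom l)).trans (α.pequiv s)

theorem halfPEquiv_eq_some {s : T} {l : List T} {u v : Ω} :
    α.halfPEquiv s l u = some v ↔ u ∈ α.dom l ∧ α.act s u = some v := by
  simp only [halfPEquiv, PEquiv.trans_eq_some, PEquiv.ofSet_eq_some_iff, pequiv_apply]
  constructor
  · rintro ⟨b, ⟨rfl, h⟩, h'⟩
    exact ⟨h, h'⟩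
  · rintro ⟨h, h'⟩
    exact ⟨u, ⟨rfl, h⟩, h'⟩

theorem rep_half (s : T) (l : List T) : α.rep (S.half s l) = shiftOp (α.halfPEquiv s l) := by
  rw [half, map_mul, rep_qm, rep_Q', rep_ι, halfPEquiv, shiftOp_trans, indicatorOp_mul,
    Set.inter_comm]
  refine ext_delta fun u => ?_
  change shiftOp _ (indicatorOp _ (delta u)) = shiftOp _ (indicatorOp _ (delta u))
  rw [indicatorOp_delta, indicatorOp_delta]
  by_cases h : u ∈ α.dom l
  · by_cases h' : ∃ v, α.act s u = some v
    · simp [h, h']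
    · rw [if_pos h, if_neg (fun h'' => h' h''.1), map_zero]
      push Not at h'
      exact (shiftOp_delta_none (Option.eq_none_iff_forall_ne_some.2 h')).symm
  · simp [h]

/-- The support of the range projection of a half-standard word. -/
def ran (s : T) (l : List T) : Set Ω := {v | ∃ u ∈ α.dom l, α.act s u = some v}

theorem rep_halfProj (s : T) (l : List T) : α.rep (S.halfProj s l) = indicatorOp (α.ran s l) := by
  rw [halfProj, rangeProj, map_mul, map_star, rep_half, shiftOp_mul_star]
  congr 1
  ext v
  simp only [halfPEquiv_eq_some, ran, Set.mem_ofPred_eq]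

theorem rep_stdProj (s : T) (l : List T) (Y : List (T × List T)) : α.rep (S.stdProj s l Y) =
    indicatorOp {v | v ∈ α.ran s l ∧ ∀ y ∈ Y, v ∉ α.ran y.1 y.2} := by
  have key : ∀ (Y : List (T × List T)) (f : S.FreeAlg) (U : Set Ω), α.rep f = indicatorOp U →
      α.rep (Y.foldl (fun f y => f - f * S.halfProj y.1 y.2) f) =
        indicatorOp {v | v ∈ U ∧ ∀ y ∈ Y, v ∉ α.ran y.1 y.2} := by
    intro Y
    induction Y with
    | nil =>
      intro f U h
      simp [h]
    | cons y Y ih =>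
      intro f U h
      rw [List.foldl_cons, ih _ (U \ α.ran y.1 y.2)]
      · congr 1
        ext v
        simp [and_assoc]
      · rw [map_sub, map_mul, h, rep_halfProj, indicatorOp_sub_mul]
  exact key Y _ _ (α.rep_halfProj s l)

theorem act_zero_eq_some (hid : S.IdemZero) {t : T} {u v : Ω} (h : α.act t u = some v) :
    α.act (S.src t) u = some u := by
  obtain ⟨w, hw, _⟩ := α.act_of_mul (hid.mul_src t) h
  have := α.one _ _ _ (hid.d_src t) hw
  rwa [this] at hw

end PartialAction

/-! ### Half-standard words, standard projections and their minimal points -/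

section Free

variable (hid : S.IdemZero) (hS : S.FinitelyAligned)

include hid hS

theorem half_zero_eq {e : T} (he : S.d e = 0) (l : List T) : S.half e l = S.prodQ e l := by
  refine eq_of_rep_eq hid hS ?_
  rw [PartialAction.rep_half, PartialAction.rep_prodQ, indicatorOp]
  congr 1
  ext u v
  rw [PEquiv.ofSet_eq_some_iff, PartialAction.dom_cons, PartialAction.halfPEquiv_eq_some]
  constructor
  · rintro ⟨h1, h2⟩
    have := (tailAction hid).one _ _ _ he h2
    subst this
    exact ⟨rfl, ⟨_, h2⟩, h1⟩
  · rintro ⟨rfl, ⟨w, hw⟩, h⟩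
    have := (tailAction hid).one _ _ _ he hw
    exact ⟨h, this ▸ hw⟩

/-- Elements of 𝒫 are written as half-standard words led by a degree-zero letter, so the adjoined
unit 1 needs no separate treatment later. -/
theorem prodQ_eq_half (t : T) (l : List T) : S.prodQ t l = S.half (S.src t) (t :: l) := by
  rw [half_zero_eq hid hS (hid.d_src t)]
  refine eq_of_rep_eq hid hS ?_
  rw [PartialAction.rep_prodQ, PartialAction.rep_prodQ]
  congr 1
  rw [PartialAction.dom_cons _ (S.src t)]
  refine (Set.inter_eq_right.2 fun u hu => ?_).symm
  obtain ⟨v, hv⟩ := hu t List.mem_cons_self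
  exact ⟨u, PartialAction.act_zero_eq_some _ hid hv⟩

theorem qm_Q'_eq (s : T) (l : List T) : S.qm l (S.Q' s) = S.prodQ s l := by
  refine eq_of_rep_eq hid hS ?_
  rw [PartialAction.rep_prodQ, PartialAction.rep_qm, PartialAction.rep_Q', indicatorOp_mul,
    PartialAction.dom_cons, Set.inter_comm]

theorem ι_mul_prodQ (s t : T) (l : List T) : S.ι s * S.prodQ t l = S.half s (t :: l) := by
  refine eq_of_rep_eq hid hS ?_
  rw [PartialAction.rep_half, map_mul, PartialAction.rep_prodQ, PartialAction.rep_ι,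
    PartialAction.halfPEquiv, shiftOp_trans]
  rfl

omit hS in
theorem freePair_d {t : T} (h : S.ι t ∈ S.freePair.T) : S.freePair.d ⟨S.ι t, h⟩ = S.d t :=
  congrArg S.d (ι_injective hid h.choose_spec.2)

theorem half_mem (s : T) (l : List T) : S.half s l ∈ S.freePair.halfStandard := by
  by_cases hs : S.d s = 0
  · rw [half_zero_eq hid hS hs]
    exact ⟨none, _, prodQ_mem s l, (one_mul _).symm⟩
  · refine ⟨some ⟨S.ι s, s, hs, rfl⟩, S.prodQ s l, prodQ_mem s l, ?_⟩
    rw [half, qm_Q'_eq hid hS]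
    exact Unitization.inr_mul ℂ _ _

theorem eq_half_of_mem {a : S.FreeAlg} (ha : a ∈ S.freePair.halfStandard) :
    a = 0 ∨ ∃ s l, a = S.half s l := by
  obtain ⟨s, p, hp, h⟩ := ha
  rcases mem_P_iff.1 hp with rfl | ⟨t, l, rfl⟩
  · left
    refine Unitization.inr_injective (R := ℂ) ?_
    rw [h, Unitization.inr_zero, mul_zero]
  · right
    rcases s with _ | ⟨_, s, hs, rfl⟩
    · refine ⟨S.src t, t :: l, ?_⟩
      rw [← prodQ_eq_half hid hS]
      exact Unitization.inr_injective (h.trans (one_mul _))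
    · refine ⟨s, t :: l, ?_⟩
      rw [← ι_mul_prodQ hid hS]
      exact Unitization.inr_injective (h.trans (Unitization.inr_mul ℂ _ _).symm)

theorem eq_half_of_mem_remove {i : k} {a : S.FreeAlg}
    (ha : a ∈ (S.freePair.remove i).halfStandard) :
    a = 0 ∨ ∃ s l, S.d s i = 0 ∧ a = S.half s l := by
  obtain ⟨s, p, hp, h⟩ := ha
  rcases mem_P_iff.1 hp with rfl | ⟨t, l, rfl⟩
  · left
    refine Unitization.inr_injective (R := ℂ) ?_
    rw [h, Unitization.inr_zero, mul_zero]
  · right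
    rcases s with _ | ⟨_, ⟨s, hs, rfl⟩, hi⟩
    · refine ⟨S.src t, t :: l, by rw [hid.d_src]; rfl, ?_⟩
      rw [← prodQ_eq_half hid hS]
      exact Unitization.inr_injective (h.trans (one_mul _))
    · replace hi := (congrFun (freePair_d hid ⟨s, hs, rfl⟩) i).symm.trans hi
      refine ⟨s, t :: l, hi, ?_⟩
      rw [← ι_mul_prodQ hid hS]
      exact Unitization.inr_injective (h.trans (Unitization.inr_mul ℂ _ _).symm)

theorem stdProj_mem (s : T) (l : List T) (Y : List (T × List T)) :
    S.stdProj s l Y ∈ S.freePair.standardProj := by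
  rw [GeneratingPair.mem_standardProj_iff]
  refine ⟨_, half_mem hid hS s l, Y.map fun y => S.half y.1 y.2, ?_, ?_⟩
  · intro y hy
    obtain ⟨z, _, rfl⟩ := List.mem_map.1 hy
    exact half_mem hid hS _ _
  · rw [List.foldl_map]
    rfl

omit hid hS in
-- Vanishing words among the yᵢ may be dropped, since they contribute the factor 1 - 0.
theorem foldl_eq_stdProj (H : S.FreeAlg → Prop) (hH : ∀ a, H a → a = 0 ∨ ∃ s l, a = S.half s l)
    (l : List S.FreeAlg) (hl : ∀ y ∈ l, H y) :
    ∃ Y : List (T × List T), ∀ f, l.foldl (fun f y => f - f * rangeProj y) f =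
      Y.foldl (fun f y => f - f * S.halfProj y.1 y.2) f := by
  induction l with
  | nil => exact ⟨[], fun f => rfl⟩
  | cons a l ih =>
    obtain ⟨Y, hY⟩ := ih fun y hy => hl y (List.mem_cons_of_mem _ hy)
    rcases hH a (hl a List.mem_cons_self) with rfl | ⟨s, l', rfl⟩
    · refine ⟨Y, fun f => ?_⟩
      rw [List.foldl_cons, rangeProj, zero_mul, mul_zero, sub_zero, hY]
    · refine ⟨(s, l') :: Y, fun f => ?_⟩
      rw [List.foldl_cons, hY]
      rfl

theorem eq_stdProj_of_mem {p : S.FreeAlg} (hp : p ∈ S.freePair.standardProj) (hne : p ≠ 0) :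
    ∃ s l Y, p = S.stdProj s l Y := by
  obtain ⟨x, hx, l, hl, rfl⟩ := (S.freePair.mem_standardProj_iff p).1 hp
  obtain ⟨Y, hY⟩ := foldl_eq_stdProj _ (fun a => eq_half_of_mem hid hS) l hl
  rw [hY] at hne ⊢
  rcases eq_half_of_mem hid hS hx with rfl | ⟨s, l, rfl⟩
  · refine absurd ?_ hne
    rw [rangeProj, zero_mul]
    clear hY hne
    induction Y with
    | nil => rfl
    | cons y Y ih => rw [List.foldl_cons, zero_mul, sub_zero, ih]
  · exact ⟨s, l, Y, rfl⟩

theorem eq_stdProj_of_mem_remove {i : k} {p : S.FreeAlg}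
    (hp : p ∈ (S.freePair.remove i).standardProj) (hne : p ≠ 0) :
    ∃ s l Y, S.d s i = 0 ∧ p = S.stdProj s l Y := by
  obtain ⟨x, hx, l, hl, rfl⟩ := ((S.freePair.remove i).mem_standardProj_iff p).1 hp
  obtain ⟨Y, hY⟩ := foldl_eq_stdProj _ (fun a ha => (eq_half_of_mem_remove hid hS ha).imp_right
    fun ⟨s, l, _, h⟩ => ⟨s, l, h⟩) l hl
  rw [hY] at hne ⊢
  rcases eq_half_of_mem_remove hid hS hx with rfl | ⟨s, l, hs, rfl⟩
  · refine absurd ?_ hne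
    rw [rangeProj, zero_mul]
    clear hY hne
    induction Y with
    | nil => rfl
    | cons y Y ih => rw [List.foldl_cons, zero_mul, sub_zero, ih]
  · exact ⟨s, l, Y, hs, rfl⟩

omit hS

theorem mem_dom_tail {R : S.TailSet} {y : T} {hy : y ∈ R.carrier} {l : List T} :
    (⟨(R, y), hy⟩ : S.TailPts) ∈ (tailAction hid).dom l ↔
      ∀ r ∈ l, ∃ z ∈ R.carrier, S.mul r y = some z := by
  refine forall₂_congr fun r _ => ?_
  constructor
  · rintro ⟨v, hv⟩
    have h := tailAct_eq_some.1 hv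
    simp only at h
    exact ⟨v.1.2, h.2 ▸ v.2, h.1⟩
  · rintro ⟨z, hz, h⟩
    exact ⟨⟨(R, z), hz⟩, tailAct_eq_some.2 ⟨h, rfl⟩⟩

theorem mem_ran_tail {R : S.TailSet} {y : T} {hy : y ∈ R.carrier} {s : T} {l : List T} :
    (⟨(R, y), hy⟩ : S.TailPts) ∈ (tailAction hid).ran s l ↔
      ∃ c, S.mul s c = some y ∧ ∀ r ∈ l, ∃ z ∈ R.carrier, S.mul r c = some z := by
  constructor
  · rintro ⟨⟨⟨R', c⟩, hc⟩, h1, h2⟩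
    obtain ⟨h3, h4⟩ := tailAct_eq_some.1 h2
    clear h2
    simp only at h3 h4
    subst h4
    exact ⟨c, h3, (mem_dom_tail hid).1 h1⟩
  · rintro ⟨c, h1, h2⟩
    have hc := R.tail _ _ _ h1 hy
    exact ⟨⟨(R, c), hc⟩, (mem_dom_tail hid).2 h2, tailAct_eq_some.2 ⟨h1, rfl⟩⟩

include hS

/-- A nonzero standard projection contains the minimal point of its defining half-standard word. -/
theorem exists_point_of_ne_zero {s : T} {l : List T} {Y : List (T × List T)}
    (h : S.stdProj s l Y ≠ 0) :
    ∃ hl : ∀ r ∈ s :: l, S.src r = S.src s,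
      (⟨(TailSet.gen hid (S.src s) (s :: l) (hid.d_src s) hl, s),
        TailSet.mem_gen hid (hl := hl) List.mem_cons_self⟩ : S.TailPts) ∈
        {v | v ∈ (tailAction hid).ran s l ∧ ∀ y ∈ Y, v ∉ (tailAction hid).ran y.1 y.2} := by
  have hne : {v | v ∈ (tailAction hid).ran s l ∧
      ∀ y ∈ Y, v ∉ (tailAction hid).ran y.1 y.2}.Nonempty := by
    rw [Set.nonempty_iff_ne_empty]
    intro hempty
    refine h (eq_of_rep_eq hid hS ?_)
    rw [PartialAction.rep_stdProj, hempty, indicatorOp_empty, map_zero]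
  obtain ⟨⟨⟨R, u⟩, hu⟩, h1, h2⟩ := hne
  obtain ⟨c, hc, hl⟩ := (mem_ran_tail hid).1 h1
  have hcR := R.tail _ _ _ hc hu
  have hsrc : ∀ r ∈ s :: l, S.src r = S.src s := by
    intro r hr
    rcases List.mem_cons.1 hr with rfl | hr
    · rfl
    · obtain ⟨z, _, hz⟩ := hl r hr
      rw [hid.src_eq_rng hz, hid.src_eq_rng hc]
  refine ⟨hsrc, ?_, ?_⟩
  · refine (mem_ran_tail hid).2 ⟨S.src s, hid.mul_src s, fun r hr => ?_⟩
    exact ⟨r, TailSet.mem_gen hid (List.mem_cons_of_mem _ hr),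
      hsrc r (List.mem_cons_of_mem _ hr) ▸ hid.mul_src r⟩
  · intro y hy hmem
    obtain ⟨b, hb, hb'⟩ := (mem_ran_tail hid).1 hmem
    refine h2 y hy ((mem_ran_tail hid).2 ?_)
    -- Right multiplication by c sends the tail set generated by s and l into R, and s to u. If
    -- (gen, s) lay in the range of some excluded word, multiplying by c would put (R, u) into that
    -- range too, contrary to its choice.
    have hsub := TailSet.gen_subset hid (he := hid.d_src s) (hl := hsrc)
      (R := R.comap hid hcR) ⟨c, hcR, by
        rw [hid.src_eq_rng hc]; exact hid.rng_mul c⟩ (by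
          intro r hr
          rcases List.mem_cons.1 hr with rfl | hr
          · exact ⟨u, hu, hc⟩
          · exact hl r hr)
    obtain ⟨c', hc', hc''⟩ := S.assoc_left hb hc
    refine ⟨c', hc'', fun r hr => ?_⟩
    obtain ⟨z, hz, hz'⟩ := hb' r hr
    obtain ⟨w, hw, hw'⟩ := hsub hz
    obtain ⟨c'', h5, h6⟩ := S.assoc_left hz' hw'
    rw [hc'] at h5
    cases h5
    exact ⟨w, hw, h6⟩

end Free

end Semigraph

namespace Semigraph

variable {k : Type v} {T : Type u} {S : Semigraph k T}

/-! ### Projections and their supports -/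

section Order

variable (hid : S.IdemZero) (hS : S.FinitelyAligned)

include hid hS

theorem comm_of_rep {p q : S.FreeAlg} {U W : Set S.TailPts}
    (hp : (tailAction hid).rep p = indicatorOp U) (hq : (tailAction hid).rep q = indicatorOp W) :
    p * q = q * p := by
  refine eq_of_rep_eq hid hS ?_
  rw [map_mul, map_mul, hp, hq, indicatorOp_mul, indicatorOp_mul, Set.inter_comm]

theorem projLE_iff {p q : S.FreeAlg} {U W : Set S.TailPts}
    (hp : (tailAction hid).rep p = indicatorOp U) (hq : (tailAction hid).rep q = indicatorOp W) :
    ProjLE p q ↔ U ⊆ W := by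
  rw [ProjLE, ← (rep_tailAction_injective hid hS).eq_iff, map_mul, hp, hq, indicatorOp_mul,
    indicatorOp_injective.eq_iff, Set.inter_eq_left]

theorem isStarProjection_of_rep {p : S.FreeAlg} {U : Set S.TailPts}
    (hp : (tailAction hid).rep p = indicatorOp U) : IsStarProjection p where
  isIdempotentElem := by
    refine eq_of_rep_eq hid hS ?_
    rw [map_mul, hp, indicatorOp_mul, Set.inter_self]
  isSelfAdjoint := by
    refine eq_of_rep_eq hid hS ?_
    rw [map_star, hp, star_indicatorOp]

omit hS in
theorem exists_support_of_mem_P {p : S.FreeAlg} (hp : p ∈ S.freePair.P) :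
    ∃ U, (tailAction hid).rep p = indicatorOp U := by
  rcases mem_P_iff.1 hp with rfl | ⟨t, l, rfl⟩
  · exact ⟨∅, by rw [indicatorOp_empty, map_zero]⟩
  · exact ⟨_, PartialAction.rep_prodQ _ t l⟩

omit hS in
/-- Points can be moved to the root without leaving the support of a source projection. -/
theorem root_mem_dom {R : S.TailSet} {y : T} {hy : y ∈ R.carrier} {l : List T}
    (h : (⟨(R, y), hy⟩ : S.TailPts) ∈ (tailAction hid).dom l) :
    (⟨(R.comap hid hy, (R.comap hid hy).root), (R.comap hid hy).root_mem⟩ : S.TailPts) ∈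
      (tailAction hid).dom l := by
  rw [mem_dom_tail] at h ⊢
  intro r hr
  obtain ⟨z, hz, hz'⟩ := h r hr
  have hmem : r ∈ (R.comap hid hy).carrier := ⟨z, hz, hz'⟩
  exact ⟨r, hmem, (R.comap hid hy).mul_root r hmem⟩

omit hS in
theorem d_le_of_mem_ran {R : S.TailSet} {y : T} {hy : y ∈ R.carrier} {s : T} {l : List T}
    (h : (⟨(R, y), hy⟩ : S.TailPts) ∈ (tailAction hid).ran s l) : S.d s ≤ S.d y := by
  obtain ⟨c, hc, _⟩ := (mem_ran_tail hid).1 h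
  rw [S.d_mul _ _ _ hc]
  exact le_self_add

/-! ### Freeness -/

/-- Points in the support of P_a have degree at least d(s) ≠ 0, while the support of a nonzero
element of 𝒫 contains a point of degree zero, obtained by moving any of its points to the root. -/
theorem halfProj_not_mem_P {s : T} {l : List T} (h : S.half s l ∉ S.freePair.P) :
    S.halfProj s l ∉ S.freePair.P := by
  have hne : S.half s l ≠ 0 := fun h0 => h (h0 ▸ zero_mem_P)
  have hs : S.d s ≠ 0 := fun hs => h (half_zero_eq hid hS hs l ▸ prodQ_mem s l)
  have hran : (tailAction hid).ran s l ≠ ∅ := by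
    intro hempty
    refine hne (eq_of_rep_eq hid hS ?_)
    rw [PartialAction.rep_half, map_zero, ← shiftOp_bot]
    congr 1
    ext u v
    constructor
    · intro h'
      obtain ⟨h1, h2⟩ := (tailAction hid).halfPEquiv_eq_some.1 h'
      exact (Set.eq_empty_iff_forall_notMem.1 hempty v ⟨u, h1, h2⟩).elim
    · intro h'
      cases h'
  intro hmem
  rcases mem_P_iff.1 hmem with h0 | ⟨t, l', h0⟩
  · have := congrArg (tailAction hid).rep h0
    rw [PartialAction.rep_halfProj, map_zero, ← indicatorOp_empty] at this
    exact hran (indicatorOp_injective this)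
  · have := congrArg (tailAction hid).rep h0
    rw [PartialAction.rep_halfProj, PartialAction.rep_prodQ] at this
    have heq := indicatorOp_injective this
    obtain ⟨⟨⟨R, y⟩, hy⟩, hmem⟩ := Set.nonempty_iff_ne_empty.2 hran
    rw [heq] at hmem
    have h1 := root_mem_dom hid hmem
    rw [← heq] at h1
    have h2 := d_le_of_mem_ran hid h1
    rw [(R.comap hid hy).d_root] at h2
    exact hs (le_antisymm h2 (fun _ => Nat.zero_le _))

omit hid hS in
theorem projSup_mul {p : S.FreeAlg} (l : List S.FreeAlg) (h : ∀ a ∈ l, ProjLE a p) :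
    projSup l * p = projSup l := by
  induction l with
  | nil => rw [projSup, zero_mul]
  | cons a l ih =>
    rw [projSup, sub_mul, add_mul, mul_assoc, ih fun b hb => h b (List.mem_cons_of_mem _ hb),
      h a List.mem_cons_self]

/-- For the second condition, consider the minimal point of p, which has degree zero. A range
projection P_a ≤ p containing it must be all of p, so strictly smaller ones miss this point, and so
does their supremum. -/
theorem isFree : S.freePair.IsFree := by
  constructor
  · intro a ha haP
    rcases eq_half_of_mem hid hS ha with rfl | ⟨s, l, rfl⟩
    · exact absurd zero_mem_P haP
    · exact halfProj_not_mem_P hid hS haP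
  · intro p hp l hl h
    refine ⟨projSup_mul _ ?_, ?_⟩
    · intro a ha
      obtain ⟨b, hb, rfl⟩ := List.mem_map.1 ha
      exact (h b hb).2.1
    rcases mem_P_iff.1 hp with rfl | ⟨t, l', rfl⟩
    · obtain ⟨a, ha⟩ := List.exists_mem_of_ne_nil l hl
      have := (h a ha).2
      exact absurd (this.1.symm.trans (mul_zero _)) this.2
    intro heq
    by_cases hzero : S.prodQ t l' = 0
    · obtain ⟨a, ha⟩ := List.exists_mem_of_ne_nil l hl
      have := (h a ha).2
      rw [hzero] at this
      exact absurd (this.1.symm.trans (mul_zero _)) this.2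
    have hstd : S.prodQ t l' = S.stdProj (S.src t) (t :: l') [] := by
      refine eq_of_rep_eq hid hS ?_
      rw [stdProj, List.foldl_nil, halfProj, rangeProj, ← prodQ_eq_half hid hS, map_mul, map_star,
        PartialAction.rep_prodQ, star_indicatorOp, indicatorOp_mul, Set.inter_self]
    rw [hstd] at hzero
    obtain ⟨hsrc, hpt, -⟩ := exists_point_of_ne_zero hid hS hzero
    set R := TailSet.gen hid (S.src (S.src t)) (S.src t :: t :: l') (hid.d_src _) hsrc with hR
    set P : S.TailPts := ⟨(R, S.src t), TailSet.mem_gen hid (hl := hsrc) List.mem_cons_self⟩ with hP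
    have hPd : (tailAction hid).rep (S.prodQ t l') (delta P) = delta P := by
      rw [hstd, stdProj, List.foldl_nil, PartialAction.rep_halfProj, indicatorOp_delta, if_pos hpt]
    have hall : ∀ a ∈ l, (tailAction hid).rep (rangeProj a) (delta P) = 0 := by
      intro a ha
      obtain ⟨ha1, ha2, ha3⟩ := h a ha
      rcases eq_half_of_mem hid hS ha1 with rfl | ⟨s, m, rfl⟩
      · rw [rangeProj, zero_mul, map_zero]
        rfl
      · change (tailAction hid).rep (S.halfProj s m) _ = 0
        rw [PartialAction.rep_halfProj, indicatorOp_delta, if_neg]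
        intro hmem
        refine ha3 ?_
        -- The range of s contains a point of degree zero.
        have hs : S.d s = 0 := by
          have := d_le_of_mem_ran hid hmem
          rw [hid.d_src] at this
          exact le_antisymm this (fun _ => Nat.zero_le _)
        -- With d(s) = 0, membership of the minimal point says that all letters of m lie in the tail
        -- set R generated by p. At any point (R', y) below p, right multiplication by y carries R
        -- into R', so the letters of m can be applied there as well.
        have hle : ProjLE (S.prodQ t l') (S.halfProj s m) := by
          rw [projLE_iff hid hS (PartialAction.rep_prodQ _ t l') (PartialAction.rep_halfProj _ s m)]
          rintro ⟨⟨R', y⟩, hy⟩ hdom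
          rw [mem_dom_tail] at hdom
          obtain ⟨c, hc, hm⟩ := (mem_ran_tail hid).1 hmem
          have hsc := (hid.eq_of_zero_mul hc hs).1
          obtain ⟨z, hz, htz⟩ := hdom t List.mem_cons_self
          have hsrcty := hid.src_eq_rng htz
          refine (mem_ran_tail hid).2 ⟨y, ?_, fun r hr => ?_⟩
          · have h1 := (hid.eq_of_mul_zero hc (by rw [← hsc, hid.d_src])).1
            rw [← h1, hsrcty]
            exact hid.rng_mul y
          · obtain ⟨w, hw, hrw⟩ := hm r hr
            have h2 := (hid.eq_of_mul_zero hrw (by rw [← hsc, hid.d_src])).1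
            subst h2
            have hsub : R.carrier ⊆ (R'.comap hid hy).carrier := by
              refine TailSet.gen_subset hid ?_ ?_
              · rw [hid.src_of_zero (hid.d_src t), hsrcty]
                exact (R'.comap hid hy).root_mem
              · intro b hb
                rcases List.mem_cons.1 hb with rfl | hb
                · rw [hsrcty]
                  exact (R'.comap hid hy).root_mem
                · exact hdom b hb
            exact hsub hw
        have hcomm := comm_of_rep hid hS (PartialAction.rep_prodQ _ t l')
          (PartialAction.rep_halfProj _ s m)
        have ha2' : S.halfProj s m * S.prodQ t l' = S.halfProj s m := ha2
        rw [ProjLE, hcomm, ha2'] at hle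
        exact hle
    have hsup : ∀ l : List S.FreeAlg, (∀ a ∈ l, (tailAction hid).rep (rangeProj a) (delta P) = 0) →
        (tailAction hid).rep (projSup (l.map rangeProj)) (delta P) = 0 := by
      intro l
      induction l with
      | nil => intro _; rw [List.map_nil, projSup, map_zero]; rfl
      | cons a l ih =>
        intro hl
        have h1 := ih fun b hb => hl b (List.mem_cons_of_mem _ hb)
        rw [List.map_cons, projSup, map_sub, map_add, map_mul]
        change (tailAction hid).rep (rangeProj a) (delta P) +
          (tailAction hid).rep (projSup (l.map rangeProj)) (delta P) -
          (tailAction hid).rep (rangeProj a)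
            ((tailAction hid).rep (projSup (l.map rangeProj)) (delta P)) = 0
        rw [h1, hl a List.mem_cons_self, map_zero, add_zero, sub_zero]
    rw [← heq, hsup l hall] at hPd
    exact delta_ne_zero _ hPd.symm

/-! ### Weak freeness -/

/-- The minimal point of p has degree d(s) with vanishing i-th coordinate, whereas the range of an
element of degree eᵢ consists of points whose i-th coordinate is at least one. -/
theorem isWeaklyFree : S.freePair.IsWeaklyFree := by
  intro i p hp hne B hB hle
  obtain ⟨s, l, Y, hs, rfl⟩ := eq_stdProj_of_mem_remove hid hS hp hne
  obtain ⟨hsrc, hpt⟩ := exists_point_of_ne_zero hid hS hne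
  set R := TailSet.gen hid (S.src s) (s :: l) (hid.d_src _) hsrc
  set P : S.TailPts := ⟨(R, s), TailSet.mem_gen hid (hl := hsrc) List.mem_cons_self⟩
  have h1 : (tailAction hid).rep (S.stdProj s l Y) (delta P) = delta P := by
    rw [PartialAction.rep_stdProj, indicatorOp_delta, if_pos hpt]
  have h2 : (tailAction hid).rep (∑ b ∈ B, rangeProj b) (delta P) = 0 := by
    rw [map_sum, sum_apply]
    refine Finset.sum_eq_zero fun b hb => ?_
    obtain ⟨⟨t, ht, rfl⟩, hd⟩ := hB b hb
    have hd' : S.d t = Pi.single i 1 := (freePair_d hid ⟨t, ht, rfl⟩).symm.trans hd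
    rw [rangeProj, map_mul, map_star, PartialAction.rep_ι, shiftOp_mul_star, indicatorOp_delta,
      if_neg]
    rintro ⟨u, hu⟩
    have h3 := S.d_mul _ _ _ (tailAct_eq_some.1 hu).1
    have h4 := congrFun h3 i
    rw [Pi.add_apply, hd', Pi.single_eq_same] at h4
    change S.d s i = _ at h4
    omega
  rw [ProjLE] at hle
  rw [← hle, map_mul] at h1
  change (tailAction hid).rep (S.stdProj s l Y) ((tailAction hid).rep _ (delta P)) = _ at h1
  rw [h2, map_zero] at h1
  exact delta_ne_zero _ h1.symm

end Order

end Semigraph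

/-! ### Graded operators -/

section Graded

variable {Ω : Type u}

/-- The operators all of whose nonzero matrix coefficients are at related points. -/
def coeffIn (r : Ω → Ω → Prop) : Submodule ℂ (Ell2 Ω →L[ℂ] Ell2 Ω) where
  carrier := {A | ∀ u v, A (delta v) u ≠ 0 → r v u}
  add_mem' := by
    intro A B hA hB u v h
    by_contra hne
    refine h ?_
    change A (delta v) u + B (delta v) u = 0
    rw [not_not.1 (mt (hA u v) hne), not_not.1 (mt (hB u v) hne), add_zero]
  zero_mem' := fun _ _ h => absurd rfl h
  smul_mem' := by
    intro c A hA u v h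
    refine hA u v fun h0 => h ?_
    change c * A (delta v) u = 0
    rw [h0, mul_zero]

theorem shiftOp_mem_coeffIn {g : Ω ≃. Ω} {r : Ω → Ω → Prop} (h : ∀ u v, g u = some v → r u v) :
    shiftOp g ∈ coeffIn r := by
  intro u v hne
  rw [shiftOp_delta] at hne
  rcases hg : g v with _ | w
  · rw [hg] at hne
    exact absurd rfl hne
  · rw [hg, Option.elim_some, delta_apply] at hne
    by_cases huw : u = w
    · rw [huw]
      exact h v w hg
    · rw [if_neg huw] at hne
      exact absurd rfl hne

variable {G : Type*} [AddCommGroup G] (deg : Ω → G)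

/-- The operators which raise degrees by `n`. -/
def shiftBy (n : G) : Submodule ℂ (Ell2 Ω →L[ℂ] Ell2 Ω) := coeffIn fun v u => deg u = deg v + n

variable {deg}

/-- The coefficients of a sum of operators of different degrees. -/
theorem sum_shiftBy_apply {F : Finset G} {A : G → Ell2 Ω →L[ℂ] Ell2 Ω}
    (hA : ∀ n ∈ F, A n ∈ shiftBy deg n) {n : G} (hn : n ∈ F) {u v : Ω} (h : deg u = deg v + n) :
    (∑ m ∈ F, A m) (delta v) u = A n (delta v) u := by
  rw [sum_apply, lp.coeFn_sum, Finset.sum_apply]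
  refine Finset.sum_eq_single_of_mem n hn fun m hm hne => ?_
  by_contra h0
  exact hne (add_left_cancel ((hA m hm u v h0).symm.trans h))

/-- Operators of different degree occupy disjoint matrix positions, so nothing cancels between them.
-/
theorem eq_zero_of_sum_shiftBy {F : Finset G} {A : G → Ell2 Ω →L[ℂ] Ell2 Ω}
    (hA : ∀ n ∈ F, A n ∈ shiftBy deg n) (h0 : ∑ m ∈ F, A m = 0) {n : G} (hn : n ∈ F) : A n = 0 := by
  refine ext_delta fun v => ?_
  ext u
  by_contra hne
  have h := hA n hn u v hne
  have := sum_shiftBy_apply hA hn h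
  rw [h0] at this
  exact hne this.symm

end Graded

/-! ### Words in generators -/

section Words

variable {k : Type v} {I : Type w} {X : Type u} [NonUnitalRing X] [StarRing X]

theorem IsWord.star {g : I → X} {δ : I → k → ℤ} {n : k → ℤ} {a : X} (h : IsWord g δ n a) :
    IsWord g δ (-n) (star a) := by
  induction h with
  | letter i => exact .letter_star i
  | letter_star i =>
    rw [neg_neg, star_star]
    exact .letter i
  | mul _ _ iha ihb =>
    rw [neg_add_rev, star_mul]
    exact .mul ihb iha

theorem FreeStarAlgebra.iSup_words {k : Type v} {I : Type u} (δ : I → k → ℤ) :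
    ⨆ n : k → ℤ, Submodule.span ℂ {w | IsWord (PresentedStarAlgebra.of
      (fun _ _ : StarTerm I => False)) δ n w} = ⊤ := by
  set g := PresentedStarAlgebra.of (fun _ _ : StarTerm I => False)
  set M := Submodule.span ℂ {w | ∃ n, IsWord g δ n w}
  have hM : M ≤ ⨆ n : k → ℤ, Submodule.span ℂ {w | IsWord g δ n w} := by
    refine Submodule.span_le.2 ?_
    rintro w ⟨n, hw⟩
    exact le_iSup (fun n : k → ℤ => Submodule.span ℂ {w | IsWord g δ n w}) n
      (Submodule.subset_span hw)
  have hmul : ∀ a ∈ M, ∀ b ∈ M, a * b ∈ M := by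
    intro a ha b hb
    induction ha using Submodule.span_induction with
    | mem a ha =>
      obtain ⟨m, ha⟩ := ha
      induction hb using Submodule.span_induction with
      | mem b hb =>
        obtain ⟨n, hb⟩ := hb
        exact Submodule.subset_span ⟨m + n, .mul ha hb⟩
      | zero => rw [mul_zero]; exact M.zero_mem
      | add b c _ _ hb hc => rw [mul_add]; exact M.add_mem hb hc
      | smul z b _ hb => rw [mul_smul_comm]; exact M.smul_mem z hb
    | zero => rw [zero_mul]; exact M.zero_mem
    | add a c _ _ ha hc => rw [add_mul]; exact M.add_mem ha hc
    | smul z a _ ha => rw [smul_mul_assoc]; exact M.smul_mem z ha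
  have hstar : ∀ a ∈ M, star a ∈ M := by
    intro a ha
    induction ha using Submodule.span_induction with
    | mem a ha =>
      obtain ⟨m, ha⟩ := ha
      exact Submodule.subset_span ⟨-m, ha.star⟩
    | zero => rw [star_zero]; exact M.zero_mem
    | add a c _ _ ha hc => rw [star_add]; exact M.add_mem ha hc
    | smul z a _ ha => rw [star_smul]; exact M.smul_mem _ ha
  refine eq_top_iff.2 fun a _ => hM ?_
  induction a using PresentedStarAlgebra.ind with | _ a
  induction a with
  | gen i => exact Submodule.subset_span ⟨δ i, .letter i⟩
  | zero => exact M.zero_mem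
  | add a b ha hb => exact M.add_mem (ha trivial) (hb trivial)
  | neg a ha => exact M.neg_mem (ha trivial)
  | smul z a ha => exact M.smul_mem z (ha trivial)
  | mul a b ha hb => exact hmul _ (ha trivial) _ (hb trivial)
  | adj a ha => exact hstar _ (ha trivial)

end Words

namespace Semigraph

variable {k : Type v} {T : Type u} {S : Semigraph k T}

/-! ### The semigraph algebra structure -/

variable (S) in
/-- The degree of a point of a tail set. -/
def tailDeg (p : S.TailPts) : k → ℤ := fun i => (S.d p.1.2 i : ℤ)

theorem tailDeg_act (hid : S.IdemZero) {x : T} {p q : S.TailPts}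
    (h : (tailAction hid).act x p = some q) : S.tailDeg q = S.tailDeg p + fun i => (S.d x i : ℤ) := by
  have := S.d_mul _ _ _ (tailAct_eq_some.1 h).1
  ext i
  have h2 := congrFun this i
  simp only [tailDeg, Pi.add_apply] at h2 ⊢
  rw [h2]
  push_cast
  ring

/-- The element of the semigraph with a given class. -/
def elt (x : S.freePair.T) : T := x.2.choose

theorem elt_ne (x : S.freePair.T) : S.d (elt x) ≠ 0 := x.2.choose_spec.1

theorem ι_elt (x : S.freePair.T) : S.ι (elt x) = x := x.2.choose_spec.2

/-- The element of `T` with a given class and nonzero degree, as an element of the semigraph algebra. -/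
def toElt (t : T) (ht : S.d t ≠ 0) : S.freePair.T := ⟨S.ι t, t, ht, rfl⟩

theorem elt_toElt (hid : S.IdemZero) {t : T} (ht : S.d t ≠ 0) : elt (toElt t ht) = t :=
  ι_injective hid (ι_elt _)

theorem elt_injective {x y : S.freePair.T} (h : elt x = elt y) : x = y :=
  Subtype.ext (by rw [← ι_elt, ← ι_elt, h])

/-- Right factors of `x` in `T ⊔ {1}` as elements of the semigraph. -/
def elt₁ (x : S.freePair.T) : Option S.freePair.T → T
  | none => S.src (elt x)
  | some y => elt y

theorem elt₁_injective (hid : S.IdemZero) (x : S.freePair.T) : Function.Injective (elt₁ x) := by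
  rintro (_ | y) (_ | z) h
  · rfl
  · exact absurd ((congrArg S.d (show S.src (elt x) = elt z from h)).symm.trans (hid.d_src _)) (elt_ne z)
  · exact absurd ((congrArg S.d (show elt y = S.src (elt x) from h)).trans (hid.d_src _)) (elt_ne y)
  · rw [elt_injective h]

theorem mul_mem_T_iff (hid : S.IdemZero) (x y z : S.freePair.T) :
    (x : S.FreeAlg) * y = z ↔ S.mul (elt x) (elt y) = some (elt z) := by
  constructor
  · intro h
    rw [← ι_elt x, ← ι_elt y, ← ι_elt z] at h
    rcases h1 : S.mul (elt x) (elt y) with _ | w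
    · rw [S.ι_mul_none h1] at h
      exact absurd h.symm (ι_ne_zero hid _)
    · rw [S.ι_mul h1] at h
      rw [ι_injective hid h]
  · intro h
    rw [← ι_elt x, ← ι_elt y, ← ι_elt z, S.ι_mul h]

theorem d_ne_of_mul {x y z : T} (hx : S.d x ≠ 0) (h : S.mul x y = some z) : S.d z ≠ 0 := by
  intro h0
  rw [S.d_mul _ _ _ h] at h0
  refine hx (le_antisymm ?_ (fun _ => Nat.zero_le _))
  rw [← h0]
  exact le_self_add

/-- The adjoined unit replaces all degree-zero elements at once: as a right factor of x it stands
for the source of x. Under this translation `elt₁`, products in T ⊔ {1} with left factor x are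
products in the original semigraph. -/
theorem mul₁_some_eq (hid : S.IdemZero) {x : S.freePair.T} {y w : Option S.freePair.T} :
    S.freePair.mul₁ (some x) y = some w ↔
      ∃ z, w = some z ∧ S.mul (elt x) (elt₁ x y) = some (elt z) := by
  rcases y with _ | y
  · simp only [GeneratingPair.mul₁, elt₁, hid.mul_src, Option.some.injEq]
    constructor
    · rintro rfl
      exact ⟨x, rfl, rfl⟩
    · rintro ⟨z, rfl, h⟩
      rw [elt_injective h]
  · simp only [GeneratingPair.mul₁, elt₁]
    constructor
    · intro h
      split_ifs at h with h'
      cases h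
      exact ⟨⟨_, h'⟩, rfl, (mul_mem_T_iff hid x y ⟨_, h'⟩).1 rfl⟩
    · rintro ⟨z, rfl, h⟩
      have h1 := (mul_mem_T_iff hid x y z).2 h
      have h2 : (x : S.FreeAlg) * y ∈ S.freePair.T := h1 ▸ z.2
      rw [dif_pos h2]
      exact congrArg (some ∘ some) (Subtype.ext h1)

theorem mul₁_none_eq {y w : Option S.freePair.T} :
    S.freePair.mul₁ none y = some w ↔ w = y := by
  rw [GeneratingPair.mul₁, Option.some.injEq, eq_comm]

theorem mul₁_assoc (hid : S.IdemZero) (x y z : Option S.freePair.T) :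
    (S.freePair.mul₁ x y).bind (fun a => S.freePair.mul₁ a z) =
      (S.freePair.mul₁ y z).bind (fun b => S.freePair.mul₁ x b) := by
  rcases x with _ | x
  · rw [GeneratingPair.mul₁, Option.bind_some]
    rcases h : S.freePair.mul₁ y z with _ | w <;> rfl
  rcases y with _ | y
  · rw [GeneratingPair.mul₁, GeneratingPair.mul₁, Option.bind_some, Option.bind_some]
  rcases z with _ | z
  · rw [show S.freePair.mul₁ (some y) none = some (some y) from rfl, Option.bind_some]
    rcases h : S.freePair.mul₁ (some x) (some y) with _ | w
    · rfl
    · obtain ⟨v, rfl, _⟩ := (mul₁_some_eq hid).1 h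
      rfl
  ext w
  simp only [Option.bind_eq_some_iff]
  constructor
  · rintro ⟨a', ha', hw'⟩
    obtain ⟨a, rfl, ha⟩ := (mul₁_some_eq hid).1 ha'
    obtain ⟨w, rfl, hw⟩ := (mul₁_some_eq hid).1 hw'
    obtain ⟨b, hb, hb'⟩ := S.assoc_left ha hw
    have hbd := d_ne_of_mul (elt_ne y) hb
    refine ⟨some (toElt b hbd), (mul₁_some_eq hid).2 ⟨_, rfl, ?_⟩,
      (mul₁_some_eq hid).2 ⟨_, rfl, ?_⟩⟩
    · rw [elt_toElt hid]; exact hb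
    · rw [elt₁, elt_toElt hid]; exact hb'
  · rintro ⟨b', hb', hw'⟩
    obtain ⟨b, rfl, hb⟩ := (mul₁_some_eq hid).1 hb'
    obtain ⟨w, rfl, hw⟩ := (mul₁_some_eq hid).1 hw'
    obtain ⟨a, ha, ha'⟩ := S.assoc_right hb hw
    have had := d_ne_of_mul (elt_ne x) ha
    refine ⟨some (toElt a had), (mul₁_some_eq hid).2 ⟨_, rfl, ?_⟩,
      (mul₁_some_eq hid).2 ⟨_, rfl, ?_⟩⟩
    · rw [elt_toElt hid]; exact ha
    · rw [elt_toElt hid]; exact ha'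

theorem d₁_eq_zero {x : Option S.freePair.T} (h : S.freePair.d₁ x = 0) : x = none := by
  rcases x with _ | x
  · rfl
  · exact absurd h (elt_ne x)

theorem d₁_eq (hid : S.IdemZero) (x : S.freePair.T) (y : Option S.freePair.T) :
    S.freePair.d₁ y = S.d (elt₁ x y) := by
  rcases y with _ | y
  · exact (hid.d_src _).symm
  · rfl

theorem mul₁_none_right (x : Option S.freePair.T) : S.freePair.mul₁ x none = some x := by
  rcases x with _ | x <;> rfl

/-- The semigraph `T ⊔ {1}`. -/
def semigraph₁ (hid : S.IdemZero) : Semigraph k (Option S.freePair.T) where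
  mul := S.freePair.mul₁
  assoc := mul₁_assoc hid
  d := S.freePair.d₁
  d_mul x y z h := by
    rcases x with _ | x
    · rw [mul₁_none_eq] at h
      rw [h]
      exact (zero_add _).symm
    · obtain ⟨z, rfl, h'⟩ := (mul₁_some_eq hid).1 h
      rw [d₁_eq hid x y]
      exact S.d_mul _ _ _ h'
  factor x n₁ n₂ hd := by
    -- The only element of degree zero in T ⊔ {1} is the unit, so a vanishing part of the degree
    -- forces the trivial factorization. When both parts are nonzero, factorization in the original
    -- semigraph produces factors that belong to 𝒯.
    by_cases h1 : n₁ = 0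
    · subst h1
      rw [zero_add] at hd
      refine ⟨(none, x), ⟨rfl, rfl, hd⟩, ?_⟩
      rintro ⟨y, z⟩ ⟨h, hy, hz⟩
      simp only at h hy hz
      rw [d₁_eq_zero hy] at h ⊢
      rw [mul₁_none_eq.1 h]
    by_cases h2 : n₂ = 0
    · subst h2
      rw [add_zero] at hd
      refine ⟨(x, none), ⟨mul₁_none_right x, hd, rfl⟩, ?_⟩
      rintro ⟨y, z⟩ ⟨h, hy, hz⟩
      simp only at h hy hz
      rw [d₁_eq_zero hz, mul₁_none_right] at h
      rw [d₁_eq_zero hz, Option.some.inj h]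
    rcases x with _ | x
    · have : n₁ = 0 := by
        refine le_antisymm ?_ (fun _ => Nat.zero_le _)
        change (0 : k → ℕ) = _ at hd
        rw [hd]
        exact le_self_add
      exact absurd this h1
    obtain ⟨⟨y, z⟩, ⟨h, hy, hz⟩, huniq⟩ := S.factor (elt x) n₁ n₂ hd
    simp only at h hy hz
    have hy0 : S.d y ≠ 0 := hy ▸ h1
    have hz0 : S.d z ≠ 0 := hz ▸ h2
    refine ⟨(some (toElt y hy0), some (toElt z hz0)), ⟨(mul₁_some_eq hid).2 ⟨x, rfl, ?_⟩, ?_, ?_⟩, ?_⟩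
    · rw [elt₁, elt_toElt hid, elt_toElt hid]; exact h
    · change S.d (elt _) = _
      rw [elt_toElt hid]; exact hy
    · change S.d (elt _) = _
      rw [elt_toElt hid]; exact hz
    · rintro ⟨y' | y', z' | z'⟩ ⟨h', hy', hz'⟩
      · exact absurd hy'.symm h1
      · exact absurd hy'.symm h1
      · exact absurd hz'.symm h2
      · obtain ⟨w, hw, h''⟩ := (mul₁_some_eq hid).1 h'
        cases hw
        have := huniq (elt y', elt z') ⟨h'', hy', hz'⟩
        obtain ⟨ha, hb⟩ := Prod.ext_iff.1 this
        simp only at ha hb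
        refine Prod.ext (congrArg some ?_) (congrArg some ?_)
        · exact elt_injective (by rw [ha, elt_toElt hid])
        · exact elt_injective (by rw [hb, elt_toElt hid])

theorem mem_minCommonExt₁ (hid : S.IdemZero) {x y : S.freePair.T}
    {c : Option S.freePair.T × Option S.freePair.T} :
    c ∈ minCommonExt S.freePair.mul₁ S.freePair.d₁ (some x) (some y) ↔
      (elt₁ x c.1, elt₁ y c.2) ∈ minCommonExt S.mul S.d (elt x) (elt y) := by
  constructor
  · rintro ⟨w, h1', h2', h3⟩
    obtain ⟨z, rfl, h1⟩ := (mul₁_some_eq hid).1 h1'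
    obtain ⟨z', hz', h2⟩ := (mul₁_some_eq hid).1 h2'
    cases hz'
    exact ⟨elt z, h1, h2, h3⟩
  · rintro ⟨z, h1, h2, h3⟩
    have hz := d_ne_of_mul (elt_ne x) h1
    refine ⟨some (toElt z hz), (mul₁_some_eq hid).2 ⟨_, rfl, ?_⟩,
      (mul₁_some_eq hid).2 ⟨_, rfl, ?_⟩, ?_⟩
    · rw [elt_toElt hid]; exact h1
    · rw [elt_toElt hid]; exact h2
    · change S.d (elt _) = S.d (elt x) ⊔ S.d (elt y)
      rw [elt_toElt hid]; exact h3

theorem exists_elt₁ (hid : S.IdemZero) {x : S.freePair.T} {e z : T}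
    (h : S.mul (elt x) e = some z) : ∃ c, elt₁ x c = e := by
  by_cases he : S.d e = 0
  · exact ⟨none, (hid.eq_of_mul_zero h he).2⟩
  · exact ⟨some (toElt e he), elt_toElt hid he⟩

theorem semigraph₁_finitelyAligned (hid : S.IdemZero) (hS : S.FinitelyAligned) :
    (semigraph₁ hid).FinitelyAligned := by
  intro x y
  change (minCommonExt S.freePair.mul₁ S.freePair.d₁ x y).Finite
  rcases x with _ | x
  · refine (Set.finite_singleton (y, (none : Option S.freePair.T))).subset ?_
    rintro ⟨e, f⟩ ⟨z, h1, h2, h3⟩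
    simp only at h1 h2
    rw [mul₁_none_eq] at h1
    have hd := (semigraph₁ hid).d_mul _ _ _ h2
    change S.freePair.d₁ z = S.freePair.d₁ y + S.freePair.d₁ f at hd
    change _ = (0 : k → ℕ) ⊔ _ at h3
    rw [sup_eq_right.2 (fun _ => Nat.zero_le _), hd, add_eq_left] at h3
    rw [d₁_eq_zero h3, mul₁_none_right] at h2
    cases h2
    rw [d₁_eq_zero h3, h1]
    rfl
  rcases y with _ | y
  · refine (Set.finite_singleton ((none : Option S.freePair.T), some x)).subset ?_
    rintro ⟨e, f⟩ ⟨z, h1, h2, h3⟩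
    simp only at h1 h2
    rw [mul₁_none_eq] at h2
    have hd := (semigraph₁ hid).d_mul _ _ _ h1
    change S.freePair.d₁ z = S.freePair.d₁ (some x) + S.freePair.d₁ e at hd
    change _ = _ ⊔ (0 : k → ℕ) at h3
    rw [sup_eq_left.2 (fun _ => Nat.zero_le _), hd, add_eq_left] at h3
    rw [d₁_eq_zero h3, mul₁_none_right] at h1
    cases h1
    rw [d₁_eq_zero h3, h2]
    rfl
  refine ((hS (elt x) (elt y)).preimage (f := fun c : Option S.freePair.T × Option S.freePair.T =>
    (elt₁ x c.1, elt₁ y c.2)) ?_).subset fun c hc => (mem_minCommonExt₁ hid).1 hc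
  intro c _ c' _ h
  obtain ⟨h1, h2⟩ := Prod.ext_iff.1 h
  exact Prod.ext (elt₁_injective hid x h1) (elt₁_injective hid y h2)

variable (S) in
/-- `Q_z`, where the product `z` may be undefined. -/
def optQ : Option T → S.FreeAlg
  | none => 0
  | some z => S.Q' z

theorem optQ_mem (hid : S.IdemZero) (hS : S.FinitelyAligned) (z : Option T) :
    S.optQ z ∈ S.freePair.P := by
  rcases z with _ | z
  · exact zero_mem_P
  · rw [optQ, ← qm_nil (S.Q' z), qm_Q'_eq hid hS]
    exact prodQ_mem _ _

/-- If the factor is the unit, then z = x, and the source of x that it stands for is absorbed by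
Q_x. -/
theorem val₁_mul_Q' (hid : S.IdemZero) {x : S.freePair.T} {e : Option S.freePair.T} {z : T}
    (h : S.mul (elt x) (elt₁ x e) = some z) :
    S.freePair.val₁ e * ((S.Q' z : S.FreeAlg) : Unitization ℂ S.FreeAlg) =
      ((S.ι (elt₁ x e) * S.Q' z : S.FreeAlg) : Unitization ℂ S.FreeAlg) := by
  rcases e with _ | e
  · rw [GeneratingPair.val₁, one_mul, elt₁]
    rw [elt₁, hid.mul_src] at h
    cases h
    rw [src_mul_Q' hid]
  · rw [GeneratingPair.val₁, elt₁, ι_elt, Unitization.inr_mul]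

theorem Q'_mul_star_val₁ (hid : S.IdemZero) {x : S.freePair.T} {e : Option S.freePair.T} {z : T}
    (h : S.mul (elt x) (elt₁ x e) = some z) :
    ((S.Q' z : S.FreeAlg) : Unitization ℂ S.FreeAlg) * star (S.freePair.val₁ e) =
      ((S.Q' z * star (S.ι (elt₁ x e)) : S.FreeAlg) : Unitization ℂ S.FreeAlg) := by
  have := congrArg star (val₁_mul_Q' hid h)
  rw [star_mul, ← Unitization.inr_star, ← Unitization.inr_star, star_mul, star_Q'] at this
  exact this

theorem expansion_free (hid : S.IdemZero) (hS : S.FinitelyAligned) (x y : S.freePair.T) :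
    ∃ q : Option S.freePair.T × Option S.freePair.T → S.FreeAlg,
    (∀ c ∈ minCommonExt S.freePair.mul₁ S.freePair.d₁ (some x) (some y), q c ∈ S.freePair.P) ∧
    ((star (x : S.FreeAlg) * y : S.FreeAlg) : Unitization ℂ S.FreeAlg) =
      ∑ᶠ c ∈ minCommonExt S.freePair.mul₁ S.freePair.d₁ (some x) (some y),
        S.freePair.val₁ c.1 * (q c : Unitization ℂ S.FreeAlg) * star (S.freePair.val₁ c.2) := by
  -- The coefficient is Q_{yβ}. As xα = yβ for a minimal common extension, this one projection
  -- absorbs the source of x on the left and that of y on the right whenever α or β is the unit.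
  refine ⟨fun c => S.optQ (S.mul (elt y) (elt₁ y c.2)), fun c _ => optQ_mem hid hS _, ?_⟩
  set F := (hS (elt x) (elt y)).toFinset
  have h1 : star (x : S.FreeAlg) * y = ∑ c ∈ F, S.ι c.1 *
      (star (S.ι (elt y) * S.ι c.2) * (S.ι (elt y) * S.ι c.2)) * star (S.ι c.2) := by
    rw [← ι_elt x, ← ι_elt y, S.star_ι_mul_ι_list (elt x) (elt y) F.toList F.nodup_toList
      (by simp [F]), ← List.sum_toFinset _ F.nodup_toList, Finset.toList_toFinset]
  have h2 : ∑ᶠ c ∈ minCommonExt S.freePair.mul₁ S.freePair.d₁ (some x) (some y),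
        S.freePair.val₁ c.1 * (S.optQ (S.mul (elt y) (elt₁ y c.2)) : Unitization ℂ S.FreeAlg) *
          star (S.freePair.val₁ c.2) =
      ∑ᶠ c ∈ minCommonExt S.mul S.d (elt x) (elt y), ((S.ι c.1 *
        (star (S.ι (elt y) * S.ι c.2) * (S.ι (elt y) * S.ι c.2)) * star (S.ι c.2) : S.FreeAlg) :
          Unitization ℂ S.FreeAlg) := by
    refine finsum_mem_eq_of_bijOn (fun c => (elt₁ x c.1, elt₁ y c.2)) ⟨?_, ?_, ?_⟩ ?_
    · exact fun c hc => (mem_minCommonExt₁ hid).1 hc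
    · intro c _ c' _ h
      obtain ⟨h1, h2⟩ := Prod.ext_iff.1 h
      exact Prod.ext (elt₁_injective hid x h1) (elt₁_injective hid y h2)
    · rintro ⟨e, f⟩ hc
      obtain ⟨z, hz1, hz2, hz3⟩ := hc
      obtain ⟨e', rfl⟩ := exists_elt₁ hid hz1
      obtain ⟨f', rfl⟩ := exists_elt₁ hid hz2
      exact ⟨(e', f'), (mem_minCommonExt₁ hid).2 ⟨z, hz1, hz2, hz3⟩, rfl⟩
    · intro c hc
      obtain ⟨z, hz1, hz2, hz3⟩ := (mem_minCommonExt₁ hid).1 hc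
      simp only at hz1 hz2 ⊢
      rw [hz2, optQ, S.ι_mul hz2, ← Q'_def, val₁_mul_Q' hid hz1, Unitization.inr_mul, mul_assoc,
        Q'_mul_star_val₁ hid hz2, ← Unitization.inr_mul, mul_assoc]
  rw [h2, h1, finsum_mem_eq_finite_toFinset_sum _ (hS (elt x) (elt y))]
  exact map_sum (Unitization.inrNonUnitalStarAlgHom ℂ S.FreeAlg) _ _

/-- Write px = p x Q_x and push the source projections in p to the right past x. The factor Q_x
keeps the resulting product nonempty. -/
theorem exchange_free (hid : S.IdemZero) (hS : S.FinitelyAligned) (x : T) {p : S.FreeAlg}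
    (hp : p ∈ S.freePair.P) : ∃ q ∈ S.freePair.P, p * S.ι x = S.ι x * q := by
  rcases mem_P_iff.1 hp with rfl | ⟨t, l, rfl⟩
  · exact ⟨0, zero_mem_P, by rw [zero_mul, mul_zero]⟩
  · have h1 : S.prodQ t l * S.ι x = S.qm (t :: l) (S.ι x * S.Q' x) := by
      rw [ι_mul_Q', ← qm_Q'_eq hid hS, qm_mul, qm_cons, Q'_mul_qm]
    rcases qm_mul_ι hid (t :: l) x with h | ⟨l', h⟩
    · exact ⟨0, zero_mem_P, by rw [h1, h, mul_zero]⟩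
    · refine ⟨S.prodQ x l', prodQ_mem _ _, ?_⟩
      rw [h1, h, qm_Q'_eq hid hS]

/-- Words are represented by partial injections which shift degrees. -/
theorem rep_isWord (hid : S.IdemZero) {n : k → ℤ} {w : FreeStarAlgebra (S.freePair.P ⊕ S.freePair.T)}
    (h : IsWord (PresentedStarAlgebra.of _) S.freePair.letterDeg n w) :
    ∃ g : S.TailPts ≃. S.TailPts,
      (tailAction hid).rep (FreeStarAlgebra.lift S.freePair.letter w) = shiftOp g ∧
      ∀ u v, g u = some v → S.tailDeg v = S.tailDeg u + n := by
  induction h with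
  | letter i =>
    rcases i with ⟨p, hp⟩ | x
    · obtain ⟨U, hU⟩ := exists_support_of_mem_P hid hp
      refine ⟨PEquiv.ofSet U, hU, fun u v h => ?_⟩
      rw [PEquiv.ofSet_eq_some_iff] at h
      rw [h.1]
      exact (add_zero _).symm
    · refine ⟨(tailAction hid).pequiv (elt x), ?_, fun u v h => tailDeg_act hid h⟩
      change (tailAction hid).rep (x : S.FreeAlg) = _
      rw [← ι_elt x, PartialAction.rep_ι]
  | letter_star i =>
    rcases i with ⟨p, hp⟩ | x
    · obtain ⟨U, hU⟩ := exists_support_of_mem_P hid hp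
      refine ⟨PEquiv.ofSet U, ?_, fun u v h => ?_⟩
      · change (tailAction hid).rep (star p) = _
        rw [map_star, hU, star_indicatorOp]
        rfl
      · rw [PEquiv.ofSet_eq_some_iff] at h
        rw [h.1]
        exact (congrArg (S.tailDeg u + ·) neg_zero).trans (add_zero _) |>.symm
    · refine ⟨((tailAction hid).pequiv (elt x)).symm, ?_, fun u v h => ?_⟩
      · change (tailAction hid).rep (star (x : S.FreeAlg)) = _
        rw [← ι_elt x, map_star, PartialAction.rep_ι, star_shiftOp]
      · rw [PEquiv.eq_some_iff] at h
        have := tailDeg_act hid h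
        rw [this]
        exact (add_neg_cancel_right _ _).symm
  | mul _ _ iha ihb =>
    obtain ⟨g, hg, hg'⟩ := iha
    obtain ⟨f, hf, hf'⟩ := ihb
    refine ⟨f.trans g, ?_, fun u v h => ?_⟩
    · rw [map_mul, map_mul, hg, hf, shiftOp_trans]
    · rw [PEquiv.trans_eq_some] at h
      obtain ⟨w, h1, h2⟩ := h
      rw [hg' _ _ h2, hf' _ _ h1]
      abel

/-- The kernel is graded: words of degree n are represented by operators shifting the degree of
points by n. Since Λ is faithful, each homogeneous component of a kernel element lies in the kernel.
Thus the homogeneous kernel elements may serve as the generating relations. -/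
theorem fiber_free (hid : S.IdemZero) (hS : S.FinitelyAligned) :
    ∃ R ⊆ S.freePair.fiberSpace, ∀ a,
      FreeStarAlgebra.lift S.freePair.letter a = 0 ↔ a ∈ starIdeal R := by
  refine ⟨{a | a ∈ S.freePair.fiberSpace ∧ FreeStarAlgebra.lift S.freePair.letter a = 0},
    fun a h => h.1, fun a => ⟨fun ha I hI _ => ?_, fun ha => ?_⟩⟩
  · have htop : a ∈ ⨆ n : k → ℤ, Submodule.span ℂ {w | IsWord (PresentedStarAlgebra.of
        (fun _ _ : StarTerm (S.freePair.P ⊕ S.freePair.T) => False)) S.freePair.letterDeg n w} := by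
      rw [FreeStarAlgebra.iSup_words]
      trivial
    obtain ⟨f, hf, rfl⟩ := (Submodule.mem_iSup_iff_exists_finsupp _ _).1 htop
    refine Submodule.sum_mem _ fun n hn => hI ⟨⟨n, hf n⟩, ?_⟩
    refine eq_of_rep_eq hid hS ?_
    rw [map_zero]
    refine eq_zero_of_sum_shiftBy (deg := S.tailDeg) (F := f.support)
      (A := fun n => (tailAction hid).rep (FreeStarAlgebra.lift S.freePair.letter (f n))) ?_ ?_ hn
    · intro m _
      refine Submodule.span_induction (p := fun w _ =>
        (tailAction hid).rep (FreeStarAlgebra.lift S.freePair.letter w) ∈ shiftBy S.tailDeg m)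
        ?_ ?_ ?_ ?_ (hf m)
      · intro w hw
        obtain ⟨g, hg, hg'⟩ := rep_isWord hid hw
        rw [hg]
        exact shiftOp_mem_coeffIn hg'
      · rw [map_zero, map_zero]; exact Submodule.zero_mem _
      · intro x y _ _ hx hy
        rw [map_add, map_add]; exact Submodule.add_mem _ hx hy
      · intro c x _ hx
        rw [map_smul, map_smul]; exact Submodule.smul_mem _ _ hx
    · rw [← map_sum, ← map_sum, show ∑ i ∈ f.support, f i = f.sum fun _ x => x from rfl, ha,
        map_zero]
  · refine ha (LinearMap.ker ((FreeStarAlgebra.lift S.freePair.letter :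
      FreeStarAlgebra (S.freePair.P ⊕ S.freePair.T) →⋆ₙₐ[ℂ] S.FreeAlg) :
        FreeStarAlgebra (S.freePair.P ⊕ S.freePair.T) →ₗ[ℂ] S.FreeAlg)) ?_ ?_
    · exact fun b hb => hb.2
    · intro x y hy
      have hy' : FreeStarAlgebra.lift S.freePair.letter y = 0 := hy
      refine ⟨?_, ?_, ?_⟩
      · change FreeStarAlgebra.lift S.freePair.letter (x * y) = 0
        rw [map_mul, hy', mul_zero]
      · change FreeStarAlgebra.lift S.freePair.letter (y * x) = 0
        rw [map_mul, hy', zero_mul]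
      · change FreeStarAlgebra.lift S.freePair.letter (star y) = 0
        rw [map_star, hy', star_zero]

theorem adjoin_free (hid : S.IdemZero) (hS : S.FinitelyAligned) :
    NonUnitalStarAlgebra.adjoin ℂ (S.freePair.P ∪ S.freePair.T) = ⊤ := by
  refine eq_top_iff.2 fun a _ => ?_
  set M := NonUnitalStarAlgebra.adjoin ℂ (S.freePair.P ∪ S.freePair.T)
  induction a using PresentedStarAlgebra.ind with | _ a
  induction a with
  | gen t =>
    refine NonUnitalStarAlgebra.subset_adjoin ℂ _ ?_
    by_cases ht : S.d t = 0
    · left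
      change S.ι t ∈ _
      rw [← Q'_zero S ht]
      exact optQ_mem hid hS (some t)
    · exact .inr ⟨t, ht, rfl⟩
  | zero => exact zero_mem M
  | add a b ha hb => exact add_mem (ha trivial) (hb trivial)
  | neg a ha => exact neg_mem (ha trivial)
  | smul z a ha => exact SMulMemClass.smul_mem z (ha trivial)
  | mul a b ha hb => exact mul_mem (ha trivial) (hb trivial)
  | adj a ha => exact star_mem (ha trivial)

theorem isSemigraphAlgebra (hid : S.IdemZero) (hS : S.FinitelyAligned) :
    S.freePair.IsSemigraphAlgebra where
  -- Elements of 𝒫 act diagonally, while t moves the point (R, src t) to (R, t), which differs from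
  -- it when d(t) ≠ 0.
  disjoint := by
    rw [Set.disjoint_left]
    rintro _ hp ⟨t, ht, rfl⟩
    obtain ⟨U, hU⟩ := exists_support_of_mem_P hid hp
    rw [PartialAction.rep_ι] at hU
    let R := TailSet.gen hid (S.src t) [t] (hid.d_src t) (by simp)
    have hx : t ∈ R.carrier := TailSet.mem_gen hid (by simp)
    have h3 := DFunLike.congr_fun (shiftOp_injective hU) (⟨(R, S.src t), R.root_mem⟩ : S.TailPts)
    have h4 : (tailAction hid).act t ⟨(R, S.src t), R.root_mem⟩ = some ⟨(R, t), hx⟩ :=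
      tailAct_eq_some.2 ⟨hid.mul_src t, rfl⟩
    rw [PartialAction.pequiv_apply, h4, eq_comm, PEquiv.ofSet_eq_some_iff] at h3
    have h5 : t = S.src t := congrArg (fun p : S.TailPts => p.1.2) h3.1
    rw [h5] at ht
    exact ht (hid.d_src t)
  generates := adjoin_free hid hS
  proj p hp := by
    obtain ⟨U, hU⟩ := exists_support_of_mem_P hid hp
    exact isStarProjection_of_rep hid hS hU
  proj_comm p hp q hq := by
    obtain ⟨U, hU⟩ := exists_support_of_mem_P hid hp
    obtain ⟨W, hW⟩ := exists_support_of_mem_P hid hq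
    exact comm_of_rep hid hS hU hW
  proj_mul p hp q hq := by
    rcases mem_P_iff.1 hp with rfl | ⟨t, l, rfl⟩
    · rw [zero_mul]; exact zero_mem_P
    rcases mem_P_iff.1 hq with rfl | ⟨t', l', rfl⟩
    · rw [mul_zero]; exact zero_mem_P
    have : S.prodQ t l * S.prodQ t' l' = S.prodQ t (l ++ t' :: l') := by
      refine eq_of_rep_eq hid hS ?_
      rw [map_mul, PartialAction.rep_prodQ, PartialAction.rep_prodQ, PartialAction.rep_prodQ,
        indicatorOp_mul, ← PartialAction.dom_append, List.cons_append]
    rw [this]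
    exact prodQ_mem _ _
  ne_zero := by
    rintro _ ⟨t, _, rfl⟩
    exact ι_ne_zero hid t
  partialIsometry := by
    rintro _ ⟨t, _, rfl⟩
    exact S.ι_mul_star_mul t
  mul_mem := by
    rintro _ ⟨s, hs, rfl⟩ _ ⟨t, _, rfl⟩ hne
    rcases h : S.mul s t with _ | z
    · exact absurd (S.ι_mul_none h) hne
    · rw [S.ι_mul h]
      exact ⟨z, d_ne_of_mul hs h, rfl⟩
  semigraph := ⟨semigraph₁ hid, rfl, rfl, semigraph₁_finitelyAligned hid hS⟩
  exchange := by
    rintro _ ⟨t, _, rfl⟩ p hp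
    exact exchange_free hid hS t hp
  expansion := expansion_free hid hS
  fiber := fiber_free hid hS

end Semigraph

namespace Semigraph

variable {k : Type v} {T : Type u} {S : Semigraph k T}

/-! ### Standard projections near a point -/

namespace PartialAction

variable {Ω : Type u} (α : S.PartialAction Ω)

/-- The support of a standard projection. -/
def supp (s : T) (l : List T) (Y : List (T × List T)) : Set Ω :=
  {v | v ∈ α.ran s l ∧ ∀ y ∈ Y, v ∉ α.ran y.1 y.2}

theorem rep_stdProj_supp (s : T) (l : List T) (Y : List (T × List T)) :
    α.rep (S.stdProj s l Y) = indicatorOp (α.supp s l Y) := α.rep_stdProj s l Y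

theorem ran_append (s : T) (l l' : List T) : α.ran s (l ++ l') = α.ran s l ∩ α.ran s l' := by
  ext v
  constructor
  · rintro ⟨u, hu, h⟩
    rw [dom_append] at hu
    exact ⟨⟨u, hu.1, h⟩, ⟨u, hu.2, h⟩⟩
  · rintro ⟨⟨u, hu, h⟩, ⟨u', hu', h'⟩⟩
    obtain rfl := α.inj _ _ _ _ h h'
    refine ⟨u, ?_, h⟩
    rw [dom_append]
    exact ⟨hu, hu'⟩

theorem supp_append (s : T) (l l' : List T) (Y Y' : List (T × List T)) :
    α.supp s (l ++ l') (Y ++ Y') = α.supp s l Y ∩ α.supp s l' Y' := by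
  ext v
  simp only [supp, ran_append, List.mem_append, Set.mem_inter_iff, Set.mem_ofPred_eq]
  constructor
  · rintro ⟨⟨h1, h2⟩, h3⟩
    exact ⟨⟨h1, fun y hy => h3 y (.inl hy)⟩, h2, fun y hy => h3 y (.inr hy)⟩
  · rintro ⟨⟨h1, h3⟩, h2, h4⟩
    exact ⟨⟨h1, h2⟩, fun y hy => hy.elim (h3 y) (h4 y)⟩

theorem mem_ran_zero {e : T} (he : S.d e = 0) {l : List T} {u : Ω} :
    u ∈ α.ran e l ↔ u ∈ α.dom l ∧ α.act e u = some u := by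
  constructor
  · rintro ⟨v, hv, h⟩
    obtain rfl := α.one _ _ _ he h
    exact ⟨hv, h⟩
  · rintro ⟨h1, h2⟩
    exact ⟨u, h1, h2⟩

end PartialAction

variable (S) in
/-- The list of half-standard words `y z`. -/
def leftMul (y : T) (Y : List (T × List T)) : List (T × List T) :=
  Y.filterMap fun z => (S.mul y z.1).map fun a => (a, z.2)

/-- An undefined product yz may be dropped from the list, because then no point in the range of z
lies in the domain of y and the condition is void. -/
theorem PartialAction.mem_supp_leftMul {Ω : Type u} (α : S.PartialAction Ω) (hid : S.IdemZero)
    {y : T} {l : List T} {Y : List (T × List T)} {v : Ω} :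
    v ∈ α.supp y l (S.leftMul y Y) ↔ ∃ u ∈ α.supp (S.src y) l Y, α.act y u = some v := by
  constructor
  · rintro ⟨⟨u, hu, h⟩, h'⟩
    refine ⟨u, ⟨(α.mem_ran_zero (hid.d_src y)).2 ⟨hu, α.act_zero_eq_some hid h⟩, ?_⟩, h⟩
    rintro z hz ⟨w, hw, hzw⟩
    obtain ⟨a, ha, haw⟩ := α.mul_of_act hzw h
    refine h' (a, z.2) ?_ ⟨w, hw, haw⟩
    exact List.mem_filterMap.2 ⟨z, hz, by rw [ha]; rfl⟩
  · rintro ⟨u, ⟨hu, hu'⟩, h⟩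
    refine ⟨⟨u, ((α.mem_ran_zero (hid.d_src y)).1 hu).1, h⟩, ?_⟩
    rintro b hb ⟨w, hw, hbw⟩
    obtain ⟨z, hz, hzb⟩ := List.mem_filterMap.1 hb
    obtain ⟨a, ha, rfl⟩ := Option.map_eq_some_iff.1 hzb
    obtain ⟨x, hx, hx'⟩ := α.act_of_mul ha hbw
    obtain rfl := α.inj _ _ _ _ h hx'
    exact hu' z hz ⟨w, hw, hx⟩

/-- Conjugation by y transports a standard projection at the source of y to one at y. This moves
constructions at a base point to arbitrary points of the tail set. -/
theorem ι_mul_stdProj (hid : S.IdemZero) (hS : S.FinitelyAligned) (y : T) (l : List T)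
    (Y : List (T × List T)) :
    S.ι y * S.stdProj (S.src y) l Y * star (S.ι y) = S.stdProj y l (S.leftMul y Y) := by
  refine eq_of_rep_eq hid hS ?_
  have h1 : (tailAction hid).rep (S.ι y * S.stdProj (S.src y) l Y) =
      shiftOp ((PEquiv.ofSet ((tailAction hid).supp (S.src y) l Y)).trans
        ((tailAction hid).pequiv y)) := by
    rw [map_mul, PartialAction.rep_ι, PartialAction.rep_stdProj_supp, shiftOp_trans]
    rfl
  have h2 : S.ι y * S.stdProj (S.src y) l Y * star (S.ι y) =
      S.ι y * S.stdProj (S.src y) l Y * star (S.ι y * S.stdProj (S.src y) l Y) := by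
    have h3 := isStarProjection_of_rep hid hS
      (PartialAction.rep_stdProj_supp (tailAction hid) (S.src y) l Y)
    have h4 : star (S.stdProj (S.src y) l Y) = S.stdProj (S.src y) l Y := h3.isSelfAdjoint
    have h5 : S.stdProj (S.src y) l Y * S.stdProj (S.src y) l Y = S.stdProj (S.src y) l Y :=
      h3.isIdempotentElem
    rw [star_mul, h4, mul_assoc (S.ι y) (S.stdProj _ _ _) (_ * _), ← mul_assoc (S.stdProj _ _ _),
      h5, mul_assoc]
  rw [h2, map_mul, map_star, h1, shiftOp_mul_star, PartialAction.rep_stdProj_supp]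
  congr 1
  ext v
  rw [PartialAction.mem_supp_leftMul _ hid]
  simp only [PEquiv.trans_eq_some, PEquiv.ofSet_eq_some_iff, PartialAction.pequiv_apply,
    Set.mem_ofPred_eq]
  constructor
  · rintro ⟨_, u, ⟨rfl, h⟩, h'⟩
    exact ⟨_, h, h'⟩
  · rintro ⟨u, h, h'⟩
    exact ⟨u, u, ⟨rfl, h⟩, h'⟩

theorem stdProj_mul_stdProj (hid : S.IdemZero) (hS : S.FinitelyAligned) (s : T) (l l' : List T)
    (Y Y' : List (T × List T)) :
    S.stdProj s l Y * S.stdProj s l' Y' = S.stdProj s (l ++ l') (Y ++ Y') := by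
  refine eq_of_rep_eq hid hS ?_
  rw [map_mul, PartialAction.rep_stdProj_supp, PartialAction.rep_stdProj_supp,
    PartialAction.rep_stdProj_supp, indicatorOp_mul, PartialAction.supp_append]

/-- The base point of a tail set. -/
def TailSet.basePt (R : S.TailSet) : S.TailPts := ⟨(R, R.root), R.root_mem⟩

/-- A standard projection below the source projection of the root of `R` whose support contains
the base point of `R`. -/
def Near (hid : S.IdemZero) (R : S.TailSet) (e : S.FreeAlg) : Prop :=
  ∃ l Y, e = S.stdProj R.root l Y ∧ R.basePt ∈ (tailAction hid).supp R.root l Y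

section Near

variable {hid : S.IdemZero} (hS : S.FinitelyAligned) {R : S.TailSet}

include hS

theorem Near.isStarProjection {e : S.FreeAlg} (h : Near hid R e) : IsStarProjection e := by
  obtain ⟨l, Y, rfl, _⟩ := h
  exact isStarProjection_of_rep hid hS (PartialAction.rep_stdProj_supp _ _ _ _)

theorem Near.mul {e f : S.FreeAlg} (he : Near hid R e) (hf : Near hid R f) :
    Near hid R (e * f) := by
  obtain ⟨l, Y, rfl, h⟩ := he
  obtain ⟨l', Y', rfl, h'⟩ := hf
  refine ⟨l ++ l', Y ++ Y', stdProj_mul_stdProj hid hS _ _ _ _ _, ?_⟩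
  rw [PartialAction.supp_append]
  exact ⟨h, h'⟩

theorem Near.comm {e f : S.FreeAlg} (he : Near hid R e) (hf : Near hid R f) : e * f = f * e := by
  obtain ⟨l, Y, rfl, h⟩ := he
  obtain ⟨l', Y', rfl, h'⟩ := hf
  exact comm_of_rep hid hS (PartialAction.rep_stdProj_supp _ _ _ _)
    (PartialAction.rep_stdProj_supp _ _ _ _)

/-- An element compressed to a scalar multiple of e is compressed to the same multiple of every
smaller projection of this kind. Finitely many elements can thus be handled by one projection. -/
theorem Near.compress_mul {x e f : S.FreeAlg} {c : ℂ} (he : Near hid R e) (hf : Near hid R f)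
    (h : e * x * e = c • e) : e * f * x * (e * f) = c • (e * f) := by
  have hff : f * f = f := (hf.isStarProjection hS).isIdempotentElem
  rw [show e * f * x * (e * f) = f * (e * x * e) * f by
    rw [he.comm hS hf]; simp only [mul_assoc]; rw [he.comm hS hf], h, mul_smul_comm,
    smul_mul_assoc, he.comm hS hf, mul_assoc, he.comm hS hf, ← mul_assoc, hff]

omit hS in
theorem Near.ne_zero {e : S.FreeAlg} (he : Near hid R e) : e ≠ 0 := by
  obtain ⟨l, Y, rfl, h⟩ := he
  intro h0
  have h1 := (tailAction hid).rep_stdProj_supp R.root l Y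
  rw [h0, map_zero] at h1
  have h2 := indicatorOp_delta ((tailAction hid).supp R.root l Y) R.basePt
  rw [if_pos h, ← h1] at h2
  exact delta_ne_zero _ h2.symm

omit hS in
theorem basePt_mem_dom {l : List T} :
    R.basePt ∈ (tailAction hid).dom l ↔ ∀ r ∈ l, r ∈ R.carrier := by
  rw [TailSet.basePt, mem_dom_tail]
  refine forall₂_congr fun r _ => ⟨?_, fun h => ⟨r, h, R.mul_root r h⟩⟩
  rintro ⟨z, hz, h⟩
  rwa [← (hid.eq_of_mul_zero h R.d_root).1]

omit hS in
-- The base point has degree zero, so only a degree-zero letter can reach it, and that letter is the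
-- root.
theorem basePt_mem_ran {s : T} {l : List T} :
    R.basePt ∈ (tailAction hid).ran s l ↔ s = R.root ∧ ∀ r ∈ l, r ∈ R.carrier := by
  constructor
  · intro h
    have hd : S.d s = 0 := le_antisymm ((d_le_of_mem_ran hid h).trans R.d_root.le)
      fun _ => Nat.zero_le _
    obtain ⟨h1, h2⟩ := ((tailAction hid).mem_ran_zero hd).1 h
    refine ⟨?_, basePt_mem_dom.1 h1⟩
    have h3 : S.mul s R.root = some R.root := (tailAct_eq_some.1 h2).1
    rw [← (hid.eq_of_mul_zero h3 R.d_root).1]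
  · rintro ⟨rfl, h⟩
    exact ((tailAction hid).mem_ran_zero R.d_root).2
      ⟨basePt_mem_dom.2 h, tailAct_eq_some.2 ⟨R.mul_root _ R.root_mem, rfl⟩⟩

/-- Compressions by small projections only see the coefficient at the base point: the case of
words. -/
theorem exists_near_word (s : T) (l : List T) (t : T) : ∃ e, Near hid R e ∧
    e * S.word s l t * e = (tailAction hid).rep (S.word s l t) (delta R.basePt) R.basePt • e := by
  set α := tailAction hid
  have hnear : ∀ (l : List T) (Y : List (T × List T)), (∀ r ∈ l, r ∈ R.carrier) →
      (∀ y ∈ Y, y.1 = R.root → ∃ r ∈ y.2, r ∉ R.carrier) →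
      Near hid R (S.stdProj R.root l Y) := by
    refine fun l Y hl hY => ⟨l, Y, rfl, basePt_mem_ran.2 ⟨rfl, hl⟩, fun y hy h => ?_⟩
    obtain ⟨h1, h2⟩ := basePt_mem_ran.1 h
    obtain ⟨r, hr, hr'⟩ := hY y hy h1
    exact hr' (h2 r hr)
  -- The off-diagonal case: if removing finitely many ranges that miss the base point leaves nothing
  -- for the word to connect, then both sides vanish.
  have hzero : ∀ Y : List (T × List T), (∀ y ∈ Y, y.1 = R.root → ∃ r ∈ y.2, r ∉ R.carrier) →
      (∀ u ∈ α.supp R.root [] Y, ∀ v ∈ α.supp R.root [] Y, α.wordPEquiv s l t u ≠ some v) →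
      ∃ e, Near hid R e ∧
        e * S.word s l t * e = α.rep (S.word s l t) (delta R.basePt) R.basePt • e := by
    intro Y hY h
    have hn := hnear [] Y (by simp) hY
    refine ⟨_, hn, ?_⟩
    have h0 : α.rep (S.word s l t) (delta R.basePt) R.basePt = 0 := by
      rw [α.rep_word, shiftOp_delta]
      obtain ⟨_, _, _, hb⟩ : Near hid R (S.stdProj R.root [] Y) := hn
      have hb : R.basePt ∈ α.supp R.root [] Y := by
        refine ⟨basePt_mem_ran.2 ⟨rfl, by simp⟩, fun y hy h => ?_⟩
        obtain ⟨h1, h2⟩ := basePt_mem_ran.1 h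
        obtain ⟨r, hr, hr'⟩ := hY y hy h1
        exact hr' (h2 r hr)
      have := h _ hb _ hb
      rcases hv : α.wordPEquiv s l t R.basePt with _ | v
      · rfl
      · rw [Option.elim_some, delta_apply, if_neg]
        rintro rfl
        exact this hv
    rw [h0, zero_smul]
    refine eq_of_rep_eq hid hS ?_
    rw [map_mul, map_mul, map_zero]
    change α.rep _ * α.rep _ * α.rep _ = 0
    rw [α.rep_stdProj_supp, α.rep_word]
    refine ext_delta fun u => ?_
    change indicatorOp _ (shiftOp _ (indicatorOp _ (delta u))) = 0
    rw [indicatorOp_delta]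
    by_cases hu : u ∈ α.supp R.root [] Y
    · rw [if_pos hu, shiftOp_delta]
      rcases hv : α.wordPEquiv s l t u with _ | v
      · rw [Option.elim_none, map_zero]
      · rw [Option.elim_some, indicatorOp_delta, if_neg]
        exact fun hv' => h u hu v hv' hv
    · rw [if_neg hu, map_zero, map_zero]
  -- If t or s is not the root, its range projection misses the base point and can be removed, which
  -- cuts off the domain or the range of the word.
  by_cases ht : t = R.root
  swap
  · refine hzero [(t, [])] ?_ ?_
    · rintro y hy h
      rw [List.mem_singleton.1 hy] at h
      exact absurd h ht
    · intro u hu v _ h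
      obtain ⟨c, hc, h1, _⟩ := α.wordPEquiv_eq_some.1 h
      exact hu.2 _ List.mem_cons_self ⟨c, by simp [PartialAction.dom], h1⟩
  by_cases hs : s = R.root
  swap
  · refine hzero [(s, [])] ?_ ?_
    · rintro y hy h
      rw [List.mem_singleton.1 hy] at h
      exact absurd h hs
    · intro u _ v hv h
      obtain ⟨c, hc, _, h1⟩ := α.wordPEquiv_eq_some.1 h
      exact hv.2 _ List.mem_cons_self ⟨c, by simp [PartialAction.dom], h1⟩
  -- A letter r outside R makes Q_r vanish at the base point, so its support is removed.
  by_cases hl : ∀ r ∈ l, r ∈ R.carrier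
  swap
  · push Not at hl
    obtain ⟨r, hr, hrR⟩ := hl
    refine hzero [(R.root, [r])] ?_ ?_
    · rintro y hy h
      rw [List.mem_singleton.1 hy]
      exact ⟨r, List.mem_cons_self, hrR⟩
    · intro u hu v _ h
      obtain ⟨c, hc, h1, _⟩ := α.wordPEquiv_eq_some.1 h
      rw [ht] at h1
      refine hu.2 _ List.mem_cons_self ⟨c, ?_, h1⟩
      rw [α.dom_singleton]
      exact hc r hr
  subst ht hs
  have hw : α.rep (S.word R.root l R.root) = α.rep (S.stdProj R.root l []) := by
    rw [α.rep_word, α.rep_stdProj_supp, indicatorOp]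
    congr 1
    ext u v
    rw [α.wordPEquiv_eq_some, PEquiv.ofSet_eq_some_iff]
    constructor
    · rintro ⟨c, hc, h1, h2⟩
      obtain rfl := α.one _ _ _ R.d_root h1
      obtain rfl := α.one _ _ _ R.d_root h2
      exact ⟨rfl, ⟨_, hc, h1⟩, by simp⟩
    · rintro ⟨rfl, ⟨c, hc, h⟩, _⟩
      exact ⟨c, hc, h, h⟩
  have hn := hnear l [] hl (by simp)
  refine ⟨_, hn, ?_⟩
  have hp := (hn.isStarProjection hS).isIdempotentElem
  rw [eq_of_rep_eq hid hS hw, hp, hp, α.rep_stdProj_supp, indicatorOp_delta, if_pos,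
    delta_apply_self, one_smul]
  exact ⟨basePt_mem_ran.2 ⟨rfl, hl⟩, by simp⟩

variable (hid R)

/-- Linear extension from words: the projections found for the summands are multiplied together. In
this way the vector state at the base point is realized by algebraic compressions inside X. -/
theorem exists_near (x : S.FreeAlg) : ∃ e, Near hid R e ∧
    e * x * e = (tailAction hid).rep x (delta R.basePt) R.basePt • e := by
  have hx : x ∈ S.wordSpan (fun _ _ => True) := by
    rw [wordSpan_eq_top hid hS]
    trivial
  induction hx using Submodule.span_induction with
  | mem x hx =>
    obtain ⟨s, l, t, _, rfl⟩ := hx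
    exact exists_near_word hS s l t
  | zero =>
    obtain ⟨e, he, _⟩ := exists_near_word (hid := hid) (R := R) hS R.root [] R.root
    exact ⟨e, he, by simp⟩
  | add x y _ _ hx hy =>
    obtain ⟨e, he, hex⟩ := hx
    obtain ⟨f, hf, hfy⟩ := hy
    refine ⟨e * f, he.mul hS hf, ?_⟩
    have h1 := he.compress_mul hS hf hex
    have h2 := hf.compress_mul hS he hfy
    rw [hf.comm hS he] at h2
    rw [mul_add, add_mul, h1, h2, map_add, ← add_smul]
    rfl
  | smul c x _ hx =>
    obtain ⟨e, he, hex⟩ := hx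
    refine ⟨e, he, ?_⟩
    rw [mul_smul_comm, smul_mul_assoc, hex, smul_smul, map_smul]
    rfl

end Near

/-! ### The cancelling condition -/

theorem PartialAction.rep_star_mul_apply {Ω : Type u} (α : S.PartialAction Ω) (a b : S.FreeAlg)
    (p q : Ω) :
    α.rep (star a * b) (delta p) q = inner ℂ (α.rep a (delta q)) (α.rep b (delta p)) := by
  rw [← inner_delta_left, map_mul, map_star]
  change inner ℂ _ (star (α.rep a) (α.rep b (delta p))) = _
  rw [ContinuousLinearMap.star_eq_adjoint, ContinuousLinearMap.adjoint_inner_right]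

theorem rep_tailAction_ι_basePt (hid : S.IdemZero) {R : S.TailSet} {y : T} (hy : y ∈ R.carrier) :
    (tailAction hid).rep (S.ι y) (delta R.basePt) = delta ⟨(R, y), hy⟩ := by
  rw [PartialAction.rep_ι]
  exact shiftOp_delta_some (tailAct_eq_some.2 ⟨R.mul_root y hy, rfl⟩)

theorem ι_src_mul_prodQ (hid : S.IdemZero) (hS : S.FinitelyAligned) (r : T) (l : List T) :
    S.ι (S.src r) * S.prodQ r l = S.prodQ r l := by
  rw [prodQ_eq_half hid hS, half, ← mul_assoc, S.ι_zero_mul_self (hid.d_src r)]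

theorem prodQ_mul_ι_src (hid : S.IdemZero) (hS : S.FinitelyAligned) (r : T) (l : List T) :
    S.prodQ r l * S.ι (S.src r) = S.prodQ r l := by
  have h : star (S.prodQ r l) = S.prodQ r l :=
    (isStarProjection_of_rep hid hS (PartialAction.rep_prodQ _ r l)).isSelfAdjoint
  have := congrArg star (ι_src_mul_prodQ hid hS r l)
  rwa [star_mul, h, S.star_ι_zero (hid.d_src r)] at this

/-- Standard words whose outer letters have different degrees have no diagonal coefficients. -/
theorem rep_standardWord_apply_self (hid : S.IdemZero) (hS : S.FinitelyAligned)
    {s t : Option S.freePair.T} (hst : S.freePair.d₁ s ≠ S.freePair.d₁ t) {p w : S.FreeAlg}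
    (hp : p ∈ S.freePair.P) (hw : (w : Unitization ℂ S.FreeAlg) =
      S.freePair.val₁ s * (p : Unitization ℂ S.FreeAlg) * star (S.freePair.val₁ t))
    (u : S.TailPts) : (tailAction hid).rep w (delta u) u = 0 := by
  obtain rfl | ⟨r, l, rfl⟩ := mem_P_iff.1 hp
  · have : w = 0 := by
      refine Unitization.inr_injective (R := ℂ) ?_
      rw [hw, Unitization.inr_zero, mul_zero, zero_mul]
    rw [this, map_zero]
    rfl
  obtain ⟨a, ha, ha'⟩ : ∃ a, S.d a = S.freePair.d₁ s ∧
      S.freePair.val₁ s * (S.prodQ r l : Unitization ℂ S.FreeAlg) =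
        (S.ι a * S.prodQ r l : S.FreeAlg) := by
    rcases s with _ | x
    · exact ⟨S.src r, hid.d_src r, by rw [ι_src_mul_prodQ hid hS]; exact one_mul _⟩
    · exact ⟨elt x, rfl, by rw [ι_elt, Unitization.inr_mul]; rfl⟩
  obtain ⟨b, hb, hb'⟩ : ∃ b, S.d b = S.freePair.d₁ t ∧
      ((S.ι a * S.prodQ r l : S.FreeAlg) : Unitization ℂ S.FreeAlg) * star (S.freePair.val₁ t) =
        (S.ι a * S.prodQ r l * star (S.ι b) : S.FreeAlg) := by
    rcases t with _ | x
    · refine ⟨S.src r, hid.d_src r, ?_⟩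
      rw [S.star_ι_zero (hid.d_src r), mul_assoc, prodQ_mul_ι_src hid hS, GeneratingPair.val₁,
        star_one, mul_one]
    · exact ⟨elt x, rfl, by
        rw [ι_elt, Unitization.inr_mul _ (_ * _), Unitization.inr_star]; rfl⟩
  obtain rfl : w = S.ι a * S.prodQ r l * star (S.ι b) :=
    Unitization.inr_injective (R := ℂ) (by rw [hw, ha', hb'])
  rw [map_mul, map_mul, map_star, PartialAction.rep_prodQ, PartialAction.rep_ι,
    PartialAction.rep_ι, star_shiftOp]
  change shiftOp _ (indicatorOp _ (shiftOp _ (delta u))) u = 0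
  rw [shiftOp_delta]
  rcases hc : ((tailAction hid).pequiv b).symm u with _ | c
  · simp
  rw [Option.elim_some, indicatorOp_delta]
  split_ifs
  swap
  · rw [map_zero]; rfl
  rw [shiftOp_delta]
  rcases hv : (tailAction hid).pequiv a c with _ | v
  · rfl
  rw [Option.elim_some, delta_apply, if_neg]
  rintro rfl
  rw [PartialAction.pequiv_symm_eq_some] at hc
  rw [PartialAction.pequiv_apply] at hv
  have h1 := S.d_mul _ _ _ (tailAct_eq_some.1 hc).1
  have h2 := S.d_mul _ _ _ (tailAct_eq_some.1 hv).1
  exact hst (by rw [← ha, ← hb]; exact add_right_cancel (h2.symm.trans h1))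

/-- Let (R, a) be the minimal point of e. The diagonal coefficient of w there vanishes, because w
changes degrees. It equals the coefficient of (ea)*w(ea) at the base point of R, so some projection
n near the base point compresses this element to zero. Transporting n back by a gives f = (a n a*)
e. -/
theorem isCancelling (hid : S.IdemZero) (hS : S.FinitelyAligned) : S.freePair.IsCancelling := by
  intro s t hst p hp w hw e he hne
  obtain ⟨a, l, Y, rfl⟩ := eq_stdProj_of_mem hid hS he hne
  obtain ⟨hl, hmem⟩ := exists_point_of_ne_zero hid hS hne
  set R := TailSet.gen hid (S.src a) (a :: l) (hid.d_src a) hl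
  have ha : a ∈ R.carrier := TailSet.mem_gen hid List.mem_cons_self
  change (⟨(R, a), ha⟩ : S.TailPts) ∈ (tailAction hid).supp a l Y at hmem
  set e := S.stdProj a l Y
  have he' := (tailAction hid).rep_stdProj_supp a l Y
  have hproj := isStarProjection_of_rep hid hS he'
  have hestar : star e = e := hproj.isSelfAdjoint
  obtain ⟨n, hn, hny⟩ := exists_near hid hS R (star (e * S.ι a) * (w * (e * S.ι a)))
  have hea : (tailAction hid).rep (e * S.ι a) (delta R.basePt) = delta ⟨(R, a), ha⟩ := by
    rw [map_mul]
    change (tailAction hid).rep e ((tailAction hid).rep (S.ι a) _) = _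
    rw [rep_tailAction_ι_basePt hid ha, he', indicatorOp_delta, if_pos hmem]
  have h0 : (tailAction hid).rep (w * (e * S.ι a)) (delta R.basePt) =
      (tailAction hid).rep w (delta ⟨(R, a), ha⟩) := by
    rw [map_mul, ← hea]
    rfl
  rw [PartialAction.rep_star_mul_apply, hea, h0, inner_delta_left,
    rep_standardWord_apply_self hid hS hst hp hw, zero_smul] at hny
  obtain ⟨l', Y', rfl, hbase⟩ := hn
  set n := S.stdProj R.root l' Y'
  have hm : S.ι a * n * star (S.ι a) = S.stdProj a l' (S.leftMul a Y') :=
    ι_mul_stdProj hid hS a l' Y'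
  set m := S.stdProj a l' (S.leftMul a Y')
  have hmrep := (tailAction hid).rep_stdProj_supp a l' (S.leftMul a Y')
  have hfe : m * e = S.stdProj a (l' ++ l) (S.leftMul a Y' ++ Y) :=
    stdProj_mul_stdProj hid hS _ _ _ _ _
  have hcomm : m * e = e * m := comm_of_rep hid hS hmrep he'
  refine ⟨m * e, hfe ▸ stdProj_mem hid hS _ _ _, ?_, ?_, ?_⟩
  · intro h
    have h1 := (tailAction hid).rep_stdProj_supp a (l' ++ l) (S.leftMul a Y' ++ Y)
    rw [← hfe, h, map_zero, PartialAction.supp_append] at h1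
    have h2 := indicatorOp_delta ((tailAction hid).supp a l' (S.leftMul a Y') ∩
      (tailAction hid).supp a l Y) ⟨(R, a), ha⟩
    rw [if_pos, ← h1] at h2
    · exact delta_ne_zero _ h2.symm
    · refine ⟨((tailAction hid).mem_supp_leftMul hid).2 ⟨R.basePt, hbase, ?_⟩, hmem⟩
      exact tailAct_eq_some.2 ⟨R.mul_root a ha, rfl⟩
  · rw [ProjLE, mul_assoc]
    exact congrArg (m * ·) hproj.isIdempotentElem
  · have h3 : m * e * w * (m * e) = S.ι a * (n * (star (e * S.ι a) * (w * (e * S.ι a))) * n) *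
        star (S.ι a) := by
      rw [show m * e * w * (m * e) = m * e * w * (e * m) by rw [hcomm], ← hm, star_mul, hestar]
      simp only [mul_assoc]
    rw [h3, hny, mul_zero, zero_mul]

end Semigraph

/-! ### Norm estimates -/

/-- Comparison of two sequences of iterated squares which are comparable up to a polynomial
factor. -/
theorem le_of_iterated_squares {a b : ℕ → ℝ} {K : ℝ} {E : ℕ} (hb : 0 ≤ b 0)
    (ha' : ∀ j, a (j + 1) = a j ^ 2) (hb' : ∀ j, b (j + 1) = b j ^ 2)
    (h : ∀ j, a j ≤ K * (2 ^ j : ℕ) ^ E * b j) : a 0 ≤ b 0 := by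
  have hpow : ∀ c : ℕ → ℝ, (∀ j, c (j + 1) = c j ^ 2) → ∀ j, c j = c 0 ^ (2 ^ j) := by
    intro c hc j
    induction j with
    | zero => simp
    | succ j ih => rw [hc, ih, ← pow_mul, pow_succ]
  by_contra hlt
  push Not at hlt
  have ha0 : 0 < a 0 := hb.trans_lt hlt
  rcases hb.eq_or_lt with hb0 | hb0
  · have := h 0
    rw [← hb0, mul_zero] at this
    exact absurd this (not_le.2 ha0)
  set r := a 0 / b 0
  have hr : 1 < r := (one_lt_div hb0).2 hlt
  -- If a 0 exceeded b 0, their ratio r > 1 raised to the power 2^j would outgrow any polynomial in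
  -- 2^j.
  have hlim : Filter.Tendsto (fun j : ℕ => K * (((2 ^ j : ℕ) : ℝ) ^ E / r ^ (2 ^ j)))
      Filter.atTop (nhds (K * 0)) :=
    ((tendsto_pow_const_div_const_pow_of_one_lt E hr).comp
      (tendsto_pow_atTop_atTop_of_one_lt (one_lt_two (α := ℕ)))).const_mul K
  rw [mul_zero] at hlim
  obtain ⟨j, hj⟩ := (hlim.eventually_lt_const one_pos).exists
  have h1 := h j
  rw [hpow a ha', hpow b hb'] at h1
  have h2 : r ^ (2 ^ j) ≤ K * (2 ^ j : ℕ) ^ E := by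
    rw [div_pow, div_le_iff₀ (pow_pos hb0 _)]
    exact h1
  rw [← mul_div_assoc, div_lt_one (pow_pos (one_pos.trans hr) _)] at hj
  exact absurd h2 (not_le.2 hj)

section IteratedSquares

variable {X : Type*} [NonUnitalRing X] [StarRing X]

/-- The iterated squares of `x* x`. -/
def iterSq (x : X) : ℕ → X
  | 0 => star x * x
  | j + 1 => iterSq x j * iterSq x j

theorem star_iterSq (x : X) (j : ℕ) : star (iterSq x j) = iterSq x j := by
  induction j with
  | zero => rw [iterSq, star_mul, star_star]
  | succ j ih => rw [iterSq, star_mul, ih]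

/-- The spectral radius argument: the norm in a C⋆-algebra is dominated by another C⋆-seminorm if it
is dominated up to a polynomial factor on iterated squares. -/
theorem norm_le_of_iterSq [Module ℂ X] {A : Type*} [NonUnitalCStarAlgebra A] (ψ : X →⋆ₙₐ[ℂ] A)
    (q : X → ℝ) (x : X) (hq0 : ∀ z, 0 ≤ q z) (hq : q (star x * x) = q x ^ 2)
    (hq' : ∀ j, q (iterSq x j * iterSq x j) = q (iterSq x j) ^ 2) {K : ℝ} {E : ℕ}
    (h : ∀ j, ‖ψ (iterSq x j)‖ ≤ K * (2 ^ j : ℕ) ^ E * q (iterSq x j)) : ‖ψ x‖ ≤ q x := by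
  have hψ : ∀ z, ‖ψ (star z * z)‖ = ‖ψ z‖ ^ 2 := by
    intro z
    rw [map_mul, map_star, CStarRing.norm_star_mul_self, pow_two]
  have key : ‖ψ (iterSq x 0)‖ ≤ q (iterSq x 0) := by
    refine le_of_iterated_squares (a := fun j => ‖ψ (iterSq x j)‖) (b := fun j => q (iterSq x j))
      (hq0 _) (fun j => ?_) hq' h
    have := hψ (iterSq x j)
    rwa [star_iterSq] at this
  rw [iterSq, hψ, hq] at key
  exact le_of_sq_le_sq key (hq0 x)

end IteratedSquares

namespace Semigraph

variable {k : Type v} {T : Type u} {S : Semigraph k T}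

/-! ### The lower bound for representations that do not vanish on standard projections -/

section Lower

variable (hid : S.IdemZero) (hS : S.FinitelyAligned)

theorem rep_mem_coeffIn {p : T → T → Prop} {r : S.TailPts → S.TailPts → Prop}
    (h : ∀ s l t u v, p s t → (tailAction hid).wordPEquiv s l t u = some v → r u v)
    {x : S.FreeAlg} (hx : x ∈ S.wordSpan p) : (tailAction hid).rep x ∈ coeffIn r := by
  induction hx using Submodule.span_induction with
  | mem x hx =>
    obtain ⟨s, l, t, hp, rfl⟩ := hx
    rw [PartialAction.rep_word]
    exact shiftOp_mem_coeffIn fun u v => h s l t u v hp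
  | zero => rw [map_zero]; exact Submodule.zero_mem _
  | add x y _ _ hx hy => rw [map_add]; exact Submodule.add_mem _ hx hy
  | smul c x _ hx => rw [map_smul]; exact Submodule.smul_mem _ _ hx

/-- The base point is algebraically cyclic for its block: every (R, y) is the image of (R, root)
under y. -/
theorem exists_rep_basePt_eq (R : S.TailSet) {ξ : Ell2 S.TailPts}
    (hξ : ξ ∈ Submodule.span ℂ (delta '' {p : S.TailPts | p.1.1 = R})) :
    ∃ x, (tailAction hid).rep x (delta R.basePt) = ξ := by
  induction hξ using Submodule.span_induction with
  | mem ξ h =>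
    obtain ⟨⟨⟨R', y⟩, hy⟩, rfl, rfl⟩ := h
    exact ⟨S.ι y, rep_tailAction_ι_basePt hid hy⟩
  | zero => exact ⟨0, by rw [map_zero]; rfl⟩
  | add ξ η _ _ hξ hη =>
    obtain ⟨x, rfl⟩ := hξ
    obtain ⟨y, rfl⟩ := hη
    exact ⟨x + y, by rw [map_add]; rfl⟩
  | smul c ξ _ hξ =>
    obtain ⟨x, rfl⟩ := hξ
    exact ⟨c • x, by rw [map_smul]; rfl⟩

include hS

/-- Representations which do not vanish on standard projections dominate the norm of the
representation on the points of tail sets. -/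
theorem norm_rep_le_of_nonVanishing {A : Type*} [NonUnitalCStarAlgebra A]
    (φ : S.FreeAlg →⋆ₙₐ[ℂ] A) (hφ : NonVanishing S.freePair φ) (x : S.FreeAlg) :
    ‖(tailAction hid).rep x‖ ≤ ‖φ x‖ := by
  refine norm_le_of_blocks _ (fun p => p.1.1) (fun p => p.1.1) (norm_nonneg _) ?_ ?_
  · have hx : x ∈ S.wordSpan (fun _ _ => True) := by
      rw [wordSpan_eq_top hid hS]
      trivial
    refine rep_mem_coeffIn (r := fun v u => u.1.1 = v.1.1) hid ?_ hx
    intro s l t u v _ h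
    obtain ⟨c, _, h1, h2⟩ := (tailAction hid).wordPEquiv_eq_some.1 h
    rw [(tailAct_eq_some.1 h1).2, (tailAct_eq_some.1 h2).2]
  · intro R ξ hξ
    obtain ⟨X, rfl⟩ := exists_rep_basePt_eq hid R hξ
    have hcoef : ∀ y : S.FreeAlg, (tailAction hid).rep (star y * y) (delta R.basePt) R.basePt =
        ((‖(tailAction hid).rep y (delta R.basePt)‖ ^ 2 : ℝ) : ℂ) := by
      intro y
      rw [PartialAction.rep_star_mul_apply, inner_self_eq_norm_sq_to_K]
      norm_cast
    -- The squared norms of Λ(xX)δ and Λ(X)δ at the base point are diagonal coefficients. One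
    -- standard projection g is made to realize both of them.
    obtain ⟨e, he, hex⟩ := exists_near hid hS R (star (x * X) * (x * X))
    obtain ⟨f, hf, hfX⟩ := exists_near hid hS R (star X * X)
    have h1 := he.compress_mul hS hf hex
    have h2 := hf.compress_mul hS he hfX
    rw [hf.comm hS he] at h2
    have hg := he.mul hS hf
    set g := e * f
    rw [hcoef] at h1 h2
    have hgs : star g = g := (hg.isStarProjection hS).isSelfAdjoint
    have hg0 : 0 < ‖φ g‖ := by
      rw [norm_pos_iff]
      obtain ⟨l, Y, h, _⟩ := id hg
      exact hφ g (h ▸ stdProj_mem hid hS _ _ _) hg.ne_zero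
    -- By the C⋆-identity, ‖φ(yg)‖² is the coefficient of y*y times ‖φ(g)‖, and ‖φ(g)‖ cancels
    -- because it is nonzero.
    have hnorm : ∀ (y : S.FreeAlg) (c : ℝ), 0 ≤ c → g * (star y * y) * g = (c : ℂ) • g →
        ‖φ (y * g)‖ * ‖φ (y * g)‖ = c * ‖φ g‖ := by
      intro y c hc h
      rw [← CStarRing.norm_star_mul_self, ← map_star, ← map_mul, star_mul, hgs,
        show g * star y * (y * g) = g * (star y * y) * g by simp only [mul_assoc], h, map_smul,
        norm_smul, Complex.norm_real, Real.norm_of_nonneg hc]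
    have h3 := hnorm _ _ (sq_nonneg _) h1
    have h4 := hnorm _ _ (sq_nonneg _) h2
    have h5 : ‖φ (x * X * g)‖ ≤ ‖φ x‖ * ‖φ (X * g)‖ := by
      rw [mul_assoc, map_mul]
      exact norm_mul_le _ _
    have h6 := mul_self_le_mul_self (norm_nonneg _) h5
    rw [h3, mul_mul_mul_comm, h4, ← mul_assoc] at h6
    have h7 := le_of_mul_le_mul_right h6 hg0
    rw [← pow_two, ← mul_pow] at h7
    have h8 := le_of_sq_le_sq h7 (by positivity)
    rw [map_mul] at h8
    exact h8

end Lower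

end Semigraph

namespace Semigraph

variable {k : Type v} {T : Type u} {S : Semigraph k T}

theorem norm_star_mul_op {Ω : Type u} (A : Ell2 Ω →L[ℂ] Ell2 Ω) : ‖star A * A‖ = ‖A‖ * ‖A‖ :=
  A.norm_adjoint_comp_self

/-! ### The core -/

theorem star_word (hid : S.IdemZero) (hS : S.FinitelyAligned) (s : T) (l : List T) (t : T) :
    star (S.word s l t) = S.word t l s := by
  refine eq_of_rep_eq hid hS ?_
  rw [map_star, PartialAction.rep_word, PartialAction.rep_word, star_shiftOp]
  congr 1
  ext u v
  rw [PEquiv.eq_some_iff, PartialAction.wordPEquiv_eq_some, PartialAction.wordPEquiv_eq_some]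
  exact exists_congr fun c => and_congr_right fun _ => and_comm

theorem star_mem_wordSpan (hid : S.IdemZero) (hS : S.FinitelyAligned) {p q : T → T → Prop}
    (h : ∀ s t, p s t → q t s) {x : S.FreeAlg} (hx : x ∈ S.wordSpan p) : star x ∈ S.wordSpan q := by
  induction hx using Submodule.span_induction with
  | mem x hx =>
    obtain ⟨s, l, t, hp, rfl⟩ := hx
    rw [star_word hid hS]
    exact word_mem_wordSpan l (h s t hp)
  | zero => rw [star_zero]; exact Submodule.zero_mem _
  | add x y _ _ hx hy => rw [star_add]; exact Submodule.add_mem _ hx hy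
  | smul c x _ hx => rw [star_smul]; exact Submodule.smul_mem _ _ hx

theorem mul_mem_span {M M' N : Set S.FreeAlg} (h : ∀ a ∈ M, ∀ b ∈ M', a * b ∈ Submodule.span ℂ N)
    {x y : S.FreeAlg} (hx : x ∈ Submodule.span ℂ M) (hy : y ∈ Submodule.span ℂ M') :
    x * y ∈ Submodule.span ℂ N := by
  induction hx using Submodule.span_induction with
  | mem x hx =>
    induction hy using Submodule.span_induction with
    | mem y hy => exact h x hx y hy
    | zero => rw [mul_zero]; exact Submodule.zero_mem _
    | add y z _ _ hy hz => rw [mul_add]; exact Submodule.add_mem _ hy hz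
    | smul c y _ hy => rw [mul_smul_comm]; exact Submodule.smul_mem _ _ hy
  | zero => rw [zero_mul]; exact Submodule.zero_mem _
  | add x z _ _ hx hz => rw [add_mul]; exact Submodule.add_mem _ hx hz
  | smul c x _ hx => rw [smul_mul_assoc]; exact Submodule.smul_mem _ _ hx

theorem mul_mem_wordSpan (hid : S.IdemZero) (hS : S.FinitelyAligned) {p q r : T → T → Prop}
    (h : ∀ s t s' t' a b, p s t → q s' t' → S.ProdRel s t s' t' a b → r a b) {x y : S.FreeAlg}
    (hx : x ∈ S.wordSpan p) (hy : y ∈ S.wordSpan q) : x * y ∈ S.wordSpan r := by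
  refine mul_mem_span ?_ hx hy
  rintro _ ⟨s, l, t, hp, rfl⟩ _ ⟨s', l', t', hq, rfl⟩
  exact wordSpan_mono (fun a b => h s t s' t' a b hp hq) (word_mul_word hid hS s t s' t' l l')

/-- Decomposition into components. -/
theorem exists_eq_sum_of_mem_wordSpan {G : Type*} {p : G → T → T → Prop} {F : Finset G}
    {x : S.FreeAlg} (hx : x ∈ S.wordSpan fun s t => ∃ g ∈ F, p g s t) :
    ∃ f : G → S.FreeAlg, (∀ g, f g ∈ S.wordSpan (p g)) ∧ x = ∑ g ∈ F, f g := by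
  induction hx using Submodule.span_induction with
  | mem x hx =>
    obtain ⟨s, l, t, ⟨g, hg, hp⟩, rfl⟩ := hx
    refine ⟨fun g' => if g' = g then S.word s l t else 0, fun g' => ?_, ?_⟩
    · by_cases h : g' = g
      · subst h
        simp only [if_true]
        exact word_mem_wordSpan l hp
      · simp only [if_neg h]
        exact Submodule.zero_mem _
    · rw [Finset.sum_ite_eq', if_pos hg]
  | zero => exact ⟨0, fun g => Submodule.zero_mem _, by simp⟩
  | add x y _ _ hx hy =>
    obtain ⟨f, hf, rfl⟩ := hx
    obtain ⟨f', hf', rfl⟩ := hy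
    exact ⟨f + f', fun g => Submodule.add_mem _ (hf g) (hf' g), Finset.sum_add_distrib.symm⟩
  | smul c x _ hx =>
    obtain ⟨f, hf, rfl⟩ := hx
    exact ⟨c • f, fun g => Submodule.smul_mem _ _ (hf g), Finset.smul_sum⟩

variable (S) in
/-- The span of the words `s p t*` with `d(s) = d(t) = n`. -/
abbrev coreAt (n : k → ℕ) : Submodule ℂ S.FreeAlg := S.wordSpan fun s t => S.d s = n ∧ S.d t = n

variable (S) in
/-- The projection onto the points of a given degree. -/
def degOp (n : k → ℕ) : Ell2 S.TailPts →L[ℂ] Ell2 S.TailPts := indicatorOp {p | S.d p.1.2 = n}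

/-- On a finite-dimensional space, any linear map factors through the injective L, and the factor is
automatically bounded. -/
theorem exists_norm_le_of_injective {V W A : Type*} [AddCommGroup V] [Module ℂ V]
    [FiniteDimensional ℂ V] [NormedAddCommGroup W] [NormedSpace ℂ W] [NormedAddCommGroup A]
    [NormedSpace ℂ A] (L : V →ₗ[ℂ] W) (hL : Function.Injective L) (f : V →ₗ[ℂ] A) :
    ∃ C : ℝ, ∀ v, ‖f v‖ ≤ C * ‖L v‖ := by
  let e := LinearEquiv.ofInjective L hL
  let B : LinearMap.range L →L[ℂ] A := LinearMap.toContinuousLinearMap (f ∘ₗ e.symm.toLinearMap)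
  refine ⟨‖B‖, fun v => ?_⟩
  have h1 := B.le_opNorm (e v)
  have h2 : B (e v) = f v := congrArg f (e.symm_apply_apply v)
  rw [h2] at h1
  exact h1

section Core

variable (hid : S.IdemZero) (hS : S.FinitelyAligned)

/-- The words of degree `(n, n)` formed from a finite set. -/
def finWords (S : Semigraph k T) (n : k → ℕ) (F : Finset T) : Set S.FreeAlg :=
  {w | ∃ s ∈ F, ∃ t ∈ F, ∃ l : List T, (∀ r ∈ l, r ∈ F) ∧ S.d s = n ∧ S.d t = n ∧ S.word s l t = w}

theorem finWords_mono {n : k → ℕ} {F F' : Finset T} (h : F ⊆ F') :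
    S.finWords n F ⊆ S.finWords n F' := by
  rintro _ ⟨s, hs, t, ht, l, hl, hns, hnt, rfl⟩
  exact ⟨s, h hs, t, h ht, l, fun r hr => h (hl r hr), hns, hnt, rfl⟩

theorem span_finWords_le (n : k → ℕ) (F : Finset T) :
    Submodule.span ℂ (S.finWords n F) ≤ S.coreAt n := by
  refine Submodule.span_mono ?_
  rintro _ ⟨s, hs, t, ht, l, hl, hns, hnt, rfl⟩
  exact ⟨s, l, t, ⟨hns, hnt⟩, rfl⟩

theorem exists_finWords {n : k → ℕ} {x : S.FreeAlg} (hx : x ∈ S.coreAt n) :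
    ∃ F : Finset T, x ∈ Submodule.span ℂ (S.finWords n F) := by
  induction hx using Submodule.span_induction with
  | mem x hx =>
    obtain ⟨s, l, t, ⟨hs, ht⟩, rfl⟩ := hx
    refine ⟨insert s (insert t l.toFinset), Submodule.subset_span
      ⟨s, by simp, t, by simp, l, fun r hr => by simp [hr], hs, ht, rfl⟩⟩
  | zero => exact ⟨∅, Submodule.zero_mem _⟩
  | add x y _ _ hx hy =>
    obtain ⟨F, hF⟩ := hx
    obtain ⟨F', hF'⟩ := hy
    exact ⟨F ∪ F', Submodule.add_mem _
      (Submodule.span_mono (finWords_mono Finset.subset_union_left) hF)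
      (Submodule.span_mono (finWords_mono Finset.subset_union_right) hF')⟩
  | smul c x _ hx =>
    obtain ⟨F, hF⟩ := hx
    exact ⟨F, Submodule.smul_mem _ _ hF⟩

include hid hS

/-- Only the set of letters in the list matters, since source projections commute and are
idempotent. -/
theorem finWords_finite (n : k → ℕ) (F : Finset T) : (S.finWords n F).Finite := by
  refine (((F ×ˢ F) ×ˢ F.powerset).finite_toSet.image
    fun c => S.word c.1.1 c.2.toList c.1.2).subset ?_
  rintro _ ⟨s, hs, t, ht, l, hl, -, -, rfl⟩
  refine ⟨((s, t), l.toFinset), Finset.mem_coe.2 (Finset.mem_product.2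
    ⟨Finset.mem_product.2 ⟨hs, ht⟩, Finset.mem_powerset.2 fun r hr =>
      hl r (List.mem_toFinset.1 hr)⟩), ?_⟩
  refine eq_of_rep_eq hid hS ?_
  rw [PartialAction.rep_word, PartialAction.rep_word]
  congr 1
  ext u v
  rw [PartialAction.wordPEquiv_eq_some, PartialAction.wordPEquiv_eq_some]
  simp [PartialAction.dom]

/-- Between letters of equal degree t*s' is zero unless t = s', and then it is Q_t. No new letters
arise, so the span is a finite-dimensional *-algebra. -/
theorem mul_mem_span_finWords {n : k → ℕ} {F : Finset T} {x y : S.FreeAlg}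
    (hx : x ∈ Submodule.span ℂ (S.finWords n F)) (hy : y ∈ Submodule.span ℂ (S.finWords n F)) :
    x * y ∈ Submodule.span ℂ (S.finWords n F) := by
  refine mul_mem_span ?_ hx hy
  rintro _ ⟨s, hs, t, ht, l, hl, hns, hnt, rfl⟩ _ ⟨s', hs', t', ht', l', hl', hns', hnt', rfl⟩
  by_cases h : t = s'
  · subst h
    refine Submodule.subset_span ⟨s, hs, t', ht', l ++ t :: l', ?_, hns, hnt', ?_⟩
    · intro r hr
      simp only [List.mem_append, List.mem_cons] at hr
      rcases hr with hr | rfl | hr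
      · exact hl r hr
      · exact ht
      · exact hl' r hr
    · rw [word, word, word, mul_assoc, qm_mul, qm_append, qm_cons, Q'_def, ← mul_assoc (star _)]
  · have h0 : S.word s l t * S.word s' l' t' = 0 := by
      refine eq_of_rep_eq hid hS ?_
      rw [map_mul, PartialAction.rep_word, PartialAction.rep_word, map_zero, ← shiftOp_trans,
        ← shiftOp_bot]
      congr 1
      ext u v
      rw [PEquiv.trans_eq_some]
      simp only [PartialAction.wordPEquiv_eq_some]
      constructor
      · rintro ⟨w, ⟨c, _, _, h1⟩, c', _, h2, _⟩
        exact absurd ((tailAction hid).unique _ _ _ _ _ h2 h1 (hnt.trans hns'.symm)) h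
      · rintro ⟨⟩
    rw [h0]
    exact Submodule.zero_mem _

theorem star_mem_span_finWords {n : k → ℕ} {F : Finset T} {x : S.FreeAlg}
    (hx : x ∈ Submodule.span ℂ (S.finWords n F)) : star x ∈ Submodule.span ℂ (S.finWords n F) := by
  induction hx using Submodule.span_induction with
  | mem x hx =>
    obtain ⟨s, hs, t, ht, l, hl, hns, hnt, rfl⟩ := hx
    rw [star_word hid hS]
    exact Submodule.subset_span ⟨t, ht, s, hs, l, hl, hnt, hns, rfl⟩
  | zero => rw [star_zero]; exact Submodule.zero_mem _
  | add x y _ _ hx hy => rw [star_add]; exact Submodule.add_mem _ hx hy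
  | smul c x _ hx => rw [star_smul]; exact Submodule.smul_mem _ _ hx

omit hS

/-- The core preserves degrees. -/
theorem degOp_comm {x : S.FreeAlg} (hx : x ∈ S.wordSpan fun s t => S.d s = S.d t) (n : k → ℕ) :
    degOp S n * (tailAction hid).rep x = (tailAction hid).rep x * degOp S n := by
  have h : (tailAction hid).rep x ∈ coeffIn fun u v : S.TailPts => S.d v.1.2 = S.d u.1.2 := by
    refine rep_mem_coeffIn hid ?_ hx
    intro s l t u v hst h
    obtain ⟨c, _, h1, h2⟩ := (tailAction hid).wordPEquiv_eq_some.1 h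
    rw [S.d_mul _ _ _ (tailAct_eq_some.1 h1).1, S.d_mul _ _ _ (tailAct_eq_some.1 h2).1, hst]
  refine ext_delta fun v => ?_
  ext u
  change indicatorOp _ ((tailAction hid).rep x (delta v)) u =
    (tailAction hid).rep x (indicatorOp _ (delta v)) u
  rw [indicatorOp_apply, indicatorOp_delta]
  by_cases h0 : (tailAction hid).rep x (delta v) u = 0
  · rw [h0, ite_self]
    split_ifs
    · exact h0.symm
    · rw [map_zero]; rfl
  · have := h u v h0
    by_cases hv : S.d v.1.2 = n
    · rw [if_pos (show u ∈ {p : S.TailPts | S.d p.1.2 = n} from this.trans hv),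
        if_pos (show v ∈ {p : S.TailPts | S.d p.1.2 = n} from hv)]
    · rw [if_neg (show u ∉ {p : S.TailPts | S.d p.1.2 = n} from fun h => hv (this.symm.trans h)),
        if_neg (show v ∉ {p : S.TailPts | S.d p.1.2 = n} from hv), map_zero]
      rfl

omit hid in
theorem degOp_mul_self (n : k → ℕ) : degOp S n * degOp S n = degOp S n := by
  rw [degOp, indicatorOp_mul, Set.inter_self]

include hS

/-- Any representation is dominated on `coreAt n` by the action on the points of degree `n`. -/
theorem norm_le_of_mem_coreAt {A : Type*} [NonUnitalCStarAlgebra A] (ψ : S.FreeAlg →⋆ₙₐ[ℂ] A)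
    {n : k → ℕ} {x : S.FreeAlg} (hx : x ∈ S.coreAt n) :
    ‖ψ x‖ ≤ ‖(tailAction hid).rep x * degOp S n‖ := by
  set Λ := (tailAction hid).rep
  obtain ⟨F, hF⟩ := exists_finWords hx
  set V := Submodule.span ℂ (S.finWords n F)
  have hfin : FiniteDimensional ℂ V := FiniteDimensional.span_of_finite ℂ (finWords_finite hid hS n F)
  let L : V →ₗ[ℂ] (Ell2 S.TailPts →L[ℂ] Ell2 S.TailPts) :=
    (LinearMap.mulRight ℂ (degOp S n)) ∘ₗ (Λ : S.FreeAlg →ₗ[ℂ] _) ∘ₗ V.subtype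
  have hL : ∀ v : V, L v = Λ v * degOp S n := fun v => rfl
  have hcore : ∀ x ∈ V, x ∈ S.wordSpan fun s t => S.d s = S.d t := fun x hx =>
    wordSpan_mono (fun s t h => h.1.trans h.2.symm) (span_finWords_le n F hx)
  -- The nonzero coefficient supplied by the triangularity argument starts at a point (R, t) with
  -- d(t) = n, so it survives the restriction to points of degree n.
  have hinj : Function.Injective L := by
    refine (injective_iff_map_eq_zero L).2 fun v hv => ?_
    by_contra hne
    obtain ⟨κ, hκ, h⟩ := exists_coeff_ne_zero hid (span_finWords_le n F v.2)
      (fun h => hne (Subtype.ext h))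
    refine h ?_
    have h1 := DFunLike.congr_fun hv (delta ⟨(κ.tails, κ.t), κ.t_mem⟩)
    rw [hL] at h1
    change Λ v (indicatorOp _ _) = 0 at h1
    rw [indicatorOp_delta, if_pos (show _ ∈ {p : S.TailPts | S.d p.1.2 = n} from hκ.2)] at h1
    change Λ v _ _ = 0
    rw [h1]
    rfl
  obtain ⟨C, hC⟩ := exists_norm_le_of_injective L hinj
    (f := { toFun := fun v => ψ v, map_add' := fun v w => map_add ψ (v : S.FreeAlg) w,
            map_smul' := fun c v => map_smul ψ c (v : S.FreeAlg) })
  have hB : ∀ v ∈ V, ‖ψ v‖ ≤ C * ‖Λ v * degOp S n‖ := fun v hv => hC ⟨v, hv⟩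
  have hyV : ∀ j, iterSq x j ∈ V := by
    intro j
    induction j with
    | zero => exact mul_mem_span_finWords hid hS (star_mem_span_finWords hid hS hF) hF
    | succ j ih => exact mul_mem_span_finWords hid hS ih ih
  -- Elements of the core commute with the projection onto degree n, so the restricted operator norm
  -- is a C⋆-seminorm and iterated squares apply. The comparison factor is constant, hence exponent
  -- zero below.
  have hE : ∀ z ∈ V, ‖Λ (star z * z) * degOp S n‖ = ‖Λ z * degOp S n‖ ^ 2 := by
    intro z hz
    have h1 : star (Λ z * degOp S n) * (Λ z * degOp S n) = Λ (star z * z) * degOp S n := by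
      have h2 := degOp_comm hid (hcore z hz) n
      have h3 := degOp_comm hid (hcore _ (star_mem_span_finWords hid hS hz)) n
      rw [star_mul, degOp, star_indicatorOp, ← degOp, ← map_star, h3, mul_assoc,
        ← mul_assoc (degOp S n), h2, mul_assoc (Λ z), degOp_mul_self, ← mul_assoc, map_mul]
    rw [← h1, pow_two]
    exact norm_star_mul_op _
  refine norm_le_of_iterSq ψ (fun z => ‖Λ z * degOp S n‖) x (fun _ => norm_nonneg _) (hE x hF)
    (fun j => ?_) (K := C) (E := 0) fun j => ?_
  · have := hE _ (hyV j)
    rwa [star_iterSq] at this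
  · rw [pow_zero, mul_one]
    exact hB _ (hyV j)

end Core

end Semigraph

/-- The partial injection with a given graph. -/
def PEquiv.ofRel {Ω : Type u} (r : Ω → Ω → Prop) (h₁ : ∀ a b b', r a b → r a b' → b = b')
    (h₂ : ∀ a a' b, r a b → r a' b → a = a') : Ω ≃. Ω where
  toFun a := if h : ∃ b, r a b then some h.choose else none
  invFun b := if h : ∃ a, r a b then some h.choose else none
  inv a b := by
    have h3 : (if h : ∃ b, r a b then some h.choose else none) = some b ↔ r a b := by
      split_ifs with h
      · rw [Option.some.injEq]
        exact ⟨fun h' => h' ▸ h.choose_spec, fun h' => h₁ _ _ _ h.choose_spec h'⟩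
      · simpa using fun h' => h ⟨b, h'⟩
    have h4 : (if h : ∃ a, r a b then some h.choose else none) = some a ↔ r a b := by
      split_ifs with h
      · rw [Option.some.injEq]
        exact ⟨fun h' => h' ▸ h.choose_spec, fun h' => h₂ _ _ _ h.choose_spec h'⟩
      · simpa using fun h' => h ⟨a, h'⟩
    exact h4.trans h3.symm

theorem PEquiv.ofRel_eq_some {Ω : Type u} {r : Ω → Ω → Prop}
    {h₁ : ∀ a b b', r a b → r a b' → b = b'} {h₂ : ∀ a a' b, r a b → r a' b → a = a'} {a b : Ω} :
    PEquiv.ofRel r h₁ h₂ a = some b ↔ r a b := by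
  change (if h : ∃ b, r a b then some h.choose else none) = some b ↔ r a b
  split_ifs with h
  · rw [Option.some.injEq]
    exact ⟨fun h' => h' ▸ h.choose_spec, fun h' => h₁ _ _ _ h.choose_spec h'⟩
  · simpa using fun h' => h ⟨b, h'⟩

namespace Semigraph

variable {k : Type v} {T : Type u} {S : Semigraph k T}

/-! ### Translations of points and bounded separation of core components -/

section Translation

variable (hid : S.IdemZero)

/-- The translation `(R_h, y) ↦ (R, y h)`, where `R_h` consists of all `y` with `y h ∈ R`. -/
def translation (R : S.TailSet) {h : T} (hh : h ∈ R.carrier) : S.TailPts ≃. S.TailPts :=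
  PEquiv.ofRel (fun p q => p.1.1 = R.comap hid hh ∧ q.1.1 = R ∧ S.mul p.1.2 h = some q.1.2)
    (fun _ _ _ h₁ h₂ => Subtype.ext (Prod.ext (h₁.2.1.trans h₂.2.1.symm)
      (Option.some.inj (h₁.2.2.symm.trans h₂.2.2))))
    (fun _ _ _ h₁ h₂ => Subtype.ext (Prod.ext (h₁.1.trans h₂.1.symm)
      (S.mul_right_cancel h₁.2.2 h₂.2.2)))

theorem translation_eq_some {R : S.TailSet} {h : T} {hh : h ∈ R.carrier} {p q : S.TailPts} :
    translation hid R hh p = some q ↔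
      p.1.1 = R.comap hid hh ∧ q.1.1 = R ∧ S.mul p.1.2 h = some q.1.2 := PEquiv.ofRel_eq_some

/-- Words of degree `(n, n)` commute with translations of points of degree `n`. -/
theorem wordPEquiv_translation {R : S.TailSet} {h y u s t : T} {l : List T} {hh : h ∈ R.carrier}
    {hu : u ∈ R.carrier} (hy : S.mul y h = some u) (hty : S.d t = S.d y) :
    (tailAction hid).wordPEquiv s l t ⟨(R, u), hu⟩ =
      ((tailAction hid).wordPEquiv s l t ⟨(R.comap hid hh, y), ⟨u, hu, hy⟩⟩).bind
        (translation hid R hh) := by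
  ext v
  rw [Option.bind_eq_some_iff, PartialAction.wordPEquiv_eq_some]
  constructor
  · rintro ⟨⟨⟨R', c⟩, hc⟩, hl, h1, h2⟩
    obtain ⟨h3, h4⟩ := tailAct_eq_some.1 h1
    obtain ⟨h5, h6⟩ := tailAct_eq_some.1 h2
    clear h1 h2
    simp only at h3 h4 h5 h6
    subst h4
    obtain ⟨rfl, rfl⟩ := S.factor_unique h3 hy hty
    have hl' := (mem_dom_tail hid).1 hl
    have hroot : ∀ r z, S.mul r c = some z → S.mul r (S.rng c) = some r := fun r z hz => by
      rw [← hid.src_eq_rng hz]; exact hid.mul_src r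
    have hsR : s ∈ (R.comap hid hh).carrier := ⟨v.1.2, h6 ▸ v.2, h5⟩
    refine ⟨⟨(R.comap hid hh, s), hsR⟩, ?_, ?_⟩
    · rw [PartialAction.wordPEquiv_eq_some]
      refine ⟨(R.comap hid hh).basePt, basePt_mem_dom.2 fun r hr => ?_, ?_, ?_⟩
      · obtain ⟨z, hz, hz'⟩ := hl' r hr
        exact ⟨z, hz, hz'⟩
      · exact tailAct_eq_some.2 ⟨hroot _ _ h3, rfl⟩
      · exact tailAct_eq_some.2 ⟨hroot _ _ h5, rfl⟩
    · exact (translation_eq_some hid).2 ⟨rfl, h6, h5⟩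
  · rintro ⟨w, hw, hwv⟩
    obtain ⟨⟨⟨R', c⟩, hc⟩, hl, h1, h2⟩ := (tailAction hid).wordPEquiv_eq_some.1 hw
    obtain ⟨h3, h4⟩ := tailAct_eq_some.1 h1
    obtain ⟨h5, h6⟩ := tailAct_eq_some.1 h2
    obtain ⟨-, h7, h8⟩ := (translation_eq_some hid).1 hwv
    clear h1 h2
    simp only at h3 h4 h5 h6
    subst h4
    have hc0 : S.d c = 0 := d_eq_zero_of_mul_right h3 hty.symm
    obtain ⟨hyt, -⟩ := hid.eq_of_mul_zero h3 hc0
    obtain ⟨hws, -⟩ := hid.eq_of_mul_zero h5 hc0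
    have hl' := (mem_dom_tail hid).1 hl
    refine ⟨⟨(R, h), hh⟩, (mem_dom_tail hid).2 fun r hr => ?_, ?_, ?_⟩
    · obtain ⟨z, ⟨a, ha, ha'⟩, hz'⟩ := hl' r hr
      rw [(hid.eq_of_mul_zero hz' hc0).1] at ha'
      exact ⟨a, ha, ha'⟩
    · exact tailAct_eq_some.2 ⟨by rw [← hyt]; exact hy, rfl⟩
    · exact tailAct_eq_some.2 ⟨by rw [← hws]; exact h8, h7⟩

/-- A point (R, yh) with d(y) = n is the translate of the degree-n point (R_h, y), and words with
both degrees n act only on the left factor y. So x acts on the two points alike. -/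
theorem rep_coreAt_translation {n : k → ℕ} {x : S.FreeAlg} (hx : x ∈ S.coreAt n) {R : S.TailSet}
    {h y u : T} (hh : h ∈ R.carrier) (hu : u ∈ R.carrier) (hy : S.mul y h = some u)
    (hyn : S.d y = n) :
    (tailAction hid).rep x (delta ⟨(R, u), hu⟩) =
      (shiftOp (translation hid R hh) * ((tailAction hid).rep x * degOp S n) *
        star (shiftOp (translation hid R hh))) (delta ⟨(R, u), hu⟩) := by
  set p : S.TailPts := ⟨(R.comap hid hh, y), ⟨u, hu, hy⟩⟩
  have hp : translation hid R hh p = some ⟨(R, u), hu⟩ :=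
    (translation_eq_some hid).2 ⟨rfl, rfl, hy⟩
  have h1 : star (shiftOp (translation hid R hh)) (delta ⟨(R, u), hu⟩) = delta p := by
    rw [star_shiftOp]
    exact shiftOp_delta_some (PEquiv.eq_some_iff _ |>.2 hp)
  have h2 : degOp S n (delta p) = delta p := by
    rw [degOp, indicatorOp_delta, if_pos (show p ∈ {p : S.TailPts | S.d p.1.2 = n} from hyn)]
  change _ = shiftOp _ ((tailAction hid).rep x (degOp S n (star (shiftOp _) (delta _))))
  rw [h1, h2]
  induction hx using Submodule.span_induction with
  | mem x hx =>
    obtain ⟨s, l, t, ⟨hs, ht⟩, rfl⟩ := hx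
    rw [PartialAction.rep_word, shiftOp_delta, shiftOp_delta,
      wordPEquiv_translation hid (hh := hh) hy (ht.trans hyn.symm)]
    rcases (tailAction hid).wordPEquiv s l t p with _ | w
    · rw [Option.elim_none, map_zero]; rfl
    · rw [Option.elim_some, shiftOp_delta]; rfl
  | zero => rw [map_zero]; exact (map_zero _).symm
  | add x x' _ _ hx hx' =>
    rw [map_add]
    exact (congrArg₂ (· + ·) hx hx').trans (map_add _ _ _).symm
  | smul c x _ hx =>
    rw [map_smul]
    exact (congrArg (c • ·) hx).trans (map_smul _ _ _).symm

/-- The norm of an element of `coreAt n` is determined by its action on points of degree `n`. -/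
theorem norm_rep_le_of_mem_coreAt {n : k → ℕ} {x : S.FreeAlg} (hx : x ∈ S.coreAt n) :
    ‖(tailAction hid).rep x‖ ≤ ‖(tailAction hid).rep x * degOp S n‖ := by
  -- The label of (R, u) is the set of pairs (R, h) for which u = yh with d(y) = n. It is a
  -- singleton if such a factorization exists and empty otherwise; x preserves labels and
  -- annihilates points with empty label.
  let κ : S.TailPts → Set (S.TailSet × T) := fun v =>
    {i | i.1 = v.1.1 ∧ ∃ y, S.mul y i.2 = some v.1.2 ∧ S.d y = n}
  have hκ : (tailAction hid).rep x ∈ coeffIn fun v u => κ u = κ v ∧ (κ v).Nonempty := by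
    refine rep_mem_coeffIn hid ?_ hx
    rintro s l t u v ⟨hs, ht⟩ h
    obtain ⟨c, _, h1, h2⟩ := (tailAction hid).wordPEquiv_eq_some.1 h
    have h3 := tailAct_eq_some.1 h1
    have h4 := tailAct_eq_some.1 h2
    have hsing : ∀ (w : S.TailPts) (r : T), S.d r = n → S.mul r c.1.2 = some w.1.2 →
        w.1.1 = c.1.1 → κ w = {(c.1.1, c.1.2)} := by
      intro w r hr hrw hwc
      ext ⟨R, h⟩
      constructor
      · rintro ⟨h5, y, h6, h7⟩
        rw [Set.mem_singleton_iff]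
        exact Prod.ext (h5.trans hwc) (S.factor_unique h6 hrw (h7.trans hr.symm)).2
      · rintro ⟨⟩
        exact ⟨hwc.symm, r, hrw, hr⟩
    rw [hsing u t ht h3.1 h3.2, hsing v s hs h4.1 h4.2]
    exact ⟨rfl, Set.singleton_nonempty _⟩
  refine norm_le_of_blocks _ κ κ (norm_nonneg _) (fun u v h => (hκ u v h).1) fun i ξ hξ => ?_
  rcases Set.eq_empty_or_nonempty i with rfl | ⟨⟨R, h⟩, hi⟩
  · have : (tailAction hid).rep x ξ = 0 := by
      induction hξ using Submodule.span_induction with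
      | mem ξ h =>
        obtain ⟨v, hv, rfl⟩ := h
        ext u
        by_contra hne
        have := (hκ u v hne).2
        rw [show κ v = ∅ from hv] at this
        exact Set.not_nonempty_empty this
      | zero => exact map_zero _
      | add ξ η _ _ h1 h2 => rw [map_add, h1, h2, add_zero]
      | smul c ξ _ h1 => rw [map_smul, h1, smul_zero]
    rw [this, norm_zero]
    positivity
  -- A label whose h is not in R belongs to no point, since tail sets contain their right factors.
  by_cases hh : h ∈ R.carrier
  swap
  · have : {v | κ v = i} = ∅ := by
      rw [Set.eq_empty_iff_forall_notMem]
      rintro v rfl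
      obtain ⟨h1, y, h2, _⟩ := hi
      exact hh (R.tail _ _ _ h2 (by rw [show R = v.1.1 from h1]; exact v.2))
    rw [this, Set.image_empty, Submodule.span_empty, Submodule.mem_bot] at hξ
    rw [hξ, map_zero, norm_zero, mul_zero]
  set g := shiftOp (translation hid R hh)
  have heq : (tailAction hid).rep x ξ =
      (g * ((tailAction hid).rep x * degOp S n) * star g) ξ := by
    induction hξ using Submodule.span_induction with
    | mem ξ h =>
      obtain ⟨⟨⟨R', u⟩, hu⟩, rfl, rfl⟩ := h
      obtain ⟨h1, y, h2, h3⟩ := hi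
      simp only at h1 h2
      subst h1
      exact rep_coreAt_translation hid hx hh hu h2 h3
    | zero => rw [map_zero, map_zero]
    | add ξ η _ _ h1 h2 => rw [map_add, map_add, h1, h2]
    | smul c ξ _ h1 => rw [map_smul, map_smul, h1]
  rw [heq]
  calc ‖g (((tailAction hid).rep x * degOp S n) (star g ξ))‖
      ≤ ‖((tailAction hid).rep x * degOp S n) (star g ξ)‖ := norm_shiftOp_apply_le _ _
    _ ≤ ‖(tailAction hid).rep x * degOp S n‖ * ‖star g ξ‖ := ContinuousLinearMap.le_opNorm _ _
    _ ≤ ‖(tailAction hid).rep x * degOp S n‖ * ‖ξ‖ := by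
      refine mul_le_mul_of_nonneg_left ?_ (norm_nonneg _)
      rw [star_shiftOp]
      exact norm_shiftOp_apply_le _ _

/-- A word with d(t) = m needs t as a left factor of the point, so it kills points whose degree is
not at least m. -/
theorem rep_mul_degOp_eq_zero {m n : k → ℕ} {x : S.FreeAlg} (hx : x ∈ S.coreAt m) (h : ¬ m ≤ n) :
    (tailAction hid).rep x * degOp S n = 0 := by
  have hc : (tailAction hid).rep x ∈ coeffIn fun v _ : S.TailPts => m ≤ S.d v.1.2 := by
    refine rep_mem_coeffIn hid ?_ hx
    rintro s l t u v ⟨hs, ht⟩ h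
    obtain ⟨c, _, h1, _⟩ := (tailAction hid).wordPEquiv_eq_some.1 h
    rw [S.d_mul _ _ _ (tailAct_eq_some.1 h1).1, ht]
    exact le_self_add
  refine ext_delta fun v => ?_
  change (tailAction hid).rep x (indicatorOp _ (delta v)) = 0
  rw [indicatorOp_delta]
  split_ifs with hv
  · ext u
    by_contra hne
    have h' : m ≤ S.d v.1.2 := hc u v hne
    rw [show S.d v.1.2 = n from hv] at h'
    exact h h'
  · exact map_zero _

/-- Induction along the order of degrees. On points of degree n only components m ≤ n act; those
with m < n are already controlled, and the norm of the n-th component is attained there. The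
constant depends on N but not on the element. -/
theorem exists_norm_component_le (N : Finset (k → ℕ)) (n : N) : ∃ C : ℝ, 0 ≤ C ∧
    ∀ f : (k → ℕ) → S.FreeAlg, (∀ m, f m ∈ S.coreAt m) →
      ‖(tailAction hid).rep (f n)‖ ≤ C * ‖(tailAction hid).rep (∑ m ∈ N, f m)‖ := by
  induction n using WellFoundedLT.induction with
  | ind n ih =>
  have ih' : ∀ m : N, ∃ C : ℝ, 0 ≤ C ∧ (m < n → ∀ f : (k → ℕ) → S.FreeAlg,
      (∀ m, f m ∈ S.coreAt m) →
      ‖(tailAction hid).rep (f m)‖ ≤ C * ‖(tailAction hid).rep (∑ m ∈ N, f m)‖) := by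
    intro m
    by_cases h : m < n
    · obtain ⟨C, h1, h2⟩ := ih m h
      exact ⟨C, h1, fun _ => h2⟩
    · exact ⟨0, le_rfl, fun h' => absurd h' h⟩
  choose C hC0 hC using ih'
  refine ⟨1 + ∑ m, C m, add_nonneg zero_le_one (Finset.sum_nonneg fun m _ => hC0 m),
    fun f hf => ?_⟩
  set Λ := (tailAction hid).rep
  have hE : ‖degOp S n.1‖ ≤ 1 := norm_shiftOp_le _
  have hmulE : ∀ x, ‖Λ x * degOp S n.1‖ ≤ ‖Λ x‖ := fun x =>
    (norm_mul_le _ _).trans (mul_le_of_le_one_right (norm_nonneg _) hE)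
  have hsum : Λ (∑ m ∈ N, f m) * degOp S n.1 = Λ (f n) * degOp S n.1 +
      ∑ m ∈ Finset.univ.erase n, Λ (f m) * degOp S n.1 := by
    rw [Finset.add_sum_erase _ (fun m : N => Λ (f m) * degOp S n.1) (Finset.mem_univ n),
      map_sum, Finset.sum_mul, ← Finset.sum_coe_sort]
  have hterm : ∀ m ∈ Finset.univ.erase n, ‖Λ (f m) * degOp S n.1‖ ≤
      C m * ‖Λ (∑ m ∈ N, f m)‖ := by
    intro m hm
    by_cases hmn : m.1 ≤ n.1
    · refine (hmulE _).trans (hC m (lt_of_le_of_ne hmn (Finset.ne_of_mem_erase hm)) f hf)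
    · rw [rep_mul_degOp_eq_zero hid (hf m) hmn, norm_zero]
      exact mul_nonneg (hC0 m) (norm_nonneg _)
  calc ‖Λ (f n)‖ ≤ ‖Λ (f n) * degOp S n.1‖ := norm_rep_le_of_mem_coreAt hid (hf n)
    _ = ‖Λ (∑ m ∈ N, f m) * degOp S n.1 - ∑ m ∈ Finset.univ.erase n, Λ (f m) * degOp S n.1‖ := by
      rw [hsum, add_sub_cancel_right]
    _ ≤ ‖Λ (∑ m ∈ N, f m)‖ + ∑ m ∈ Finset.univ.erase n, C m * ‖Λ (∑ m ∈ N, f m)‖ :=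
      (norm_sub_le _ _).trans (add_le_add (hmulE _)
        ((norm_sum_le _ _).trans (Finset.sum_le_sum hterm)))
    _ ≤ ‖Λ (∑ m ∈ N, f m)‖ + ∑ m, C m * ‖Λ (∑ m ∈ N, f m)‖ :=
      add_le_add le_rfl (Finset.sum_le_sum_of_subset_of_nonneg (Finset.erase_subset _ _)
        fun m _ _ => mul_nonneg (hC0 m) (norm_nonneg _))
    _ = (1 + ∑ m, C m) * ‖Λ (∑ m ∈ N, f m)‖ := by rw [add_mul, one_mul, Finset.sum_mul]

end Translation

/-! ### Domination of arbitrary representations on the core -/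

section Upper

variable (hid : S.IdemZero) (hS : S.FinitelyAligned) {A : Type*} [NonUnitalCStarAlgebra A]
  (ψ : S.FreeAlg →⋆ₙₐ[ℂ] A)

theorem exists_finset_of_mem_wordSpan {p : T → T → Prop} {x : S.FreeAlg} (hx : x ∈ S.wordSpan p) :
    ∃ F : Finset (T × T), x ∈ S.wordSpan fun s t => p s t ∧ (s, t) ∈ F := by
  induction hx using Submodule.span_induction with
  | mem x hx =>
    obtain ⟨s, l, t, h, rfl⟩ := hx
    exact ⟨{(s, t)}, word_mem_wordSpan l ⟨h, Finset.mem_singleton_self _⟩⟩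
  | zero => exact ⟨∅, Submodule.zero_mem _⟩
  | add x y _ _ hx hy =>
    obtain ⟨F, hF⟩ := hx
    obtain ⟨F', hF'⟩ := hy
    exact ⟨F ∪ F', Submodule.add_mem _
      (wordSpan_mono (fun s t h => ⟨h.1, Finset.mem_union_left _ h.2⟩) hF)
      (wordSpan_mono (fun s t h => ⟨h.1, Finset.mem_union_right _ h.2⟩) hF')⟩
  | smul c x _ hx =>
    obtain ⟨F, hF⟩ := hx
    exact ⟨F, Submodule.smul_mem _ _ hF⟩

include hid hS

/-- Any representation is dominated on the core by the representation on tail sets. -/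
theorem norm_le_of_mem_core {x : S.FreeAlg} (hx : x ∈ S.wordSpan fun s t => S.d s = S.d t) :
    ‖ψ x‖ ≤ ‖(tailAction hid).rep x‖ := by
  obtain ⟨F, hF⟩ := exists_finset_of_mem_wordSpan hx
  -- Words of degrees (m, m) and (n, n) multiply to words of degree m ∨ n. Closing the finite set of
  -- degrees under suprema keeps it finite and makes the corresponding span a *-algebra containing
  -- all iterated squares of x.
  have hfin : (supClosure ((F.image fun c => S.d c.1 : Finset (k → ℕ)) : Set (k → ℕ))).Finite :=
    (Finset.finite_toSet _).supClosure
  set N := hfin.toFinset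
  have hN : ∀ m ∈ N, ∀ n ∈ N, m ⊔ n ∈ N := by
    intro m hm n hn
    rw [Set.Finite.mem_toFinset] at hm hn ⊢
    exact supClosed_supClosure hm hn
  let p : (k → ℕ) → T → T → Prop := fun n s t => S.d s = n ∧ S.d t = n
  have hxN : x ∈ S.wordSpan fun s t => ∃ n ∈ N, p n s t := by
    refine wordSpan_mono ?_ hF
    rintro s t ⟨hst, h⟩
    refine ⟨S.d s, ?_, rfl, hst.symm⟩
    rw [Set.Finite.mem_toFinset]
    exact subset_supClosure (Finset.mem_coe.2 (Finset.mem_image_of_mem (fun c => S.d c.1) h))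
  choose C hC0 hC using exists_norm_component_le (S := S) hid N
  -- Each component is estimated without loss by its action on points of one degree; the separation
  -- of components costs a constant that is uniform on this *-algebra.
  have hbound : ∀ y ∈ S.wordSpan fun s t => ∃ n ∈ N, p n s t,
      ‖ψ y‖ ≤ (∑ n, C n) * ‖(tailAction hid).rep y‖ := by
    intro y hy
    obtain ⟨f, hf, rfl⟩ := exists_eq_sum_of_mem_wordSpan hy
    rw [map_sum, Finset.sum_mul, ← Finset.sum_coe_sort]
    refine (norm_sum_le _ _).trans (Finset.sum_le_sum fun n _ => ?_)
    refine ((norm_le_of_mem_coreAt hid hS ψ (hf n)).trans ?_).trans (hC n f hf)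
    exact (norm_mul_le _ _).trans (mul_le_of_le_one_right (norm_nonneg _) (norm_shiftOp_le _))
  have hmul : ∀ y ∈ S.wordSpan fun s t => ∃ n ∈ N, p n s t,
      ∀ z ∈ S.wordSpan fun s t => ∃ n ∈ N, p n s t,
        y * z ∈ S.wordSpan fun s t => ∃ n ∈ N, p n s t := by
    intro y hy z hz
    refine mul_mem_wordSpan hid hS ?_ hy hz
    rintro s t s' t' a b ⟨m, hm, hs, ht⟩ ⟨n, hn, hs', ht'⟩ ⟨e, f, g, h1, h2, h3, h4, h5⟩
    refine ⟨m ⊔ n, hN m hm n hn, ?_, ?_⟩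
    · rw [S.d_mul _ _ _ h4, hs, ← ht, ← S.d_mul _ _ _ h1, h3, hs']
    · rw [S.d_mul _ _ _ h5, ht', ← hs', ← S.d_mul _ _ _ h2, h3, ht]
  have hiter : ∀ j, iterSq x j ∈ S.wordSpan fun s t => ∃ n ∈ N, p n s t := by
    intro j
    induction j with
    | zero =>
      exact hmul _ (star_mem_wordSpan hid hS (fun s t ⟨n, hn, h⟩ => ⟨n, hn, h.2, h.1⟩) hxN) _ hxN
    | succ j ih => exact hmul _ ih _ ih
  have hC' : ∀ z : S.FreeAlg, ‖(tailAction hid).rep (star z * z)‖ = ‖(tailAction hid).rep z‖ ^ 2 := by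
    intro z
    rw [map_mul, map_star, norm_star_mul_op, pow_two]
  refine norm_le_of_iterSq ψ (fun z => ‖(tailAction hid).rep z‖) x (fun _ => norm_nonneg _) (hC' x)
    (fun j => ?_) (K := ∑ n, C n) (E := 0) fun j => ?_
  · have := hC' (iterSq x j)
    rwa [star_iterSq] at this
  · rw [pow_zero, mul_one]
    exact hbound _ (hiter j)

end Upper

end Semigraph

/-! ### Polynomial growth -/

section Graded

variable {Ω : Type u} {G : Type*} [AddCommGroup G] {deg : Ω → G}

/-- On vectors of degree i, the component of degree n is the whole sum cut down to degree i + n. The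
labels on the two sides of the block decomposition differ by n. -/
theorem norm_le_norm_sum_shiftBy {F : Finset G} {A : G → Ell2 Ω →L[ℂ] Ell2 Ω}
    (hA : ∀ n ∈ F, A n ∈ shiftBy deg n) {n : G} (hn : n ∈ F) : ‖A n‖ ≤ ‖∑ m ∈ F, A m‖ := by
  refine norm_le_of_blocks _ deg (fun u => deg u - n) (norm_nonneg _)
    (fun u v h => sub_eq_of_eq_add (hA n hn u v h)) fun i ξ hξ => ?_
  have : A n ξ = indicatorOp {u | deg u = i + n} ((∑ m ∈ F, A m) ξ) := by
    induction hξ using Submodule.span_induction with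
    | mem ξ h =>
      obtain ⟨v, rfl, rfl⟩ := h
      ext u
      rw [indicatorOp_apply]
      split_ifs with hu
      · exact (sum_shiftBy_apply hA hn hu).symm
      · by_contra hne
        exact hu (hA n hn u v hne)
    | zero => simp
    | add ξ η _ _ h1 h2 => rw [map_add, h1, h2, map_add, map_add]
    | smul c ξ _ h1 => rw [map_smul, h1, map_smul, map_smul]
  rw [this]
  exact (norm_shiftOp_apply_le _ _).trans (ContinuousLinearMap.le_opNorm _ _)

/-- The sums of elements of `G` in which each element occurs at most `m` times. -/
def sumsUpTo (F : Finset G) (m : ℕ) : Finset G :=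
  (Fintype.piFinset fun _ : F => Finset.range (m + 1)).image fun c => ∑ g : F, c g • (g : G)

/-- Commutativity of G enters here: a sum is determined by its multiplicities, so the count is
polynomial in m of degree |F|. -/
theorem card_sumsUpTo_le (F : Finset G) (m : ℕ) : (sumsUpTo F m).card ≤ (m + 1) ^ F.card := by
  refine Finset.card_image_le.trans ?_
  rw [Fintype.card_piFinset]
  simp

theorem mem_sumsUpTo_one {F : Finset G} {g : G} (hg : g ∈ F) : g ∈ sumsUpTo F 1 := by
  refine Finset.mem_image.2 ⟨fun i => if i = ⟨g, hg⟩ then 1 else 0, ?_, ?_⟩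
  · rw [Fintype.mem_piFinset]
    intro i
    rw [Finset.mem_range]
    split_ifs <;> omega
  · simp [ite_smul]

theorem add_mem_sumsUpTo {F : Finset G} {m n : ℕ} {g h : G} (hg : g ∈ sumsUpTo F m)
    (hh : h ∈ sumsUpTo F n) : g + h ∈ sumsUpTo F (m + n) := by
  obtain ⟨c, hc, rfl⟩ := Finset.mem_image.1 hg
  obtain ⟨e, he, rfl⟩ := Finset.mem_image.1 hh
  refine Finset.mem_image.2 ⟨c + e, ?_, ?_⟩
  · rw [Fintype.mem_piFinset] at hc he ⊢
    intro i
    have h1 := Finset.mem_range.1 (hc i)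
    have h2 := Finset.mem_range.1 (he i)
    rw [Finset.mem_range, Pi.add_apply]
    omega
  · simp [add_smul, Finset.sum_add_distrib]

end Graded

namespace Semigraph

variable {k : Type v} {T : Type u} {S : Semigraph k T}

variable (S) in
/-- The degree of the word `s p t*`. -/
def wordDeg (s t : T) : k → ℤ := fun i => (S.d s i : ℤ) - S.d t i

theorem wordDeg_of_prodRel {s t s' t' a b : T} (h : S.ProdRel s t s' t' a b) :
    S.wordDeg a b = S.wordDeg s t + S.wordDeg s' t' := by
  obtain ⟨e, f, g, h1, h2, -, h4, h5⟩ := h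
  ext i
  have h6 := congrFun ((S.d_mul _ _ _ h1).symm.trans (S.d_mul _ _ _ h2)) i
  have h7 := congrFun (S.d_mul _ _ _ h4) i
  have h8 := congrFun (S.d_mul _ _ _ h5) i
  simp only [wordDeg, Pi.add_apply] at h6 h7 h8 ⊢
  omega

theorem rep_mem_shiftBy (hid : S.IdemZero) {g : k → ℤ} {x : S.FreeAlg}
    (hx : x ∈ S.wordSpan fun s t => S.wordDeg s t = g) :
    (tailAction hid).rep x ∈ shiftBy S.tailDeg g := by
  refine rep_mem_coeffIn hid ?_ hx
  rintro s l t u v rfl h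
  obtain ⟨c, _, h1, h2⟩ := (tailAction hid).wordPEquiv_eq_some.1 h
  rw [tailDeg_act hid h1, tailDeg_act hid h2]
  ext i
  simp only [wordDeg, Pi.add_apply]
  ring

/-! ### Domination of arbitrary representations on the whole algebra -/

section Upper

variable (hid : S.IdemZero) (hS : S.FinitelyAligned) {A : Type*} [NonUnitalCStarAlgebra A]
  (ψ : S.FreeAlg →⋆ₙₐ[ℂ] A)

include hid hS

/-- For homogeneous x, the element x*x has degree zero and lies in the core, so the C⋆-identity
reduces the estimate to the core. -/
theorem norm_le_of_homogeneous {g : k → ℤ} {x : S.FreeAlg}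
    (hx : x ∈ S.wordSpan fun s t => S.wordDeg s t = g) : ‖ψ x‖ ≤ ‖(tailAction hid).rep x‖ := by
  have hstar : star x ∈ S.wordSpan fun s t => S.wordDeg s t = -g := by
    refine star_mem_wordSpan hid hS ?_ hx
    rintro s t rfl
    ext i
    simp [wordDeg]
  have hmul : star x * x ∈ S.wordSpan fun s t => S.d s = S.d t := by
    refine mul_mem_wordSpan hid hS ?_ hstar hx
    intro s t s' t' a b h1 h2 h3
    have h4 := wordDeg_of_prodRel h3
    rw [h1, h2, neg_add_cancel] at h4
    ext i
    have h5 := congrFun h4 i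
    simp only [wordDeg, Pi.zero_apply] at h5
    omega
  have h := norm_le_of_mem_core hid hS ψ hmul
  rw [map_mul, map_star, map_mul, map_star, norm_star_mul_op, CStarRing.norm_star_mul_self] at h
  exact abs_le_of_sq_le_sq' (by rwa [pow_two, pow_two]) (norm_nonneg _) |>.2

theorem norm_le_card_mul {F : Finset (k → ℤ)} {x : S.FreeAlg}
    (hx : x ∈ S.wordSpan fun s t => ∃ g ∈ F, S.wordDeg s t = g) :
    ‖ψ x‖ ≤ F.card * ‖(tailAction hid).rep x‖ := by
  obtain ⟨f, hf, rfl⟩ := exists_eq_sum_of_mem_wordSpan (p := fun g s t => S.wordDeg s t = g) hx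
  rw [map_sum, map_sum, ← nsmul_eq_mul]
  refine (norm_sum_le _ _).trans (Finset.sum_le_card_nsmul _ _ _ fun g hg => ?_)
  exact (norm_le_of_homogeneous hid hS ψ (hf g)).trans (norm_le_norm_sum_shiftBy
    (A := fun g => (tailAction hid).rep (f g)) (fun g _ => rep_mem_shiftBy hid (hf g)) hg)

/-- Any representation is dominated by the representation on tail sets. -/
theorem norm_le_norm_rep (x : S.FreeAlg) : ‖ψ x‖ ≤ ‖(tailAction hid).rep x‖ := by
  have hx : star x * x ∈ S.wordSpan (fun _ _ => True) := by
    rw [wordSpan_eq_top hid hS]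
    trivial
  obtain ⟨H, hH⟩ := exists_finset_of_mem_wordSpan hx
  set F := H.image fun c => S.wordDeg c.1 c.2
  -- Degrees add under products, so the degrees in the j-th iterated square are sums in which each
  -- degree of x*x is used at most 2^j times.
  have hiter : ∀ j, iterSq x j ∈
      S.wordSpan fun s t => ∃ g ∈ sumsUpTo F (2 ^ j), S.wordDeg s t = g := by
    intro j
    induction j with
    | zero =>
      refine wordSpan_mono (fun s t h => ⟨_, mem_sumsUpTo_one ?_, rfl⟩) hH
      exact Finset.mem_image_of_mem (fun c : T × T => S.wordDeg c.1 c.2) h.2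
    | succ j ih =>
      refine mul_mem_wordSpan hid hS ?_ ih ih
      rintro s t s' t' a b ⟨g, hg, hst⟩ ⟨g', hg', hst'⟩ h
      refine ⟨g + g', ?_, by rw [wordDeg_of_prodRel h, hst, hst']⟩
      rw [pow_succ, mul_two]
      exact add_mem_sumsUpTo hg hg'
  have hC : ∀ z : S.FreeAlg, ‖(tailAction hid).rep (star z * z)‖ = ‖(tailAction hid).rep z‖ ^ 2 := by
    intro z
    rw [map_mul, map_star, norm_star_mul_op, pow_two]
  -- The number of degrees is at most (2^j + 1)^|F| ≤ 2^|F| (2^j)^|F|, which accounts for the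
  -- constant and the exponent.
  refine norm_le_of_iterSq ψ (fun z => ‖(tailAction hid).rep z‖) x (fun _ => norm_nonneg _) (hC x)
    (fun j => ?_) (K := 2 ^ F.card) (E := F.card) fun j => ?_
  · have := hC (iterSq x j)
    rwa [star_iterSq] at this
  · refine (norm_le_card_mul hid hS ψ (hiter j)).trans
      (mul_le_mul_of_nonneg_right ?_ (norm_nonneg _))
    rw [← mul_pow]
    have h1 : ((sumsUpTo F (2 ^ j)).card : ℝ) ≤ ((2 ^ j + 1 : ℕ) : ℝ) ^ F.card := by
      exact_mod_cast card_sumsUpTo_le F (2 ^ j)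
    refine h1.trans (pow_le_pow_left₀ (Nat.cast_nonneg _) ?_ _)
    have h2 : (1 : ℝ) ≤ 2 ^ j := one_le_pow₀ one_le_two
    push_cast
    linarith

/-- Any representation is dominated by each representation which does not vanish on nonzero
standard projections. -/
theorem norm_le_of_nonVanishing {B : Type*} [NonUnitalCStarAlgebra B] (φ : S.FreeAlg →⋆ₙₐ[ℂ] B)
    (hφ : NonVanishing S.freePair φ) (x : S.FreeAlg) : ‖ψ x‖ ≤ ‖φ x‖ :=
  (norm_le_norm_rep hid hS ψ x).trans (norm_rep_le_of_nonVanishing hid hS φ hφ x)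

omit ψ in
-- The lower bound together with faithfulness of Λ gives injectivity on all of X, which includes the
-- core.
theorem injective_of_nonVanishing (φ : S.FreeAlg →⋆ₙₐ[ℂ] A) (hφ : NonVanishing S.freePair φ) :
    Function.Injective φ := by
  refine (injective_iff_map_eq_zero φ).2 fun x hx => eq_of_rep_eq hid hS ?_
  have := norm_rep_le_of_nonVanishing hid hS φ hφ x
  rw [hx, norm_zero] at this
  rw [map_zero]
  exact norm_le_zero_iff.1 this

end Upper

end Semigraph

/-! ### Extension of representations by density -/

section Extension

variable {X : Type*} [NonUnitalRing X] [StarRing X] [Module ℂ X]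
  {A B : Type*} [NonUnitalCStarAlgebra A] [NonUnitalCStarAlgebra B]
  {f : X →⋆ₙₐ[ℂ] A} {g : X →⋆ₙₐ[ℂ] B}

theorem continuous_starAlgHom (Φ : A →⋆ₙₐ[ℂ] B) : Continuous Φ :=
  AddMonoidHomClass.continuous_of_bound Φ 1 fun a => by
    rw [one_mul]
    exact NonUnitalStarAlgHom.norm_apply_le Φ a

/-- The norm inequality makes f x ↦ g x well defined and contractive; multiplicativity and
compatibility with the star pass to the closure by continuity. -/
theorem exists_extension (hf : DenseRange f) (h : ∀ x, ‖g x‖ ≤ ‖f x‖) :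
    ∃ Φ : A →⋆ₙₐ[ℂ] B, ∀ x, Φ (f x) = g x := by
  let f' : X →ₗ[ℂ] A := { toFun := f, map_add' := map_add f, map_smul' := map_smul f }
  let g' : X →ₗ[ℂ] B := { toFun := g, map_add' := map_add g, map_smul' := map_smul g }
  let L : A →L[ℂ] B := g'.extendOfNorm f'
  have hL : ∀ x, L (f x) = g x :=
    LinearMap.extendOfNorm_eq (f := g') (e := f') hf ⟨1, fun x => by rw [one_mul]; exact h x⟩
  refine ⟨{ toFun := L, map_smul' := map_smul L, map_zero' := map_zero L, map_add' := map_add L,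
            map_mul' := fun a b => ?_, map_star' := fun a => ?_ }, hL⟩
  · refine hf.induction_on₂ (p := fun a b => L (a * b) = L a * L b)
      (isClosed_eq (by fun_prop) (by fun_prop)) (fun x y => ?_) a b
    rw [← map_mul, hL, hL, hL, map_mul]
  · refine hf.induction_on (p := fun a => L (star a) = star (L a)) a
      (isClosed_eq (by fun_prop) (by fun_prop)) fun x => ?_
    rw [← map_star, hL, hL, map_star]

theorem extension_unique (hf : DenseRange f) {Φ Ψ : A →⋆ₙₐ[ℂ] B} (h : ∀ x, Φ (f x) = Ψ (f x)) :
    Φ = Ψ :=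
  DFunLike.coe_injective
    (hf.equalizer (continuous_starAlgHom Φ) (continuous_starAlgHom Ψ) (funext h))

theorem existsUnique_extension (hf : DenseRange f) (h : ∀ x, ‖g x‖ ≤ ‖f x‖) :
    ∃! Φ : A →⋆ₙₐ[ℂ] B, ∀ x, Φ (f x) = g x := by
  obtain ⟨Φ, hΦ⟩ := exists_extension hf h
  exact ⟨Φ, hΦ, fun Ψ hΨ => extension_unique hf fun x => (hΨ x).trans (hΦ x).symm⟩

theorem exists_starAlgEquiv (hf : DenseRange f) (hg : DenseRange g) (h : ∀ x, ‖f x‖ = ‖g x‖) :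
    ∃ Φ : A ≃⋆ₐ[ℂ] B, ∀ x, Φ (f x) = g x := by
  obtain ⟨Φ, hΦ⟩ := exists_extension hf fun x => (h x).ge
  obtain ⟨Ψ, hΨ⟩ := exists_extension hg fun x => (h x).le
  have h1 : Function.LeftInverse Ψ Φ := by
    refine fun a => hf.induction_on (p := fun a => Ψ (Φ a) = a) a
      (isClosed_eq ((continuous_starAlgHom Ψ).comp (continuous_starAlgHom Φ)) continuous_id)
      fun x => ?_
    rw [hΦ, hΨ]
  have h2 : Function.RightInverse Ψ Φ := by
    refine fun b => hg.induction_on (p := fun b => Φ (Ψ b) = b) b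
      (isClosed_eq ((continuous_starAlgHom Φ).comp (continuous_starAlgHom Ψ)) continuous_id)
      fun x => ?_
    rw [hΨ, hΦ]
  exact ⟨StarAlgEquiv.ofBijective Φ ⟨h1.injective, h2.surjective⟩, hΦ⟩

end Extension

/-- The range of a representation is dense in a closed subalgebra generated by elements of its
range. -/
theorem denseRange_codRestrict {X : Type*} [NonUnitalRing X] [StarRing X] [Module ℂ X]
    {A : Type u} [NonUnitalCStarAlgebra A] (f : X →⋆ₙₐ[ℂ] A) {s : Set A} (hs : s ⊆ Set.range f)
    (h : ∀ x, f x ∈ cstarClosure s) :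
    DenseRange (NonUnitalStarAlgHom.codRestrict f (cstarClosure s) h) := by
  have hle : NonUnitalStarAlgebra.adjoin ℂ s ≤ NonUnitalStarAlgHom.range f :=
    NonUnitalStarAlgebra.adjoin_le hs
  rintro ⟨a, ha⟩
  rw [closure_subtype]
  refine closure_mono ?_ (show a ∈ closure (NonUnitalStarAlgebra.adjoin ℂ s : Set A) from ha)
  intro b hb
  obtain ⟨x, rfl⟩ := hle hb
  exact ⟨_, ⟨x, rfl⟩, rfl⟩

theorem denseRange_universalRep {X : Type u} [NonUnitalRing X] [StarRing X] [Module ℂ X]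
    (hX : CStarBounded X) : DenseRange (universalRep hX) :=
  denseRange_codRestrict (productRep hX) subset_rfl _

theorem hom_eq_zero_of_universalRep_eq_zero {X : Type u} [NonUnitalRing X] [StarRing X]
    [Module ℂ X] {hX : CStarBounded X} {x : X} (h : universalRep hX x = 0) (ρ : CStarRep X) :
    ρ.hom x = 0 := by
  have h1 : productRep hX x = 0 := congrArg Subtype.val h
  exact congrFun (congrArg Subtype.val h1) ρ

namespace Semigraph

variable {k : Type v} {T : Type u} {S : Semigraph k T}

/-! ### The left regular representation -/

theorem deltaAction_act_eq_some (hid : S.IdemZero) {x : T} {p q : S.DeltaType} :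
    (deltaAction hid).act x p = some q ↔
      (∃ y z, p = .inl y ∧ q = .inl z ∧ S.mul x y = some z) ∨
      (∃ y z, p = .inr y ∧ q = .inr z ∧ S.mul x y.1.1 = some z.1.1 ∧ z.1.2 = y.1.2) :=
  deltaMul_inl_eq_some

theorem deltaAction_act_inr (hid : S.IdemZero) {x : T} {p q : T × List T}
    {hp : ∃ a ∈ p.2, S.le p.1 a} {hq : ∃ a ∈ q.2, S.le q.1 a} :
    (deltaAction hid).act x (.inr ⟨p, hp⟩) = some (.inr ⟨q, hq⟩) ↔
      S.mul x p.1 = some q.1 ∧ q.2 = p.2 := by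
  refine (deltaAction_act_eq_some hid).trans ⟨?_, fun h => .inr ⟨_, _, rfl, rfl, h.1, h.2⟩⟩
  rintro (⟨y, z, h, -⟩ | ⟨y, z, h1, h2, h3⟩)
  · cases h
  · cases h1
    cases h2
    exact h3

theorem rep_deltaAction_mem (hid : S.IdemZero) (x : S.FreeAlg) :
    (deltaAction hid).rep x ∈ leftReducedCStar S.Delta := by
  induction x using PresentedStarAlgebra.ind with | _ a
  induction a with
  | gen t =>
    refine subset_cstarClosure _ ⟨.inl t, ?_⟩
    rw [leftRegular_eq_shiftOp hid]
    exact (PartialAction.rep_ι _ t).symm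
  | zero => exact zero_mem _
  | add a b ha hb => exact add_mem ha hb
  | neg a ha => exact neg_mem ha
  | smul z a ha => exact SMulMemClass.smul_mem z ha
  | mul a b ha hb => exact mul_mem ha hb
  | adj a ha => exact star_mem ha

/-- The representation of the freely generated semigraph algebra on `ℓ²(Δ)`. -/
def regularRep (hid : S.IdemZero) : S.FreeAlg →⋆ₙₐ[ℂ] leftReducedCStar S.Delta :=
  NonUnitalStarAlgHom.codRestrict (deltaAction hid).rep (leftReducedCStar S.Delta)
    (rep_deltaAction_mem hid)

theorem regularRep_ι (hid : S.IdemZero) (t : T) :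
    (regularRep hid (S.ι t) : Ell2 S.DeltaType →L[ℂ] Ell2 S.DeltaType) =
      leftRegular S.Delta (.inl t) := by
  rw [leftRegular_eq_shiftOp hid]
  exact PartialAction.rep_ι _ t

theorem denseRange_regularRep (hid : S.IdemZero) : DenseRange (regularRep hid) := by
  refine denseRange_codRestrict _ ?_ _
  rintro _ ⟨t | q, rfl⟩
  · exact ⟨S.ι t, regularRep_ι hid t⟩
  · exact ⟨0, by rw [map_zero, leftRegular_inr]⟩

/-- The symbol s μ_{s, l} of Δ imitates the minimal point (R, s), where R is the tail set generated
by s and l: products with such symbols stay in Δ exactly as long as they are right factors of s or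
of an element of l. It therefore lies in the support of every nonzero standard projection led by s
and l. -/
theorem nonVanishing_regularRep (hid : S.IdemZero) (hS : S.FinitelyAligned) :
    NonVanishing S.freePair (regularRep hid) := by
  intro p hp hne h0
  obtain ⟨s, l, Y, rfl⟩ := eq_stdProj_of_mem hid hS hp hne
  obtain ⟨hl, hmem, hY⟩ := exists_point_of_ne_zero hid hS hne
  have hs : ∃ a ∈ s :: l, S.le s a := ⟨s, List.mem_cons_self, le_refl' hid s⟩
  obtain ⟨q, hq'⟩ : ∃ q : S.DeltaType, q = .inr ⟨(s, s :: l), hs⟩ := ⟨_, rfl⟩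
  have hq : q ∈ (deltaAction hid).supp s l Y := by
    have hsrc : ∃ a ∈ s :: l, S.le (S.src s) a := ⟨s, List.mem_cons_self, s, hid.mul_src s⟩
    refine ⟨⟨.inr ⟨(S.src s, s :: l), hsrc⟩, fun r hr => ?_, ?_⟩, fun y hy hran => ?_⟩
    · refine ⟨.inr ⟨(r, s :: l), r, List.mem_cons_of_mem _ hr, le_refl' hid r⟩, ?_⟩
      refine (deltaAction_act_inr hid).2 ⟨?_, rfl⟩
      rw [← hl r (List.mem_cons_of_mem _ hr)]
      exact hid.mul_src r
    · rw [hq']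
      exact (deltaAction_act_inr hid).2 ⟨hid.mul_src s, rfl⟩
    · refine hY y hy ((mem_ran_tail hid).2 ?_)
      obtain ⟨c, hc, hcq⟩ := hran
      rw [hq'] at hcq
      rcases (deltaAction_act_eq_some hid).1 hcq with ⟨_, _, _, h, _⟩ | ⟨⟨⟨c, l'⟩, hc'⟩, z, rfl, h, h1, h2⟩
      · cases h
      · cases h
        simp only at h1 h2
        subst h2
        refine ⟨c, h1, fun r hr => ?_⟩
        obtain ⟨v, hv⟩ := hc r hr
        rcases (deltaAction_act_eq_some hid).1 hv with ⟨_, _, h, _⟩ |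
          ⟨y', ⟨⟨z, l'⟩, hz⟩, h, rfl, h3, h4⟩
        · cases h
        · cases h
          simp only at h3 h4
          subst h4
          obtain ⟨a, ha, hza⟩ := hz
          exact ⟨z, ⟨a, List.mem_cons_of_mem _ ha, hza⟩, h3⟩
  have h1 : (deltaAction hid).rep (S.stdProj s l Y) = 0 := congrArg Subtype.val h0
  rw [PartialAction.rep_stdProj_supp] at h1
  have h2 := indicatorOp_delta ((deltaAction hid).supp s l Y) q
  rw [if_pos hq, h1] at h2
  exact delta_ne_zero _ h2.symm

/-- The representation on ℓ²(Δ) is among those entering the universal product, so whatever dies in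
𝒬(T) dies there too. -/
theorem nonVanishing_toQ (hid : S.IdemZero) (hS : S.FinitelyAligned) :
    NonVanishing S.freePair S.toQ := by
  intro p hp hne h0
  exact nonVanishing_regularRep hid hS p hp hne
    (hom_eq_zero_of_universalRep_eq_zero h0 ⟨_, regularRep hid⟩)

end Semigraph

end SemigraphCStar

end

open SemigraphCStar in
theorem mainTheorem1 {k : Type v} {T : Type u} (S : Semigraph k T)
    (hS : S.FinitelyAligned) (hid : ∀ e, S.d e = 0 → S.mul e e = some e) :
    Function.Injective S.ι ∧
    S.freePair.IsSemigraphAlgebra ∧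
    S.freePair.IsFree ∧
    S.freePair.IsWeaklyFree ∧
    S.freePair.IsCancelling ∧
    CuntzKriegerUniqueness.{u, w, v} S.freePair S.freeAlg_cstarBounded ∧
    IsUniversalRep.{u, u + 1, w} S.toQ ∧
    ∃ φ : S.FreeAlg →⋆ₙₐ[ℂ] leftReducedCStar S.Delta,
      (∀ t, (φ (S.ι t) : lp (fun _ : S.DeltaType => ℂ) 2 →L[ℂ] lp (fun _ : S.DeltaType => ℂ) 2) =
        leftRegular S.Delta (Sum.inl t)) ∧
      DenseRange φ ∧
      NonVanishing S.freePair φ ∧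
      InjectiveOnCore S.freePair φ ∧
      IsUniversalRep.{u, u, w} φ ∧
      ∃ Φ : S.Q ≃⋆ₐ[ℂ] leftReducedCStar S.Delta, ∀ x, Φ (S.toQ x) = φ x := by
  have hφ := Semigraph.nonVanishing_regularRep hid hS
  have hπ := Semigraph.nonVanishing_toQ hid hS
  have hφd := Semigraph.denseRange_regularRep hid
  have hπd := denseRange_universalRep S.freeAlg_cstarBounded
  refine ⟨Semigraph.ι_injective hid, Semigraph.isSemigraphAlgebra hid hS,
    Semigraph.isFree hid hS, Semigraph.isWeaklyFree hid hS, Semigraph.isCancelling hid hS,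
    ⟨(Semigraph.injective_of_nonVanishing hid hS _ hπ).injOn, hπ, fun A _ ψ hψ hψd => ?_⟩,
    fun A _ ψ => existsUnique_extension hπd (Semigraph.norm_le_of_nonVanishing hid hS ψ _ hπ),
    Semigraph.regularRep hid, Semigraph.regularRep_ι hid, hφd, hφ,
    (Semigraph.injective_of_nonVanishing hid hS _ hφ).injOn,
    fun A _ ψ => existsUnique_extension hφd (Semigraph.norm_le_of_nonVanishing hid hS ψ _ hφ), ?_⟩
  -- Two representations that do not vanish on standard projections dominate each other, hence are
  -- isometric to one another on X; with dense images they extend to an isomorphism.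
  · exact exists_starAlgEquiv hπd hψd fun x => le_antisymm
      (Semigraph.norm_le_of_nonVanishing hid hS _ ψ hψ x)
      (Semigraph.norm_le_of_nonVanishing hid hS ψ _ hπ x)
  · exact exists_starAlgEquiv hπd hφd fun x => le_antisymm
      (Semigraph.norm_le_of_nonVanishing hid hS _ _ hφ x)
      (Semigraph.norm_le_of_nonVanishing hid hS _ _ hπ x)
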